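/- Let $N,n\ge 1$ be integers and $\sigma>0$. Write $h_m(x_1,\dots,x_m)=\prod_{1\le j<k\le m}(x_k-x_j)$, and let $$H_\ell(z)=\ell!\sum_{k=0}^{\lfloor \ell/2\rfloor}\frac{(-1)^k(2z)^{\ell-2k}}{k!\,(\ell-2k)!},\qquad L^\nu_\ell(z)=\sum_{k=0}^{\ell}\frac{(-1)^k\,\Gamma(\ell+\nu+1)\,z^k}{\Gamma(k+\nu+1)\,(\ell-k)!\,k!}$$ be the Hermite and Laguerre polynomials. All Gaussian variables below are centred. Consider the following averages, for $\alpha=(\alpha_1,\dots,\alpha_m)\in\mathbb C^{m}$. * $M_{\rm GUE}(m,\alpha;N,\sigma^2)=\big\langle\prod_{k=1}^m\det(\alpha_kI_N-H)\big\rangle$, where $H$ is an $N\times N$ GUE matrix of variance $\sigma^2$ (a Hermitian Gaussian matrix with density proportional to $e^{-\operatorname{tr}H^2/2\sigma^2}$). * For real $\nu>-1$, $M^{(\nu)}(m,\alpha;N,\sigma^2)=\mathbb E\big[\prod_{k=1}^m\prod_{j=1}^N(\alpha_k-X_j)\big]$, that is, $$M^{(\nu)}(m,\alpha;N,\sigma^2)=\frac1{N!}\int_{[0,\infty)^N}\prod_{k=1}^m\prod_{j=1}^N(\alpha_k-x_j)\;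 \frac{\sigma^{-2N(N+\nu)}}{2^{N(N+\nu)}\prod_{j=1}^N\Gamma(j)\Gamma(j+\nu)}\prod_{j=1}^N x_j^\nu e^{-x_j/2\sigma^2}\;h_N(x)^2\,dx .$$ * For an integer $\nu\ge0$, $M^{(\nu)}_{\rm chGUE}(m,\alpha;N,\sigma^2)=\big\langle\prod_{k=1}^m\det(\alpha_kI_N-M^\dagger M)\big\rangle$, where $M$ is an $(N+\nu)\times N$ complex matrix whose entries have independent Gaussian real and imaginary parts of variance $\sigma^2$. * $M_{\rm classC}(m,\alpha;2N,\sigma^2)$ and $M_{\rm classD}(m,\alpha;2N,\sigma^2)$ are the averages $\big\langle\prod_{k=1}^m\det(\alpha_kI_{2N}-H)\big\rangle$, where $H$ is a Gaussian random element of the space of $2N\times2N$ Hermitian matrices lying in $\mathfrak{sp}(2N,\mathbb C)$ (class C), respectively in $\mathfrak{so}(2N,\mathbb C)$ (class D), with density proportional to $e^{-\operatorname{tr}H^2/4\sigma^2}$. Then all these averages exist, and for every $\alpha\in\mathbb C^{2n}$ $$M_{\rm GUE}(2n,\alpha;N,\sigma^2)=\frac{\gamma_{N,2n}\,\sigma^{n(2N+n)}}{h_n(\alpha_1,\dots,\alpha_n)\,h_n(\alpha_{n+1},\dots,\alpha_{2n})}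 \det_{1\le j,k\le n}\left[\frac1{\alpha_j-\alpha_{n+k}}\begin{vmatrix}H_{N+n}\big(\tfrac{\alpha_j}{\sqrt{2\sigma^2}}\big)&H_{N+n}\big(\tfrac{\alpha_{n+k}}{\sqrt{2\sigma^2}}\big)\\ H_{N+n-1}\big(\tfrac{\alpha_j}{\sqrt{2\sigma^2}}\big)&H_{N+n-1}\big(\tfrac{\alpha_{n+k}}{\sqrt{2\sigma^2}}\big)\end{vmatrix}\right],$$ $$\gamma_{N,2n}=2^{-n(2N+2n-1)/2}\prod_{\ell=2}^n\frac{(N+n-\ell)!}{(N+n-1)!},$$ and for every real $\nu>-1$ $$M^{(\nu)}(2n,\alpha;N,\sigma^2)=\frac{\gamma^{(\nu)}_{N,2n}\,(2\sigma^2)^{n(2N+n)}}{h_n(\alpha_1,\dots,\alpha_n)\,h_n(\alpha_{n+1},\dots,\alpha_{2n})} \det_{1\le j,k\le n}\left[\frac1{\alpha_j-\alpha_{n+k}}\begin{vmatrix}L^\nu_{N+n}\big(\tfrac{\alpha_j}{2\sigma^2}\big)&L^\nu_{N+n}\big(\tfrac{\alpha_{n+k}}{2\sigma^2}\big)\\ L^\nu_{N+n-1}\big(\tfrac{\alpha_j}{2\sigma^2}\big)&L^\nu_{N+n-1}\big(\tfrac{\alpha_{n+k}}{2\sigma^2}\big)\end{vmatrix}\right],$$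 $$\gamma^{(\nu)}_{N,2n}=(-1)^n\left(\frac{(N+n)!}{\Gamma(N+n+\nu)}\right)^{n-1}\prod_{\ell=1}^{n-1}\Gamma(N+\nu+\ell)\prod_{m=1}^{n+1}(N+m-1)!.$$ Denote the last right-hand side by $R^{(\nu)}(\alpha)$. Moreover $$M^{(\nu)}_{\rm chGUE}(2n,\alpha;N,\sigma^2)=R^{(\nu)}(\alpha)\quad(\nu\in\{0,1,2,\dots\}),$$ $$M_{\rm classC}(2n,\alpha;2N,\sigma^2)=R^{(1/2)}(\alpha_1^2,\dots,\alpha_{2n}^2),\qquad M_{\rm classD}(2n,\alpha;2N,\sigma^2)=R^{(-1/2)}(\alpha_1^2,\dots,\alpha_{2n}^2).$$ At points $\alpha$ where two of the arguments ($\alpha_i$, or $\alpha_i^2$ for class C and D) coincide, so that a denominator may vanish, the right-hand sides are understood as their limits through points with pairwise distinct arguments. -/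

import Mathlib

open MeasureTheory ProbabilityTheory Filter Topology Matrix
open scoped Nat

noncomputable section

/-! ### Polynomials and constants -/

/-- The (physicists') Hermite polynomial
`H_l(z) = l! ∑_{k ≤ l/2} (-1)^k (2z)^(l-2k) / (k! (l-2k)!)`. -/
def hermiteH (l : ℕ) (z : ℂ) : ℂ :=
  (l ! : ℂ) * ∑ k ∈ Finset.range (l / 2 + 1),
    (-1) ^ k * (2 * z) ^ (l - 2 * k) / ((k ! : ℂ) * ((l - 2 * k)! : ℂ))

/-- The Laguerre polynomial
`L_l^ν(z) = ∑_{k ≤ l} (-1)^k Γ(l+ν+1) z^k / (Γ(k+ν+1) (l-k)! k!)`. -/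
def laguerreL (ν : ℝ) (l : ℕ) (z : ℂ) : ℂ :=
  ∑ k ∈ Finset.range (l + 1),
    (-1) ^ k * ((Real.Gamma (l + ν + 1) : ℝ) : ℂ) * z ^ k /
      (((Real.Gamma (k + ν + 1) : ℝ) : ℂ) * ((l - k)! : ℂ) * (k ! : ℂ))

/-- The product of differences `h_m(x) = ∏_{i < j} (x_j - x_i)`. -/
def diffProd {R : Type*} [CommRing R] {m : ℕ} (x : Fin m → R) : R :=
  ∏ i : Fin m, ∏ j ∈ Finset.Ioi i, (x j - x i)

/-- The constant `γ_{N,2n}` of the Hermite case. -/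
def gammaHermite (N n : ℕ) : ℝ :=
  (2 : ℝ) ^ (-((n : ℝ) * (2 * N + 2 * n - 1)) / 2) *
    ∏ l ∈ Finset.Icc 2 n, (((N + n - l)! : ℝ) / ((N + n - 1)! : ℝ))

/-- The constant `γ_{N,2n}^{(ν)}` of the Laguerre case. -/
def gammaLaguerre (ν : ℝ) (N n : ℕ) : ℝ :=
  (-1) ^ n * (((N + n)! : ℝ) / Real.Gamma (N + n + ν)) ^ (n - 1) *
    (∏ l ∈ Finset.Icc 1 (n - 1), Real.Gamma (N + ν + l)) *
    ∏ m ∈ Finset.Icc 1 (n + 1), ((N + m - 1)! : ℝ)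

/-- The first half `(α_1, …, α_n)` of a vector of length `2n`. -/
def firstHalf {n : ℕ} (α : Fin (n + n) → ℂ) : Fin n → ℂ := fun j => α (Fin.castAdd n j)

/-- The second half `(α_{n+1}, …, α_{2n})` of a vector of length `2n`. -/
def secondHalf {n : ℕ} (α : Fin (n + n) → ℂ) : Fin n → ℂ := fun k => α (Fin.natAdd n k)

/-- The Hermite determinantal expression. -/
def hermiteExpr (N n : ℕ) (σ : ℝ) (α : Fin (n + n) → ℂ) : ℂ :=
  (gammaHermite N n : ℂ) * (σ : ℂ) ^ (n * (2 * N + n)) /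
      (diffProd (firstHalf α) * diffProd (secondHalf α)) *
    (Matrix.of fun j k : Fin n =>
      1 / (firstHalf α j - secondHalf α k) *
        !![hermiteH (N + n) (firstHalf α j / (√(2 * σ ^ 2) : ℝ)),
              hermiteH (N + n) (secondHalf α k / (√(2 * σ ^ 2) : ℝ));
            hermiteH (N + n - 1) (firstHalf α j / (√(2 * σ ^ 2) : ℝ)),
              hermiteH (N + n - 1) (secondHalf α k / (√(2 * σ ^ 2) : ℝ))].det).det

/-- The Laguerre determinantal expression. -/
def laguerreExpr (ν : ℝ) (N n : ℕ) (σ : ℝ) (α : Fin (n + n) → ℂ) : ℂ :=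
  (gammaLaguerre ν N n : ℂ) * (2 * (σ : ℂ) ^ 2) ^ (n * (2 * N + n)) /
      (diffProd (firstHalf α) * diffProd (secondHalf α)) *
    (Matrix.of fun j k : Fin n =>
      1 / (firstHalf α j - secondHalf α k) *
        !![laguerreL ν (N + n) (firstHalf α j / (2 * (σ : ℂ) ^ 2)),
              laguerreL ν (N + n) (secondHalf α k / (2 * (σ : ℂ) ^ 2));
            laguerreL ν (N + n - 1) (firstHalf α j / (2 * (σ : ℂ) ^ 2)),
              laguerreL ν (N + n - 1) (secondHalf α k / (2 * (σ : ℂ) ^ 2))].det).det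

/-! ### Gaussian random matrices -/

/-- The law of a family of independent real Gaussian variables of mean `0` and variance `σ²`. -/
def iidGaussian (ι : Type) [Fintype ι] (σ : ℝ) : Measure (ι → ℝ) :=
  Measure.pi fun _ : ι => gaussianReal 0 (σ ^ 2).toNNReal

/-- Index set of the real and imaginary parts of the entries of a `p × q` complex matrix. -/
abbrev EntryIdx (p q : ℕ) : Type := (Fin p × Fin q) ⊕ (Fin p × Fin q)

/-- The complex matrix with the given real and imaginary parts of its entries. -/
def cplxMatrix {p q : ℕ} (g : EntryIdx p q → ℝ) : Matrix (Fin p) (Fin q) ℂ :=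
  Matrix.of fun i j => (g (Sum.inl (i, j)) : ℂ) + (g (Sum.inr (i, j)) : ℂ) * Complex.I

/-- The Hermitian part `(Z + Z†)/2`. If `g` has law `iidGaussian _ σ`, this is the GUE matrix of
variance `σ²`: its density is proportional to `exp (- tr H² / (2σ²))`, that is, the diagonal
entries have variance `σ²`, and the real and imaginary parts of the entries above the diagonal have
variance `σ²/2`, all independent. -/
def hermitianMatrix {N : ℕ} (g : EntryIdx N N → ℝ) : Matrix (Fin N) (Fin N) ℂ :=
  (1 / 2 : ℂ) • (cplxMatrix g + (cplxMatrix g)ᴴ)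

/-- The complex symmetric part `(Z + Zᵀ)/2`. -/
def symmetricMatrix {N : ℕ} (g : EntryIdx N N → ℝ) : Matrix (Fin N) (Fin N) ℂ :=
  (1 / 2 : ℂ) • (cplxMatrix g + (cplxMatrix g)ᵀ)

/-- The elements `[A, B; B†, -Aᵀ]` (`A` Hermitian, `B` complex symmetric) of
`𝔰𝔭(2N, ℂ) ∩ Hermitian`. If `g` has law `iidGaussian _ σ`, this is the class C matrix of variance
`σ²`: its density is proportional to `exp (- tr H² / (4σ²))`. -/
def classCMatrix {N : ℕ} (g : EntryIdx N N ⊕ EntryIdx N N → ℝ) :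
    Matrix (Fin N ⊕ Fin N) (Fin N ⊕ Fin N) ℂ :=
  Matrix.fromBlocks (hermitianMatrix fun i => g (Sum.inl i)) (symmetricMatrix fun i => g (Sum.inr i))
    (symmetricMatrix fun i => g (Sum.inr i))ᴴ (-(hermitianMatrix fun i => g (Sum.inl i))ᵀ)

/-- The elements `i (X - Xᵀ)/√2` (`X` real) of `𝔰𝔬(2N, ℂ) ∩ Hermitian`. If `g` has law
`iidGaussian _ σ`, this is the class D matrix of variance `σ²`: its density is proportional to
`exp (- tr H² / (4σ²))`. -/
def classDMatrix {N : ℕ} (g : Fin (2 * N) × Fin (2 * N) → ℝ) :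
    Matrix (Fin (2 * N)) (Fin (2 * N)) ℂ :=
  Matrix.of fun i j => Complex.I * (((g (i, j) - g (j, i)) / √2 : ℝ) : ℂ)

lemma hermitianMatrix_isHermitian {N : ℕ} (g : EntryIdx N N → ℝ) :
    (hermitianMatrix g).IsHermitian := by
  ext i j
  simp [hermitianMatrix, cplxMatrix]
  ring

lemma classCMatrix_mem {N : ℕ} (g : EntryIdx N N ⊕ EntryIdx N N → ℝ) :
    (classCMatrix g).IsHermitian ∧ classCMatrix g ∈ LieAlgebra.Symplectic.sp (Fin N) ℂ := by
  have hA := hermitianMatrix_isHermitian fun i => g (Sum.inl i)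
  have hB : (symmetricMatrix fun i => g (Sum.inr i))ᵀ = symmetricMatrix fun i => g (Sum.inr i) := by
    simp [symmetricMatrix, add_comm]
  constructor
  · refine Matrix.IsHermitian.fromBlocks hA rfl ?_
    exact hA.transpose.neg
  · rw [LieAlgebra.Symplectic.sp, mem_skewAdjointMatricesLieSubalgebra,
      mem_skewAdjointMatricesSubmodule]
    have hB' : (symmetricMatrix fun i => g (Sum.inr i))ᴴᵀ =
        (symmetricMatrix fun i => g (Sum.inr i))ᴴ := by
      conv_rhs => rw [← hB]
      rfl
    simp [Matrix.IsSkewAdjoint, Matrix.IsAdjointPair, classCMatrix, Matrix.J,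
      Matrix.fromBlocks_transpose, Matrix.fromBlocks_multiply, Matrix.fromBlocks_neg, hB, hB']

lemma classDMatrix_mem {N : ℕ} (g : Fin (2 * N) × Fin (2 * N) → ℝ) :
    (classDMatrix g).IsHermitian ∧ classDMatrix g ∈ LieAlgebra.Orthogonal.so (Fin (2 * N)) ℂ := by
  constructor
  · ext i j
    simp [classDMatrix]
    ring
  · rw [LieAlgebra.Orthogonal.mem_so]
    ext i j
    simp [classDMatrix]
    ring

/-! ### Averages of products of characteristic polynomials -/

/-- `∏_k det (α_k I - H)`. -/
def charProd {ι : Type} [Fintype ι] [DecidableEq ι] {m : ℕ} (α : Fin m → ℂ) (H : Matrix ι ι ℂ) : ℂ :=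
  ∏ k : Fin m, (α k • (1 : Matrix ι ι ℂ) - H).det

/-- `⟨∏_k det (α_k I_N - H)⟩` over the GUE of `N × N` matrices of variance `σ²`. -/
def avgGUE {m : ℕ} (N : ℕ) (σ : ℝ) (α : Fin m → ℂ) : ℂ :=
  ∫ g, charProd α (hermitianMatrix g) ∂(iidGaussian (EntryIdx N N) σ)

/-- `⟨∏_k det (α_k I_N - M†M)⟩` over the chiral GUE of `(N+ν) × N` complex matrices, whose entries
have independent real and imaginary parts of variance `σ²`. -/
def avgChGUE {m : ℕ} (ν N : ℕ) (σ : ℝ) (α : Fin m → ℂ) : ℂ :=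
  ∫ g, charProd α ((cplxMatrix g)ᴴ * cplxMatrix g) ∂(iidGaussian (EntryIdx (N + ν) N) σ)

/-- `⟨∏_k det (α_k I_{2N} - H)⟩` over the class C ensemble of variance `σ²`. -/
def avgClassC {m : ℕ} (N : ℕ) (σ : ℝ) (α : Fin m → ℂ) : ℂ :=
  ∫ g, charProd α (classCMatrix g) ∂(iidGaussian (EntryIdx N N ⊕ EntryIdx N N) σ)

/-- `⟨∏_k det (α_k I_{2N} - H)⟩` over the class D ensemble of variance `σ²`. -/
def avgClassD {m : ℕ} (N : ℕ) (σ : ℝ) (α : Fin m → ℂ) : ℂ :=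
  ∫ g, charProd α (classDMatrix g) ∂(iidGaussian (Fin (2 * N) × Fin (2 * N)) σ)

/-- The density, on ordered configurations in `[0, ∞)^N`, of the Laguerre-type ensemble of real index
`ν > -1`. -/
def laguerreDensity (ν : ℝ) (N : ℕ) (σ : ℝ) (x : Fin N → ℝ) : ℝ :=
  σ ^ (-(2 * (N : ℝ) * (N + ν))) /
      ((2 : ℝ) ^ ((N : ℝ) * (N + ν)) *
        ∏ j ∈ Finset.Icc 1 N, Real.Gamma j * Real.Gamma (j + ν)) *
    (∏ j, x j ^ ν * Real.exp (-(x j) / (2 * σ ^ 2))) * diffProd x ^ 2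

/-- `∏_k ∏_j (α_k - x_j)` times the density of the Laguerre-type ensemble. -/
def laguerreIntegrand {m : ℕ} (ν : ℝ) (N : ℕ) (σ : ℝ) (α : Fin m → ℂ) (x : Fin N → ℝ) : ℂ :=
  (∏ k, ∏ j, (α k - (x j : ℂ))) * (laguerreDensity ν N σ x : ℂ)

/-- `M^{(ν)}(m, α; N, σ²)`, the expectation of `∏_k ∏_j (α_k - X_j)` in the Laguerre-type ensemble. -/
def avgLaguerre {m : ℕ} (ν : ℝ) (N : ℕ) (σ : ℝ) (α : Fin m → ℂ) : ℂ :=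
  1 / (N ! : ℂ) * ∫ x in {x : Fin N → ℝ | ∀ j, 0 ≤ x j}, laguerreIntegrand ν N σ α x

/-- `f = g` as functions on `ℂ^m`, where `g` is an expression whose denominators vanish outside `D`:
the two sides agree on `D`, and at every point `g` is extended by its limit through `D`. -/
def EqExtendedFrom {m : ℕ} (D : Set (Fin m → ℂ)) (f g : (Fin m → ℂ) → ℂ) : Prop :=
  (∀ α ∈ D, f α = g α) ∧ ∀ α, Tendsto g (𝓝[D] α) (𝓝 (f α))

end

/-! Let h be the Vandermonde product of the 2n spectral variables (of their squares for classes C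
and D), and M the average. Everything rests on one identity: h(α) M(α) = det [p_{N+i}(α_k)] with 0 ≤
i < 2n, where p_j are the monic Hermite or Laguerre polynomials (with argument α_k² for classes C
and D). The stated formulas then follow from the three-term recurrence alone.

For the Gaussian matrices the identity is a duality. Put D_k = det(x_k - H), a polynomial in x_k and
in the real Gaussian coordinates of H; for class C it is replaced by x_k D_k. There is a second
order operator T, a sum of one-variable operators a(x_k) ∂_k² + b ∂_k, with T(h ∏ D_k) = -h Δ(∏
D_k), where Δ is the Laplacian in the coordinates (`secondOrder_diffProd_mul_prod`). This needs T h
= 0, a formula for Δ D_k, and a formula for ∇D_k · ∇D_l; the last two are read off from the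
covariance tensor of the ensemble. Gaussian integration by parts turns the Euler field in the
coordinates into σ² Δ, and h ∏ D_k is homogeneous once x_k has the right weight w. Hence h M is an
eigenfunction of w ∑ x_k ∂_k - σ² T. The determinant of one-variable eigenpolynomials has the same
eigenvalue and the same top-degree part. On degree j the operator is w j up to lower-degree terms,
so the difference, which has lower degree, vanishes (`eq_zero_of_degLT_of_eigen`,
`diffProd_mul_partialExp_prod`).

For real ν the average is an integral over points, and h(α) ∏(α_k - x_j) h(x)² = h(x) h(x, α) is a
product of two determinants in orthogonal polynomials, integrated column by column
(`integral_det_mul_det`).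

Finally, `det_monicRec` writes p_N, …, p_{N+2n-1} as polynomial combinations of the middle pair
p_{N+n}, p_{N+n-1}. The transition matrix is triangular with explicit diagonal, and Lagrange
interpolation from the first half of the nodes to the second leaves an n × n determinant of
Christoffel–Darboux kernels. All averages are polynomials in α, hence continuous, which gives the
limits at coinciding arguments. -/

/-! ### Derivations and second order operators acting on determinants. -/

section DerivationDet

variable {R A : Type*} [CommRing R] [CommRing A] [Algebra R A]

theorem Derivation.map_prod_eq_sum {κ : Type*} [DecidableEq κ] (d : Derivation R A A)
    (s : Finset κ) (f : κ → A) :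
    d (∏ k ∈ s, f k) = ∑ k ∈ s, (∏ l ∈ s.erase k, f l) * d (f k) := by
  induction s using Finset.induction_on with
  | empty => simp
  | insert a s ha ih =>
    rw [Finset.prod_insert ha, Finset.sum_insert ha, Finset.erase_insert ha, d.leibniz, ih,
      smul_eq_mul, smul_eq_mul, Finset.mul_sum, add_comm]
    congr 1
    refine Finset.sum_congr rfl fun k hk => ?_
    have hak : a ≠ k := fun h => ha (h ▸ hk)
    rw [Finset.erase_insert_of_ne hak, Finset.prod_insert (fun h => ha (Finset.mem_of_mem_erase h)),
      mul_assoc]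

/-- Additive operators `T k`, each acting only on the `k`-th factor of products of the entries,
act on a determinant row by row. -/
theorem sum_apply_det {n : Type*} [Fintype n] [DecidableEq n] (T : n → A →+ A) (f : n → n → A)
    (hT : ∀ k (τ : Equiv.Perm n), T k (∏ l, f (τ l) l) =
      (∏ l ∈ Finset.univ.erase k, f (τ l) l) * T k (f (τ k) k)) :
    ∑ k, T k (Matrix.of f).det =
      ∑ i, ((Matrix.of f).updateRow i fun k => T k (f i k)).det := by
  simp only [Matrix.det_apply, map_sum]
  rw [Finset.sum_comm, Finset.sum_comm (s := Finset.univ (α := n))]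
  refine Finset.sum_congr rfl fun τ _ => ?_
  -- In the term of `τ`, column `k` carries row `τ k`; reindexing by `τ` turns the sum over columns
  -- into a sum over rows.
  refine Eq.trans ?_ (Equiv.sum_comp τ _)
  refine Finset.sum_congr rfl fun k _ => ?_
  rw [Units.smul_def, map_zsmul, Units.smul_def]
  congr 1
  have h1 := hT k τ
  simp only [Matrix.of_apply]
  rw [h1, ← Finset.mul_prod_erase _ _ (Finset.mem_univ k), mul_comm]
  congr 1
  · simp
  · refine Finset.prod_congr rfl fun l hl => ?_
    rw [Matrix.updateRow_ne (fun h => (Finset.ne_of_mem_erase hl) (τ.injective h))]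
    rfl

/-- Jacobi's formula for a derivation. -/
theorem Derivation.map_det {n : Type*} [Fintype n] [DecidableEq n] (d : Derivation R A A)
    (M : Matrix n n A) : d M.det = (M.adjugate * M.map d).trace := by
  have h : d M.det = ∑ i, (M.updateCol i fun k => d (M k i)).det := by
    simp only [Matrix.det_apply, map_sum]
    rw [Finset.sum_comm]
    refine Finset.sum_congr rfl fun τ _ => ?_
    rw [Units.smul_def, map_zsmul, Derivation.map_prod_eq_sum, Finset.smul_sum]
    refine Finset.sum_congr rfl fun k _ => ?_
    rw [Units.smul_def]
    congr 1
    rw [← Finset.mul_prod_erase _ _ (Finset.mem_univ k), mul_comm]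
    congr 1
    · simp
    · refine Finset.prod_congr rfl fun l hl => ?_
      rw [Matrix.updateCol_ne (Finset.ne_of_mem_erase hl)]
  rw [h, Matrix.trace]
  refine Finset.sum_congr rfl fun i _ => ?_
  rw [← Matrix.cramer_apply, Matrix.cramer_eq_adjugate_mulVec]
  simp [Matrix.mulVec, dotProduct, Matrix.mul_apply]

theorem Matrix.map_derivation_mul {l m n : Type*} [Fintype m] (d : Derivation R A A)
    (M : Matrix l m A) (N : Matrix m n A) :
    (M * N).map d = M * N.map d + M.map d * N := by
  ext i j
  simp [Matrix.mul_apply, Finset.sum_add_distrib, mul_comm]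

/-- Division-free form of d(M⁻¹) = -M⁻¹ (dM) M⁻¹: differentiate M · adj M = det M · 1 and multiply
by adj M on the left. -/
theorem det_smul_map_adjugate {n : Type*} [Fintype n] [DecidableEq n] (d : Derivation R A A)
    (M : Matrix n n A) :
    M.det • M.adjugate.map d =
      d M.det • M.adjugate - M.adjugate * M.map d * M.adjugate := by
  have h1 : (M * M.adjugate).map d = d M.det • (1 : Matrix n n A) := by
    rw [Matrix.mul_adjugate]
    ext i j
    by_cases hij : i = j <;> simp [hij]
  rw [Matrix.map_derivation_mul] at h1
  have h2 := congrArg (M.adjugate * ·) h1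
  simp only [mul_add, ← mul_assoc, Matrix.adjugate_mul, smul_mul_assoc, one_mul, mul_smul_comm,
    mul_one] at h2
  rw [← h2, add_sub_cancel_right]

/-- The operator `f ↦ a f'' + b f'`. -/
def secondOrder (d : Derivation R A A) (a b : A) : A →+ A where
  toFun f := a * d (d f) + b * d f
  map_zero' := by simp
  map_add' f g := by simp; ring

theorem secondOrder_apply (d : Derivation R A A) (a b f : A) :
    secondOrder d a b f = a * d (d f) + b * d f := rfl

theorem secondOrder_const_mul (d : Derivation R A A) (a b : A) {c : A} (hc : d c = 0) (f : A) :
    secondOrder d a b (c * f) = c * secondOrder d a b f := by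
  simp [secondOrder_apply, hc]
  ring

theorem Derivation.map_prod_eq_zero {κ : Type*} [DecidableEq κ] (d : Derivation R A A)
    (s : Finset κ) (f : κ → A) (h : ∀ k ∈ s, d (f k) = 0) : d (∏ k ∈ s, f k) = 0 := by
  rw [d.map_prod_eq_sum]
  exact Finset.sum_eq_zero fun k hk => by rw [h k hk, mul_zero]

theorem sum_secondOrder_det {n : Type*} [Fintype n] [DecidableEq n] (d : n → Derivation R A A)
    (a b : n → A) (f : n → n → A) (hf : ∀ k l i, l ≠ k → d k (f i l) = 0) :
    ∑ k, secondOrder (d k) (a k) (b k) (Matrix.of f).det =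
      ∑ i, ((Matrix.of f).updateRow i fun k => secondOrder (d k) (a k) (b k) (f i k)).det := by
  refine sum_apply_det (fun k => secondOrder (d k) (a k) (b k)) f fun k τ => ?_
  rw [← Finset.prod_erase_mul _ _ (Finset.mem_univ k)]
  exact secondOrder_const_mul _ _ _
    (Derivation.map_prod_eq_zero _ _ _ fun l hl => hf _ _ _ (Finset.ne_of_mem_erase hl)) _

theorem sum_secondOrder_det_of_eigen {n : Type*} [Fintype n] [DecidableEq n]
    (d : n → Derivation R A A) (a b : n → A) (f : n → n → A)
    (hf : ∀ k l i, l ≠ k → d k (f i l) = 0) (μ : n → A)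
    (h : ∀ i k, secondOrder (d k) (a k) (b k) (f i k) = μ i * f i k) :
    ∑ k, secondOrder (d k) (a k) (b k) (Matrix.of f).det = (∑ i, μ i) * (Matrix.of f).det := by
  rw [sum_secondOrder_det d a b f hf, Finset.sum_mul]
  refine Finset.sum_congr rfl fun i _ => ?_
  have : (fun k => secondOrder (d k) (a k) (b k) (f i k)) = μ i • (Matrix.of f) i := by
    ext k
    simp [h]
  rw [this, Matrix.det_updateRow_smul, Matrix.updateRow_eq_self]

/-- A row replaced by a multiple of another row gives a repeated row. With the rows X^(ρ i), whose
images under the spectral operator are multiples of lower rows, this is the harmonicity of the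
Vandermonde product. -/
theorem sum_secondOrder_det_of_shift {n : Type*} [Fintype n] [DecidableEq n]
    (d : n → Derivation R A A) (a b : n → A) (f : n → n → A)
    (hf : ∀ k l i, l ≠ k → d k (f i l) = 0)
    (h : ∀ i, (∀ k, secondOrder (d k) (a k) (b k) (f i k) = 0) ∨
      ∃ μ : A, ∃ j, j ≠ i ∧ ∀ k, secondOrder (d k) (a k) (b k) (f i k) = μ * f j k) :
    ∑ k, secondOrder (d k) (a k) (b k) (Matrix.of f).det = 0 := by
  rw [sum_secondOrder_det d a b f hf]
  refine Finset.sum_eq_zero fun i _ => ?_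
  obtain h0 | ⟨μ, j, hj, h1⟩ := h i
  · exact Matrix.det_eq_zero_of_row_eq_zero i (by simp [h0])
  · have : (fun k => secondOrder (d k) (a k) (b k) (f i k)) = μ • (Matrix.of f) j := by
      ext k
      simp [h1]
    rw [this, Matrix.det_updateRow_smul,
      Matrix.det_zero_of_row_eq (M := (Matrix.of f).updateRow i ((Matrix.of f) j)) hj.symm
        (by rw [Matrix.updateRow_self, Matrix.updateRow_ne hj]), mul_zero]

end DerivationDet

/-! ### Duality between the entry Laplacian and the spectral operator. -/

section Duality

variable {R A K : Type*} [CommRing R] [CommRing A] [Algebra R A] [Field K] (ψ : A →+* K)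

theorem Derivation.map_prod_eq_logDeriv {κ : Type*} (d : Derivation R A A) (s : Finset κ) (f : κ → A)
    (hf : ∀ k ∈ s, ψ (f k) ≠ 0) :
    ψ (d (∏ k ∈ s, f k)) = ψ (∏ k ∈ s, f k) * ∑ k ∈ s, ψ (d (f k)) / ψ (f k) := by
  classical
  induction s using Finset.induction_on with
  | empty => simp
  | insert a s ha ih =>
    have h0 := hf a (Finset.mem_insert_self a s)
    have ih' := ih fun k hk => hf k (Finset.mem_insert_of_mem hk)
    rw [Finset.prod_insert ha, Finset.sum_insert ha, d.leibniz, smul_eq_mul, smul_eq_mul,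
      map_add, map_mul, map_mul, ih', map_mul]
    field_simp
    ring

theorem Derivation.map_map_prod_eq_logDeriv {κ : Type*} [DecidableEq κ] (d : Derivation R A A)
    (s : Finset κ) (f : κ → A) (hf : ∀ k ∈ s, ψ (f k) ≠ 0) :
    ψ (d (d (∏ k ∈ s, f k))) = ψ (∏ k ∈ s, f k) *
      (∑ k ∈ s, ψ (d (d (f k))) / ψ (f k) +
        ∑ k ∈ s, ∑ l ∈ s.erase k, ψ (d (f k)) * ψ (d (f l)) / (ψ (f k) * ψ (f l))) := by
  -- The sum over ordered pairs of distinct indices is first written as a square minus a sum of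
  -- squares, a form that inserting one factor changes in a simple way.
  have key : ψ (d (d (∏ k ∈ s, f k))) = ψ (∏ k ∈ s, f k) *
      (∑ k ∈ s, ψ (d (d (f k))) / ψ (f k) +
        ((∑ k ∈ s, ψ (d (f k)) / ψ (f k)) ^ 2 - ∑ k ∈ s, (ψ (d (f k)) / ψ (f k)) ^ 2)) := by
    induction s using Finset.induction_on with
    | empty => simp
    | insert a s ha ih =>
      have h0 := hf a (Finset.mem_insert_self a s)
      have hf' := fun k hk => hf k (Finset.mem_insert_of_mem hk)
      have ih' := ih hf'
      rw [Finset.prod_insert ha, Finset.sum_insert ha, Finset.sum_insert ha, Finset.sum_insert ha,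
        d.leibniz, smul_eq_mul, smul_eq_mul, map_add, d.leibniz, d.leibniz]
      simp only [smul_eq_mul, map_add, map_mul, ih', d.map_prod_eq_logDeriv ψ s f hf']
      field_simp
      ring
  rw [key]
  congr 2
  rw [sub_eq_iff_eq_add, sq, Finset.sum_mul_sum, ← Finset.sum_add_distrib]
  refine Finset.sum_congr rfl fun k hk => ?_
  rw [← Finset.sum_erase_add _ _ hk]
  congr 1
  · exact Finset.sum_congr rfl fun l _ => by rw [div_mul_div_comm]
  · ring

theorem diffProd_ne_zero {A : Type*} [CommRing A] [IsDomain A] {m : ℕ} {y : Fin m → A}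
    (hy : Function.Injective y) : diffProd y ≠ 0 := by
  refine Finset.prod_ne_zero_iff.2 fun i _ => Finset.prod_ne_zero_iff.2 fun j hj => ?_
  rw [sub_ne_zero]
  exact fun h => (Finset.mem_Ioi.1 hj).ne' (hy h)

theorem map_diffProd {A B : Type*} [CommRing A] [CommRing B] (f : A →+* B) {m : ℕ} (y : Fin m → A) :
    f (diffProd y) = diffProd (fun i => f (y i)) := by
  simp [diffProd, map_prod]

/-- The logarithmic derivative of the Vandermonde product. -/
theorem Derivation.map_diffProd_eq {m : ℕ} (d : Derivation R A A) (y : Fin m → A) (k : Fin m)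
    (hd : ∀ l, l ≠ k → d (y l) = 0) (hy : Function.Injective fun i => ψ (y i)) :
    ψ (d (diffProd y)) = ψ (diffProd y) *
      (ψ (d (y k)) * ∑ l ∈ Finset.univ.erase k, 1 / (ψ (y k) - ψ (y l))) := by
  have hne : ∀ i j : Fin m, i ≠ j → ψ (y j - y i) ≠ 0 := fun i j hij => by
    rw [map_sub, sub_ne_zero]
    exact fun h => hij (hy h).symm
  rw [diffProd, d.map_prod_eq_logDeriv ψ _ _ fun i _ => by
    rw [map_prod]
    exact Finset.prod_ne_zero_iff.2 fun j hj => hne i j (Finset.mem_Ioi.1 hj).ne]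
  congr 1
  have h1 : ∀ i : Fin m, ψ (d (∏ j ∈ Finset.Ioi i, (y j - y i))) /
      ψ (∏ j ∈ Finset.Ioi i, (y j - y i)) =
      ∑ j ∈ Finset.Ioi i, ψ (d (y j - y i)) / ψ (y j - y i) := fun i => by
    have hp : ψ (∏ j ∈ Finset.Ioi i, (y j - y i)) ≠ 0 := by
      rw [map_prod]
      exact Finset.prod_ne_zero_iff.2 fun j hj => hne i j (Finset.mem_Ioi.1 hj).ne
    rw [d.map_prod_eq_logDeriv ψ _ _ fun j hj => hne i j (Finset.mem_Ioi.1 hj).ne,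
      mul_div_cancel_left₀ _ hp]
  simp only [h1]
  -- Only pairs containing `k` contribute: with `k` as the smaller index in the first summand, as
  -- the larger one in the second.
  have h2 : ∀ i : Fin m, ∑ j ∈ Finset.Ioi i, ψ (d (y j - y i)) / ψ (y j - y i) =
      (if i = k then ∑ l ∈ Finset.Ioi k, ψ (d (y k)) * (1 / (ψ (y k) - ψ (y l))) else 0) +
      (if i < k then ψ (d (y k)) * (1 / (ψ (y k) - ψ (y i))) else 0) := fun i => by
    rcases lt_trichotomy i k with h | h | h
    · rw [if_neg h.ne, if_pos h, zero_add, Finset.sum_eq_single k]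
      · rw [map_sub, hd i h.ne, sub_zero, map_sub]
        ring
      · intro j _ hj
        rw [map_sub, hd j hj, hd i h.ne, sub_zero, map_zero, zero_div]
      · intro hk
        exact absurd (Finset.mem_Ioi.2 h) hk
    · subst h
      rw [if_pos rfl, if_neg (lt_irrefl _), add_zero]
      refine Finset.sum_congr rfl fun j hj => ?_
      have hj' : j ≠ i := (Finset.mem_Ioi.1 hj).ne'
      rw [map_sub, hd j hj', zero_sub, map_neg, map_sub, ← neg_sub (ψ (y i)), neg_div_neg_eq]
      ring
    · rw [if_neg h.ne', if_neg h.not_gt, zero_add]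
      refine Finset.sum_eq_zero fun j hj => ?_
      rw [map_sub, hd j (h.trans (Finset.mem_Ioi.1 hj)).ne', hd i h.ne', sub_zero, map_zero,
        zero_div]
  simp only [h2, Finset.sum_add_distrib, Finset.sum_ite_eq', Finset.mem_univ, if_true]
  rw [Finset.mul_sum, ← Finset.sum_filter, ← Finset.sum_union]
  · refine Finset.sum_congr ?_ fun _ _ => rfl
    ext l
    simp only [Finset.mem_union, Finset.mem_Ioi, Finset.mem_filter, Finset.mem_univ, true_and,
      Finset.mem_erase, and_true]
    exact ⟨fun h => h.elim (fun h => h.ne') (fun h => h.ne), fun h => (lt_or_gt_of_ne h).symm⟩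
  · rw [Finset.disjoint_left]
    intro l hl hl'
    exact lt_asymm (Finset.mem_Ioi.1 hl) (Finset.mem_filter.1 hl').2

theorem sum_erase_eq_zero_of_antisymm {κ K : Type*} [Fintype κ] [DecidableEq κ] [Field K] [CharZero K]
    (g : κ → κ → K) (hg : ∀ k l, k ≠ l → g k l = -g l k) :
    ∑ k, ∑ l ∈ Finset.univ.erase k, g k l = 0 := by
  have h1 : ∀ g : κ → κ → K, ∑ k, ∑ l ∈ Finset.univ.erase k, g k l =
      ∑ k, ∑ l, if l ≠ k then g k l else 0 := fun g => by
    refine Finset.sum_congr rfl fun k _ => ?_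
    rw [← Finset.sum_filter]
    refine Finset.sum_congr ?_ fun _ _ => rfl
    ext
    simp
  have h2 : ∑ k, ∑ l ∈ Finset.univ.erase k, g k l = -∑ k, ∑ l ∈ Finset.univ.erase k, g k l := by
    conv_lhs => rw [h1, Finset.sum_comm]
    rw [h1, ← Finset.sum_neg_distrib]
    refine Finset.sum_congr rfl fun k _ => ?_
    rw [← Finset.sum_neg_distrib]
    refine Finset.sum_congr rfl fun l _ => ?_
    by_cases h : k = l
    · simp [h]
    · rw [if_pos h, if_pos (Ne.symm h), hg l k (Ne.symm h)]
  exact self_eq_neg.1 h2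

/-- The duality between the Laplacian in the matrix entries and a second order operator in the
spectral variables, for products of characteristic polynomials. -/
theorem secondOrder_diffProd_mul_prod [IsDomain A] [CharZero A] {m : ℕ} {ι : Type*} [Fintype ι]
    (d : Fin m → Derivation R A A) (e : ι → Derivation R A A) (y v a b D : Fin m → A)
    (hdD : ∀ k l, l ≠ k → d k (D l) = 0) (hdy : ∀ k l, l ≠ k → d k (y l) = 0)
    (hv : ∀ k, d k (y k) = v k)
    (hlap : ∀ k, ∑ i, e i (e i (D k)) = -secondOrder (d k) (a k) (b k) (D k))
    (hgrad : ∀ k l, k ≠ l → (y l - y k) * ∑ i, e i (D k) * e i (D l) =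
      a k * v k * d k (D k) * D l - a l * v l * D k * d l (D l))
    (hharm : ∑ k, secondOrder (d k) (a k) (b k) (diffProd y) = 0)
    (hy : Function.Injective y) (hD : ∀ k, D k ≠ 0) :
    ∑ k, secondOrder (d k) (a k) (b k) (diffProd y * ∏ k, D k) =
      -(diffProd y * ∑ i, e i (e i (∏ k, D k))) := by
  -- The identity is compared in the fraction field, where dividing by the `D k` and by the
  -- differences of the `y k` is allowed.
  have hinj := IsFractionRing.injective A (FractionRing A)
  set ψ : A →+* FractionRing A := algebraMap A (FractionRing A) with hψ
  have : CharZero (FractionRing A) := charZero_of_injective_algebraMap hinj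
  apply hinj
  have hDψ : ∀ k, ψ (D k) ≠ 0 := fun k => by
    rw [Ne, map_eq_zero_iff ψ hinj]
    exact hD k
  have hyψ : Function.Injective fun i => ψ (y i) := hinj.comp hy
  have hsplit : ∀ k, secondOrder (d k) (a k) (b k) (diffProd y * ∏ l, D l) =
      secondOrder (d k) (a k) (b k) (diffProd y) * ∏ l, D l +
      2 * a k * d k (diffProd y) * d k (∏ l, D l) +
      diffProd y * secondOrder (d k) (a k) (b k) (∏ l, D l) := fun k => by
    simp only [secondOrder_apply, Derivation.leibniz, smul_eq_mul, map_add]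
    ring
  have hprod : ∀ k, secondOrder (d k) (a k) (b k) (∏ l, D l) =
      (∏ l ∈ Finset.univ.erase k, D l) * secondOrder (d k) (a k) (b k) (D k) := fun k => by
    rw [← Finset.prod_erase_mul _ _ (Finset.mem_univ k)]
    exact secondOrder_const_mul _ _ _
      (Derivation.map_prod_eq_zero _ _ _ fun l hl => hdD k l (Finset.ne_of_mem_erase hl)) _
  have hPk : ∀ k, ψ (∏ l ∈ Finset.univ.erase k, D l) = ψ (∏ l, D l) / ψ (D k) := fun k => by
    rw [eq_div_iff (hDψ k), ← map_mul, Finset.prod_erase_mul _ _ (Finset.mem_univ k)]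
  have hd1 : ∀ k, ψ (d k (∏ l, D l)) = ψ (∏ l, D l) * (ψ (d k (D k)) / ψ (D k)) := fun k => by
    rw [(d k).map_prod_eq_logDeriv ψ _ _ fun l _ => hDψ l]
    congr 1
    refine Finset.sum_eq_single k (fun l _ hl => ?_) (by simp)
    rw [hdD k l hl, map_zero, zero_div]
  simp only [hsplit, Finset.sum_add_distrib, ← Finset.sum_mul, hharm, zero_mul, zero_add, hprod]
  simp only [map_add, map_neg, map_mul, map_sum, hd1, hPk, map_ofNat]
  simp only [(e _).map_map_prod_eq_logDeriv ψ _ _ fun l _ => hDψ l,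
    (d _).map_diffProd_eq ψ y _ (hdy _) hyψ, hv]
  simp only [← Finset.mul_sum, Finset.sum_add_distrib]
  have h3 : ∑ i, ∑ k, ψ (e i (e i (D k))) / ψ (D k) =
      -∑ k, ψ (secondOrder (d k) (a k) (b k) (D k)) / ψ (D k) := by
    rw [Finset.sum_comm, ← Finset.sum_neg_distrib]
    refine Finset.sum_congr rfl fun k _ => ?_
    rw [← Finset.sum_div, ← map_sum, hlap, map_neg, neg_div]
  have h4 : ∑ i, ∑ k, ∑ l ∈ Finset.univ.erase k,
      ψ (e i (D k)) * ψ (e i (D l)) / (ψ (D k) * ψ (D l)) =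
      ∑ k, ∑ l ∈ Finset.univ.erase k, (ψ (a k) * ψ (v k) * (ψ (d k (D k)) / ψ (D k)) -
        ψ (a l) * ψ (v l) * (ψ (d l (D l)) / ψ (D l))) / (ψ (y l) - ψ (y k)) := by
    rw [Finset.sum_comm]
    refine Finset.sum_congr rfl fun k _ => ?_
    rw [Finset.sum_comm]
    refine Finset.sum_congr rfl fun l hl => ?_
    have hkl : l ≠ k := Finset.ne_of_mem_erase hl
    have hne : ψ (y l) - ψ (y k) ≠ 0 := sub_ne_zero.2 fun h => hkl (hyψ h)
    have := congrArg ψ (hgrad k l hkl.symm)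
    simp only [map_mul, map_sub, map_sum] at this
    have hk := hDψ k
    have hl := hDψ l
    rw [← Finset.sum_div, eq_div_iff hne, div_mul_eq_mul_div, div_eq_iff (mul_ne_zero hk hl),
      mul_comm _ (ψ (y l) - ψ (y k)), this]
    field_simp
  rw [h3, h4]
  -- The crux: write A_k = a_k v_k D_k'/D_k. The gradient products give (A_k - A_l)/(y_l - y_k), and
  -- the cross terms between the Vandermonde product and ∏ D give 2 A_k/(y_k - y_l). Their sum is
  -- -(A_k + A_l)/(y_l - y_k), antisymmetric in k and l.
  have h5 : ∑ k, ∑ l ∈ Finset.univ.erase k, ((ψ (a k) * ψ (v k) * (ψ (d k (D k)) / ψ (D k)) -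
        ψ (a l) * ψ (v l) * (ψ (d l (D l)) / ψ (D l))) / (ψ (y l) - ψ (y k)) +
        2 * (ψ (a k) * ψ (v k) * (ψ (d k (D k)) / ψ (D k))) * (1 / (ψ (y k) - ψ (y l)))) = 0 := by
    refine sum_erase_eq_zero_of_antisymm _ fun k l hkl => ?_
    have hne : ψ (y l) - ψ (y k) ≠ 0 := sub_ne_zero.2 fun h => hkl (hyψ h).symm
    have hne' : ψ (y k) - ψ (y l) ≠ 0 := sub_ne_zero.2 fun h => hkl (hyψ h)
    rw [← neg_sub (ψ (y l)), div_add' _ _ _ hne, div_add' _ _ _ (neg_ne_zero.2 hne), ← neg_div,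
      div_eq_div_iff hne (neg_ne_zero.2 hne)]
    field_simp
    ring
  simp only [Finset.sum_add_distrib] at h5
  have h6 : ∑ k, 2 * ψ (a k) * (ψ (diffProd y) * (ψ (v k) *
        ∑ l ∈ Finset.univ.erase k, 1 / (ψ (y k) - ψ (y l)))) *
        (ψ (∏ l, D l) * (ψ (d k (D k)) / ψ (D k))) =
      ψ (diffProd y) * ψ (∏ l, D l) * ∑ k, ∑ l ∈ Finset.univ.erase k,
        2 * (ψ (a k) * ψ (v k) * (ψ (d k (D k)) / ψ (D k))) * (1 / (ψ (y k) - ψ (y l))) := by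
    rw [Finset.mul_sum]
    refine Finset.sum_congr rfl fun k _ => ?_
    rw [← Finset.mul_sum]
    ring
  have h7 : ∑ k, ψ (∏ l, D l) / ψ (D k) * ψ (secondOrder (d k) (a k) (b k) (D k)) =
      ψ (∏ l, D l) * ∑ k, ψ (secondOrder (d k) (a k) (b k) (D k)) / ψ (D k) := by
    rw [Finset.mul_sum]
    refine Finset.sum_congr rfl fun k _ => ?_
    ring
  rw [h6, h7]
  linear_combination ψ (diffProd y) * ψ (∏ l, D l) * h5

end Duality

/-! ### Gaussian moments. -/

section GaussianMoments

/-- The moments of the centred Gaussian law of variance `σ²`, as complex numbers. -/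
noncomputable def gaussianMoment (σ : ℝ) (k : ℕ) : ℂ :=
  ∫ x : ℝ, (x : ℂ) ^ k ∂gaussianReal 0 (σ ^ 2).toNNReal

theorem integrable_pow_gaussianReal (v : NNReal) (k : ℕ) :
    Integrable (fun x : ℝ => x ^ k) (gaussianReal 0 v) := by
  have := (memLp_id_gaussianReal (μ := 0) (v := v) (k : NNReal)).integrable_norm_pow'
  refine (integrable_norm_iff (by fun_prop)).1 ?_
  simpa using this

theorem integrable_ofReal_pow_gaussianReal (v : NNReal) (k : ℕ) :
    Integrable (fun x : ℝ => (x : ℂ) ^ k) (gaussianReal 0 v) := by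
  simpa using (integrable_pow_gaussianReal v k).ofReal (𝕜 := ℂ)

/-- Integration by parts, with -v times the density as antiderivative of x times the density. At `k
= 0` the truncated exponent `k - 1` is harmless because of the factor `k`. -/
theorem integral_pow_succ_gaussianReal {v : NNReal} (hv : v ≠ 0) (k : ℕ) :
    ∫ x : ℝ, x ^ (k + 1) ∂gaussianReal 0 v = v * (k * ∫ x : ℝ, x ^ (k - 1) ∂gaussianReal 0 v) := by
  have hv' : (v : ℝ) ≠ 0 := by exact_mod_cast hv
  have hint : ∀ k : ℕ, Integrable (fun x : ℝ => x ^ k * gaussianPDFReal 0 v x) := fun k => by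
    have := integrable_pow_gaussianReal v k
    rw [gaussianReal_of_var_ne_zero _ hv,
      integrable_withDensity_iff (measurable_gaussianPDF 0 v)
        (ae_of_all _ fun _ => gaussianPDF_lt_top)] at this
    simpa [toReal_gaussianPDF] using this
  have hderiv : ∀ x, HasDerivAt (fun x => -(v : ℝ) * gaussianPDFReal 0 v x)
      (x * gaussianPDFReal 0 v x) x := fun x => by
    have h1 : HasDerivAt (fun x : ℝ => -(x - 0) ^ 2 / (2 * v)) (-(2 * x) / (2 * v)) x := by
      have := (((hasDerivAt_id x).sub_const 0).pow 2).neg.div_const (2 * (v : ℝ))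
      simpa using this
    have h2 := (h1.exp.const_mul ((√(2 * Real.pi * v))⁻¹)).const_mul (-(v : ℝ))
    refine h2.congr_deriv ?_
    rw [gaussianPDFReal]
    field_simp
  have h := integral_mul_deriv_eq_deriv_mul_of_integrable
    (u := fun x : ℝ => x ^ k) (u' := fun x => k * x ^ (k - 1))
    (v := fun x => -(v : ℝ) * gaussianPDFReal 0 v x) (v' := fun x => x * gaussianPDFReal 0 v x)
    (fun x _ => by simpa using hasDerivAt_pow k x) (fun x _ => hderiv x)
    ((hint (k + 1)).congr (ae_of_all _ fun x => by simp [pow_succ, mul_assoc]))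
    (((hint (k - 1)).const_mul (-(v : ℝ) * k)).congr (ae_of_all _ fun x => by simp; ring))
    (((hint k).const_mul (-(v : ℝ))).congr (ae_of_all _ fun x => by simp; ring))
  rw [integral_gaussianReal_eq_integral_smul hv, integral_gaussianReal_eq_integral_smul hv]
  simp only [smul_eq_mul]
  calc ∫ x, gaussianPDFReal 0 v x * x ^ (k + 1) = ∫ x, x ^ k * (x * gaussianPDFReal 0 v x) := by
        congr 1; ext x; ring
    _ = v * (k * ∫ x, gaussianPDFReal 0 v x * x ^ (k - 1)) := by
        rw [h, ← integral_neg, ← integral_const_mul, ← integral_const_mul]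
        congr 1; ext x; ring

theorem gaussianMoment_zero (σ : ℝ) : gaussianMoment σ 0 = 1 := by
  simp [gaussianMoment]

theorem gaussianMoment_succ {σ : ℝ} (hσ : 0 < σ) (k : ℕ) :
    gaussianMoment σ (k + 1) = (σ : ℂ) ^ 2 * (k * gaussianMoment σ (k - 1)) := by
  have hv : (σ ^ 2).toNNReal ≠ 0 := by
    simpa using hσ.ne'
  have h := integral_pow_succ_gaussianReal hv k
  rw [Real.coe_toNNReal _ (sq_nonneg σ)] at h
  simp only [gaussianMoment, ← Complex.ofReal_pow, integral_complex_ofReal, h]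
  push_cast
  rfl

end GaussianMoments

/-! ### Formal expectation over some of the variables of a polynomial. -/

section PartialExpectation

open MvPolynomial

/-- The expectation of a polynomial over the variables indexed by `ι`, regarded as independent with
the moments `mom`. -/
noncomputable def partialExp (κ : Type*) {ι : Type*} [Fintype ι] (mom : ℕ → ℂ) :
    MvPolynomial (κ ⊕ ι) ℂ →ₗ[ℂ] MvPolynomial κ ℂ :=
  (basisMonomials (κ ⊕ ι) ℂ).constr ℂ fun s =>
    monomial (s.comapDomain Sum.inl Sum.inl_injective.injOn) (∏ i, mom (s (Sum.inr i)))

theorem partialExp_monomial {κ ι : Type*} [Fintype ι] (mom : ℕ → ℂ) (s : κ ⊕ ι →₀ ℕ) (c : ℂ) :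
    partialExp κ mom (monomial s c) =
      monomial (s.comapDomain Sum.inl Sum.inl_injective.injOn) (c * ∏ i, mom (s (Sum.inr i))) := by
  have h : monomial s c = c • basisMonomials (κ ⊕ ι) ℂ s := by
    simp [smul_monomial]
  rw [h, map_smul, partialExp, Module.Basis.constr_basis, smul_monomial, smul_eq_mul]

theorem linearMap_ext_monomial {σ M : Type*} [AddCommGroup M] [Module ℂ M]
    {f g : MvPolynomial σ ℂ →ₗ[ℂ] M} (h : ∀ s c, f (monomial s c) = g (monomial s c)) : f = g :=
  (basisMonomials σ ℂ).ext fun s => by simpa using h s 1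

theorem comapDomain_inl_add_single_inl {κ ι : Type*} (s : κ ⊕ ι →₀ ℕ) (k : κ) :
    (Finsupp.single (Sum.inl k) 1 + s).comapDomain Sum.inl Sum.inl_injective.injOn =
      Finsupp.single k 1 + s.comapDomain Sum.inl Sum.inl_injective.injOn := by
  classical
  ext l
  simp [Finsupp.single_apply]

variable {κ ι : Type*} [Fintype ι]

theorem partialExp_X_inl_mul (mom : ℕ → ℂ) (k : κ) (f : MvPolynomial (κ ⊕ ι) ℂ) :
    partialExp κ mom (X (Sum.inl k) * f) = X k * partialExp κ mom f := by
  have : (partialExp κ mom) ∘ₗ (LinearMap.mulLeft ℂ (X (Sum.inl k))) =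
      LinearMap.mulLeft ℂ (X k) ∘ₗ (partialExp κ (ι := ι) mom) := by
    refine linearMap_ext_monomial fun s c => ?_
    simp only [LinearMap.comp_apply, LinearMap.mulLeft_apply, X, monomial_mul, one_mul,
      partialExp_monomial, comapDomain_inl_add_single_inl]
    simp
  exact LinearMap.congr_fun this f

theorem partialExp_rename_inl_mul (mom : ℕ → ℂ) (q : MvPolynomial κ ℂ)
    (f : MvPolynomial (κ ⊕ ι) ℂ) :
    partialExp κ mom (rename Sum.inl q * f) = q * partialExp κ mom f := by
  induction q using MvPolynomial.induction_on generalizing f with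
  | C a => rw [rename_C, ← smul_eq_C_mul, ← smul_eq_C_mul, map_smul]
  | add p q hp hq => rw [map_add, add_mul, map_add, hp, hq, add_mul]
  | mul_X p k hp =>
    rw [map_mul (rename Sum.inl), rename_X, mul_assoc, hp, partialExp_X_inl_mul, mul_assoc]

theorem pderiv_partialExp (mom : ℕ → ℂ) (k : κ) (f : MvPolynomial (κ ⊕ ι) ℂ) :
    pderiv k (partialExp κ mom f) = partialExp κ mom (pderiv (Sum.inl k) f) := by
  have : (pderiv k).toLinearMap ∘ₗ (partialExp κ mom) =
      (partialExp κ (ι := ι) mom) ∘ₗ (pderiv (Sum.inl k)).toLinearMap := by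
    refine linearMap_ext_monomial fun s c => ?_
    simp only [LinearMap.comp_apply, Derivation.coeFn_coe, pderiv_monomial, partialExp_monomial]
    have h : (s - Finsupp.single (Sum.inl k) 1).comapDomain Sum.inl Sum.inl_injective.injOn =
        s.comapDomain Sum.inl Sum.inl_injective.injOn - Finsupp.single k 1 := by
      classical
      ext l
      simp [Finsupp.single_apply]
    rw [h]
    congr 1
    simp
    ring
  exact LinearMap.congr_fun this f

/-- Gaussian integration by parts (Stein's identity) at the level of polynomials. The moment
recursion and `mom 0 = 1` are all that the duality argument uses of the Gaussian law. -/
theorem partialExp_X_inr_mul {mom : ℕ → ℂ} {v : ℂ}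
    (hmom : ∀ k, mom (k + 1) = v * (k * mom (k - 1))) (i : ι) (f : MvPolynomial (κ ⊕ ι) ℂ) :
    partialExp κ mom (X (Sum.inr i) * f) = C v * partialExp κ mom (pderiv (Sum.inr i) f) := by
  have : (partialExp κ mom) ∘ₗ (LinearMap.mulLeft ℂ (X (Sum.inr i))) =
      v • ((partialExp κ (ι := ι) mom) ∘ₗ (pderiv (Sum.inr i)).toLinearMap) := by
    classical
    refine linearMap_ext_monomial fun s c => ?_
    simp only [LinearMap.comp_apply, LinearMap.mulLeft_apply, X, monomial_mul, one_mul,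
      LinearMap.smul_apply, Derivation.coeFn_coe, pderiv_monomial, partialExp_monomial,
      smul_monomial]
    have h1 : (Finsupp.single (Sum.inr i) 1 + s).comapDomain Sum.inl Sum.inl_injective.injOn =
        s.comapDomain Sum.inl Sum.inl_injective.injOn := by
      ext l
      simp
    have h2 : (s - Finsupp.single (Sum.inr i) 1).comapDomain Sum.inl Sum.inl_injective.injOn =
        s.comapDomain Sum.inl Sum.inl_injective.injOn := by
      ext l
      simp
    rw [h1, h2]
    congr 1
    rw [← Finset.mul_prod_erase _ _ (Finset.mem_univ i),
      ← Finset.mul_prod_erase (a := i) _ _ (Finset.mem_univ i)]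
    have h3 : ∀ j ∈ Finset.univ.erase i,
        mom ((Finsupp.single (Sum.inr i) 1 + s : κ ⊕ ι →₀ ℕ) (Sum.inr j)) =
        mom ((s - Finsupp.single (Sum.inr i) 1 : κ ⊕ ι →₀ ℕ) (Sum.inr j)) := fun j hj => by
      simp [(Finset.ne_of_mem_erase hj).symm]
    rw [Finset.prod_congr rfl h3]
    simp [add_comm 1, hmom]
    ring
  have h := LinearMap.congr_fun this f
  simpa [smul_eq_C_mul] using h

end PartialExpectation

/-! ### The formal expectation as an integral. -/

section PolynomialIntegral

open MvPolynomial

theorem eval_sumElim_monomial {κ ι : Type*} [Fintype κ] [Fintype ι] (α : κ → ℂ) (g : ι → ℂ)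
    (s : κ ⊕ ι →₀ ℕ) (c : ℂ) :
    eval (Sum.elim α g) (monomial s c) =
      c * (∏ k, α k ^ s (Sum.inl k)) * ∏ i, g i ^ s (Sum.inr i) := by
  rw [eval_monomial, Finsupp.prod_fintype _ _ (by simp), Fintype.prod_sum_type, mul_assoc]
  simp

/-- Polynomials are integrable against product weights with finite moments. -/
theorem integrable_eval_mul_prod {κ ι : Type*} [Fintype κ] [Fintype ι] (μ : Measure ℝ)
    [SigmaFinite μ] (w : ℝ → ℂ) (hw : ∀ k : ℕ, Integrable (fun x : ℝ => (x : ℂ) ^ k * w x) μ)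
    (α : κ → ℂ) (f : MvPolynomial (κ ⊕ ι) ℂ) :
    Integrable (fun x : ι → ℝ => eval (Sum.elim α fun i => (x i : ℂ)) f * ∏ i, w (x i))
      (Measure.pi fun _ => μ) := by
  induction f using MvPolynomial.induction_on' with
  | monomial s c =>
    have := Integrable.fintype_prod (μ := fun _ : ι => μ)
      (f := fun (i : ι) (x : ℝ) => (x : ℂ) ^ s (Sum.inr i) * w x) fun i => hw (s (Sum.inr i))
    refine (this.const_mul (c * ∏ k, α k ^ s (Sum.inl k))).congr (ae_of_all _ fun x => ?_)
    simp only [eval_sumElim_monomial, Finset.prod_mul_distrib]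
    ring
  | add p q hp hq =>
    refine (hp.add hq).congr (ae_of_all _ fun x => ?_)
    simp [add_mul]

/-- Fubini on monomials. The weight `w` lets one statement serve both the Gaussian law, with `w =
1`, and the Laguerre density. -/
theorem eval_partialExp {κ ι : Type*} [Fintype κ] [Fintype ι] (μ : Measure ℝ)
    [SigmaFinite μ] (w : ℝ → ℂ) (hw : ∀ k : ℕ, Integrable (fun x : ℝ => (x : ℂ) ^ k * w x) μ)
    (α : κ → ℂ) (f : MvPolynomial (κ ⊕ ι) ℂ) :
    eval α (partialExp κ (fun k => ∫ x, (x : ℂ) ^ k * w x ∂μ) f) =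
      ∫ x : ι → ℝ, eval (Sum.elim α fun i => (x i : ℂ)) f * ∏ i, w (x i)
        ∂(Measure.pi fun _ => μ) := by
  induction f using MvPolynomial.induction_on' with
  | monomial s c =>
    have h : ∀ x : ι → ℝ, eval (Sum.elim α fun i => (x i : ℂ)) (monomial s c) * ∏ i, w (x i) =
        (c * ∏ k, α k ^ s (Sum.inl k)) * ∏ i, ((x i : ℂ) ^ s (Sum.inr i) * w (x i)) := fun x => by
      simp only [eval_sumElim_monomial, Finset.prod_mul_distrib]
      ring
    simp only [h]
    rw [partialExp_monomial, eval_monomial, integral_const_mul,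
      integral_fintype_prod_eq_prod (f := fun (i : ι) (x : ℝ) => (x : ℂ) ^ s (Sum.inr i) * w x),
      Finsupp.prod_fintype _ _ (by simp)]
    simp only [Finsupp.comapDomain_apply]
    ring
  | add p q hp hq =>
    simp only [map_add, add_mul]
    rw [integral_add (integrable_eval_mul_prod μ w hw α p) (integrable_eval_mul_prod μ w hw α q),
      hp, hq]

theorem integrable_eval_iidGaussian {κ ι : Type} [Fintype κ] [Fintype ι] (σ : ℝ) (α : κ → ℂ)
    (f : MvPolynomial (κ ⊕ ι) ℂ) :
    Integrable (fun g : ι → ℝ => eval (Sum.elim α fun i => (g i : ℂ)) f) (iidGaussian ι σ) := by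
  simpa [iidGaussian] using integrable_eval_mul_prod (gaussianReal 0 (σ ^ 2).toNNReal) (fun _ => 1)
    (fun k => by simpa using integrable_ofReal_pow_gaussianReal _ _) α f

theorem eval_partialExp_gaussianMoment {κ ι : Type} [Fintype κ] [Fintype ι] (σ : ℝ) (α : κ → ℂ)
    (f : MvPolynomial (κ ⊕ ι) ℂ) :
    eval α (partialExp κ (gaussianMoment σ) f) =
      ∫ g, eval (Sum.elim α fun i => (g i : ℂ)) f ∂iidGaussian ι σ := by
  have h := eval_partialExp (gaussianReal 0 (σ ^ 2).toNNReal) (fun _ => 1)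
    (fun k => by simpa using integrable_ofReal_pow_gaussianReal _ _) α f
  simp only [mul_one, Finset.prod_const_one] at h
  exact h

end PolynomialIntegral

/-! ### Weighted degree bounds and uniqueness of eigenfunctions. -/

section WeightedDegree

open MvPolynomial

variable {σ : Type*}

/-- All monomials of `f` have weight less than `n`. -/
def DegLT (w : σ → ℕ) (n : ℕ) (f : MvPolynomial σ ℂ) : Prop :=
  ∀ s, coeff s f ≠ 0 → Finsupp.weight w s < n

namespace DegLT

variable {w : σ → ℕ} {n p q : ℕ} {f g : MvPolynomial σ ℂ}

theorem mono (hf : DegLT w p f) (h : p ≤ q) : DegLT w q f := fun s hs => (hf s hs).trans_le h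

theorem zero (w : σ → ℕ) (n : ℕ) : DegLT w n 0 := fun s hs => absurd (coeff_zero s) hs

theorem add (hf : DegLT w n f) (hg : DegLT w n g) : DegLT w n (f + g) := fun s hs => by
  by_cases h : coeff s f = 0
  · exact hg s fun h' => hs (by rw [coeff_add, h, h', add_zero])
  · exact hf s h

theorem neg (hf : DegLT w n f) : DegLT w n (-f) := fun s hs => hf s fun h => hs (by simp [h])

theorem sub (hf : DegLT w n f) (hg : DegLT w n g) : DegLT w n (f - g) := by
  rw [sub_eq_add_neg]
  exact hf.add hg.neg

theorem sum {κ : Type*} {S : Finset κ} {F : κ → MvPolynomial σ ℂ}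
    (h : ∀ k ∈ S, DegLT w n (F k)) : DegLT w n (∑ k ∈ S, F k) :=
  Finset.sum_induction F (DegLT w n) (fun _ _ => add) (zero w n) h

/-- The bound is strict, so `p + 1` stands for weight at most `p`, and `DegLT w 0` forces the zero
polynomial. One factor with a bound of the form `p + 1` keeps the bound on the product sharp. -/
theorem mul (hf : DegLT w (p + 1) f) (hg : DegLT w q g) : DegLT w (p + q) (f * g) := fun s hs => by
  classical
  rw [coeff_mul] at hs
  obtain ⟨x, hx, hne⟩ := Finset.exists_ne_zero_of_sum_ne_zero hs
  have h1 := hf _ (left_ne_zero_of_mul hne)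
  have h2 := hg _ (right_ne_zero_of_mul hne)
  rw [← Finset.HasAntidiagonal.mem_antidiagonal.1 hx, map_add]
  omega

theorem C_mul (c : ℂ) (hf : DegLT w n f) : DegLT w n (C c * f) := fun s hs =>
  hf s fun h => hs (by simp [h])

theorem C (c : ℂ) : DegLT w 1 (MvPolynomial.C c) := fun s hs => by
  classical
  rw [coeff_C] at hs
  have : s = 0 := by
    by_contra h
    simp [Ne.symm h] at hs
  simp [this]

theorem one : DegLT w 1 (1 : MvPolynomial σ ℂ) := C 1

theorem X (i : σ) (h : w i ≤ n) : DegLT w (n + 1) (X i) := fun s hs => by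
  classical
  rw [coeff_X] at hs
  have : Finsupp.single i 1 = s := by
    by_contra h'
    simp [h'] at hs
  rw [← this, Finsupp.weight_single]
  simpa using Nat.lt_succ_of_le h

theorem prod {κ : Type*} (S : Finset κ) {F : κ → MvPolynomial σ ℂ} {N : κ → ℕ}
    (h : ∀ k ∈ S, DegLT w (N k + 1) (F k)) : DegLT w (∑ k ∈ S, N k + 1) (∏ k ∈ S, F k) := by
  classical
  induction S using Finset.induction_on with
  | empty => simpa using one
  | insert a S ha ih =>
    rw [Finset.prod_insert ha, Finset.sum_insert ha, add_assoc]
    exact (h a (Finset.mem_insert_self a S)).mul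
      (ih fun k hk => h k (Finset.mem_insert_of_mem hk))

/-- Telescoping one factor at a time: if each `G k` is the top part of `F k`, the product of the `G
k` is the top part of the product of the `F k`. -/
theorem prod_sub_prod {κ : Type*} (S : Finset κ) {F G : κ → MvPolynomial σ ℂ} {N : κ → ℕ}
    (hG : ∀ k ∈ S, DegLT w (N k + 1) (G k)) (h : ∀ k ∈ S, DegLT w (N k) (F k - G k)) :
    DegLT w (∑ k ∈ S, N k) (∏ k ∈ S, F k - ∏ k ∈ S, G k) := by
  classical
  induction S using Finset.induction_on with
  | empty => simpa using zero w 0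
  | insert a S ha ih =>
    have hS := fun k hk => h k (Finset.mem_insert_of_mem hk)
    have hGS := fun k hk => hG k (Finset.mem_insert_of_mem hk)
    have hFS : DegLT w (∑ k ∈ S, N k + 1) (∏ k ∈ S, F k) := prod S fun k hk => by
      have := ((hS k hk).mono (Nat.le_succ _)).add (hGS k hk)
      rwa [sub_add_cancel] at this
    rw [Finset.prod_insert ha, Finset.prod_insert ha, Finset.sum_insert ha]
    have h1 := (hG a (Finset.mem_insert_self a S)).mul (ih hGS hS)
    have h2 := hFS.mul (h a (Finset.mem_insert_self a S))
    rw [add_comm] at h2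
    convert h1.add h2 using 1
    ring

theorem det {m : Type*} [Fintype m] [DecidableEq m] {F : m → m → MvPolynomial σ ℂ} {N : m → ℕ}
    (h : ∀ i k, DegLT w (N i + 1) (F i k)) : DegLT w (∑ i, N i + 1) (Matrix.of F).det := by
  rw [Matrix.det_apply']
  refine sum fun τ _ => ?_
  have := prod Finset.univ (F := fun k => F (τ k) k) (N := fun k => N (τ k)) fun k _ => h _ k
  rw [Equiv.sum_comp τ N] at this
  simpa using this.C_mul ((Equiv.Perm.sign τ : ℤ) : ℂ)

theorem det_sub_det {m : Type*} [Fintype m] [DecidableEq m] {F G : m → m → MvPolynomial σ ℂ}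
    {N : m → ℕ} (hG : ∀ i k, DegLT w (N i + 1) (G i k)) (h : ∀ i k, DegLT w (N i) (F i k - G i k)) :
    DegLT w (∑ i, N i) ((Matrix.of F).det - (Matrix.of G).det) := by
  rw [Matrix.det_apply', Matrix.det_apply', ← Finset.sum_sub_distrib]
  refine sum fun τ _ => ?_
  have := prod_sub_prod Finset.univ (F := fun k => F (τ k) k) (G := fun k => G (τ k) k)
    (N := fun k => N (τ k)) (fun k _ => hG _ k) (fun k _ => h _ k)
  rw [Equiv.sum_comp τ N] at this
  simpa [mul_sub] using this.C_mul ((Equiv.Perm.sign τ : ℤ) : ℂ)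

theorem pow (hf : DegLT w (p + 1) f) (n : ℕ) : DegLT w (n * p + 1) (f ^ n) := by
  simpa using prod (Finset.range n) (F := fun _ => f) (N := fun _ => p) fun _ _ => hf

theorem pderiv (i : σ) (hi : w i = 1) (hf : DegLT w (n + 1) f) : DegLT w n (pderiv i f) :=
  fun s hs => by
    rw [coeff_pderiv] at hs
    have := hf _ (left_ne_zero_of_mul hs)
    rw [map_add, Finsupp.weight_single, hi] at this
    simpa using this

theorem coeff_X_mul_pderiv (i : σ) (f : MvPolynomial σ ℂ) (s : σ →₀ ℕ) :
    coeff s (MvPolynomial.X i * MvPolynomial.pderiv i f) = s i * coeff s f := by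
  classical
  rw [coeff_X_mul']
  split_ifs with h
  · have h1 : 1 ≤ s i := Nat.one_le_iff_ne_zero.2 (Finsupp.mem_support_iff.1 h)
    rw [coeff_pderiv, tsub_add_cancel_of_le (by simpa using h1)]
    rw [Finsupp.tsub_apply, Finsupp.single_eq_same]
    push_cast [Nat.cast_sub h1]
    ring
  · rw [Finsupp.notMem_support_iff.1 h]
    simp

theorem X_mul_pderiv (i : σ) (hf : DegLT w n f) :
    DegLT w n (MvPolynomial.X i * MvPolynomial.pderiv i f) := fun s hs => by
  rw [coeff_X_mul_pderiv] at hs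
  exact hf s (right_ne_zero_of_mul hs)

theorem eq_zero (hf : DegLT w 0 f) : f = 0 := by
  ext s
  by_contra h
  exact absurd (hf s (by simpa using h)) (Nat.not_lt_zero _)

end DegLT

/-- An eigenfunction of an operator `w ∑ X_k ∂_k - (degree lowering)` with eigenvalue `w n`, all of
whose monomials have degree less than `n`, vanishes. -/
theorem eq_zero_of_degLT_of_eigen {m : ℕ} {w n : ℕ} (hw : 0 < w) (c a₀ a₁ b₀ : ℂ)
    {Q : MvPolynomial (Fin m) ℂ} (hQ : DegLT 1 n Q)
    (h : ∑ k, secondOrder (pderiv k) (-C c * (C a₀ + C a₁ * X k)) (C (w : ℂ) * X k - C c * C b₀) Q =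
      C ((w : ℂ) * n) * Q) : Q = 0 := by
  -- The degree bound is lowered one step at a time. On a monomial of top degree `j < n` the
  -- operator has coefficient `w * j`, while the eigenvalue is `w * n`.
  have key : ∀ j, j ≤ n → DegLT 1 j Q → Q = 0 := by
    intro j
    induction j with
    | zero => exact fun _ h0 => h0.eq_zero
    | succ j ih =>
      intro hj hQj
      refine ih (by omega) fun s hs => ?_
      refine lt_of_le_of_ne (Nat.lt_succ_iff.1 (hQj s hs)) fun hsj => ?_
      have hlow : ∀ k, DegLT 1 j (C (-c * a₀) * pderiv k (pderiv k Q) +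
          C (-c * a₁) * (X k * pderiv k (pderiv k Q)) - C (c * b₀) * pderiv k Q) := fun k => by
        have h1 : DegLT 1 j (pderiv k Q) := DegLT.pderiv (w := 1) k (Pi.one_apply k) hQj
        have h2 : DegLT 1 j (pderiv k (pderiv k Q)) := DegLT.pderiv (w := 1) k (Pi.one_apply k) (h1.mono (Nat.le_succ j))
        have h3 : DegLT 1 j (X k * pderiv k (pderiv k Q)) :=
          DegLT.X_mul_pderiv k h1
        exact ((h2.C_mul _).add (h3.C_mul _)).sub (h1.C_mul _)
      have hcoef := congrArg (coeff s) h
      have hterm : ∀ k, coeff s (secondOrder (pderiv k) (-C c * (C a₀ + C a₁ * X k))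
          (C (w : ℂ) * X k - C c * C b₀) Q) = w * (s k * coeff s Q) := fun k => by
        have h0 : coeff s (C (-c * a₀) * pderiv k (pderiv k Q) +
          C (-c * a₁) * (X k * pderiv k (pderiv k Q)) - C (c * b₀) * pderiv k Q) = 0 := by
          by_contra hne
          exact absurd (hlow k s hne) (by rw [hsj]; exact lt_irrefl _)
        have he : secondOrder (pderiv k) (-C c * (C a₀ + C a₁ * X k))
            (C (w : ℂ) * X k - C c * C b₀) Q = (C (-c * a₀) * pderiv k (pderiv k Q) +
            C (-c * a₁) * (X k * pderiv k (pderiv k Q)) - C (c * b₀) * pderiv k Q) +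
            C (w : ℂ) * (X k * pderiv k Q) := by
          simp only [secondOrder_apply, C_mul, C_neg]
          ring
        rw [he, coeff_add, h0, zero_add, coeff_C_mul, DegLT.coeff_X_mul_pderiv]
      rw [coeff_sum, Finset.sum_congr rfl fun k _ => hterm k, coeff_C_mul, ← Finset.mul_sum,
        ← Finset.sum_mul, ← mul_assoc, mul_left_inj' hs,
        mul_right_inj' (by exact_mod_cast hw.ne')] at hcoef
      have hdeg : Finsupp.weight (1 : Fin m → ℕ) s = ∑ k, s k := by
        rw [Finsupp.weight_apply, Finsupp.sum_fintype _ _ (by simp)]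
        simp
      rw [hdeg] at hsj
      have : ∑ k, s k = n := by exact_mod_cast hcoef
      omega
  exact key n le_rfl hQ

end WeightedDegree

/-! ### The determinant formula for averages, in abstract form. -/

section DualityExpectation

open MvPolynomial

theorem pderiv_rename_inl_inr {κ ι : Type*} (i : ι) (q : MvPolynomial κ ℂ) :
    pderiv (Sum.inr i : κ ⊕ ι) (rename Sum.inl q) = 0 := by
  induction q using MvPolynomial.induction_on with
  | C a => simp
  | add p q hp hq => simp [hp, hq]
  | mul_X p k hp =>
    rw [map_mul (rename Sum.inl), rename_X, Derivation.leibniz, hp, pderiv_X_of_ne (by simp)]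
    simp

theorem diffProd_eq_det {A : Type*} [CommRing A] {m : ℕ} (y : Fin m → A) :
    diffProd y = (Matrix.of fun i k : Fin m => y k ^ (i : ℕ)).det := by
  rw [← Matrix.det_transpose, diffProd, ← Matrix.det_vandermonde]
  rfl

theorem degLT_aeval_X {m : ℕ} (k : Fin m) {f : Polynomial ℂ} {n : ℕ} (hf : f.degree < n) :
    DegLT 1 n (Polynomial.aeval (X k : MvPolynomial (Fin m) ℂ) f) := by
  by_cases h : f = 0
  · rw [h, map_zero]
    exact DegLT.zero _ _
  rw [Polynomial.aeval_eq_sum_range' ((Polynomial.natDegree_lt_iff_degree_lt h).2 hf)]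
  refine DegLT.sum fun j hj => ?_
  rw [smul_eq_C_mul]
  refine DegLT.C_mul _ (((DegLT.X (w := 1) k le_rfl).pow j).mono ?_)
  simpa using Nat.succ_le_of_lt (Finset.mem_range.1 hj)

theorem degLT_partialExp {κ ι : Type*} [Fintype κ] [Fintype ι] (mom : ℕ → ℂ) {n : ℕ}
    {f : MvPolynomial (κ ⊕ ι) ℂ} (hf : DegLT (Sum.elim 1 0) n f) :
    DegLT 1 n (partialExp κ mom f) := by
  classical
  rw [f.as_sum, map_sum]
  refine DegLT.sum fun s hs => ?_
  rw [partialExp_monomial]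
  intro t ht
  rw [coeff_monomial] at ht
  have hst : s.comapDomain Sum.inl Sum.inl_injective.injOn = t := by
    by_contra h
    simp [h] at ht
  have h := hf s (mem_support_iff.1 hs)
  rw [← hst]
  convert h using 1
  rw [Finsupp.weight_apply, Finsupp.weight_apply, Finsupp.sum_fintype _ _ (by simp),
    Finsupp.sum_fintype _ _ (by simp), Fintype.sum_sum_type]
  simp

/-- The operator `f ↦ (a₀ + a₁ X) f'' + b₀ f'` on polynomials in one variable. -/
noncomputable def spectralOp (a₀ a₁ b₀ : ℂ) (f : Polynomial ℂ) : Polynomial ℂ :=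
  (Polynomial.C a₀ + Polynomial.C a₁ * Polynomial.X) *
    Polynomial.derivative (Polynomial.derivative f) + Polynomial.C b₀ * Polynomial.derivative f

theorem pderiv_aeval_X_of_ne {τ : Type*} {s t : τ} (hst : t ≠ s) (f : Polynomial ℂ) :
    pderiv s (Polynomial.aeval (X t : MvPolynomial τ ℂ) f) = 0 := by
  rw [Derivation.map_aeval, pderiv_X_of_ne hst, smul_zero]

theorem pderiv_aeval_X_self {τ : Type*} (s : τ) (f : Polynomial ℂ) :
    pderiv s (Polynomial.aeval (X s : MvPolynomial τ ℂ) f) =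
      Polynomial.aeval (X s) (Polynomial.derivative f) := by
  rw [Derivation.map_aeval, pderiv_X_self, smul_eq_mul, mul_one]

theorem secondOrder_aeval_X {τ : Type*} (s : τ) (a₀ a₁ b₀ : ℂ) (f : Polynomial ℂ) :
    secondOrder (pderiv s) (C a₀ + C a₁ * X s) (C b₀) (Polynomial.aeval (X s : MvPolynomial τ ℂ) f) =
      Polynomial.aeval (X s) (spectralOp a₀ a₁ b₀ f) := by
  simp [secondOrder_apply, spectralOp, MvPolynomial.algebraMap_eq]

set_option maxHeartbeats 1000000 in
-- The common core of all Gaussian ensembles. Here `ρ` is the power of the spectral variables in the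
-- Vandermonde product, `e` the degree of `D k` in its spectral variable, `w` the weight of that
-- variable when Gaussian coordinates have weight one, and `a₀, a₁, b₀` determine the spectral
-- operator. Both sides are eigenfunctions of w ∑ X_k ∂_k - v T, where T is the sum of the spectral
-- operators. They share the eigenvalue `w * n` and the part of top degree `n`, so uniqueness
-- applies to the difference.
theorem diffProd_mul_partialExp_prod {m : ℕ} {ι : Type*} [Fintype ι] {mom : ℕ → ℂ} {v : ℂ}
    (hmom₀ : mom 0 = 1) (hmom : ∀ k, mom (k + 1) = v * (k * mom (k - 1)))
    {ρ e w : ℕ} (hρ : 0 < ρ) (hw : 0 < w) (a₀ a₁ b₀ : ℂ)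
    (D : Fin m → MvPolynomial (Fin m ⊕ ι) ℂ)
    (hdD : ∀ k l, l ≠ k → pderiv (Sum.inl k) (D l) = 0)
    (hlap : ∀ k, ∑ i, pderiv (Sum.inr i) (pderiv (Sum.inr i) (D k)) =
      -secondOrder (pderiv (Sum.inl k)) (C a₀ + C a₁ * X (Sum.inl k)) (C b₀) (D k))
    (hgrad : ∀ k l, k ≠ l → (X (Sum.inl l) ^ ρ - X (Sum.inl k) ^ ρ) *
      ∑ i, pderiv (Sum.inr i) (D k) * pderiv (Sum.inr i) (D l) =
      (C a₀ + C a₁ * X (Sum.inl k)) * (C (ρ : ℂ) * X (Sum.inl k) ^ (ρ - 1)) *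
        pderiv (Sum.inl k) (D k) * D l -
      (C a₀ + C a₁ * X (Sum.inl l)) * (C (ρ : ℂ) * X (Sum.inl l) ^ (ρ - 1)) *
        D k * pderiv (Sum.inl l) (D l))
    (heuler : ∀ k, ∑ i, X (Sum.inr i) * pderiv (Sum.inr i) (D k) +
      C (w : ℂ) * X (Sum.inl k) * pderiv (Sum.inl k) (D k) = C ((w : ℂ) * e) * D k)
    (hlead : ∀ k, DegLT (Sum.elim 1 0) e (D k - X (Sum.inl k) ^ e))
    (hharm : ∀ i : ℕ, spectralOp a₀ a₁ b₀ (Polynomial.X ^ (ρ * i)) = 0 ∨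
      ∃ μ : ℂ, ∃ j < i, spectralOp a₀ a₁ b₀ (Polynomial.X ^ (ρ * i)) =
        Polynomial.C μ * Polynomial.X ^ (ρ * j))
    (r : ℕ → Polynomial ℂ)
    (hr_deg : ∀ i, (r i - Polynomial.X ^ (e + ρ * i)).degree < ((e + ρ * i : ℕ) : WithBot ℕ))
    (hr : ∀ i, Polynomial.C (w : ℂ) * Polynomial.X * Polynomial.derivative (r i) -
      Polynomial.C v * spectralOp a₀ a₁ b₀ (r i) =
      Polynomial.C ((w : ℂ) * (e + ρ * i : ℕ)) * r i) :
    diffProd (fun k => (X k : MvPolynomial (Fin m) ℂ) ^ ρ) * partialExp (Fin m) mom (∏ k, D k) =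
      (Matrix.of fun i k : Fin m =>
        Polynomial.aeval (X k : MvPolynomial (Fin m) ℂ) (r i)).det := by
  set n : ℕ := ∑ i : Fin m, (e + ρ * (i : ℕ)) with hn
  set h₀ : MvPolynomial (Fin m) ℂ := diffProd fun k => (X k : MvPolynomial (Fin m) ℂ) ^ ρ with hh₀
  set h : MvPolynomial (Fin m ⊕ ι) ℂ := diffProd fun k => X (Sum.inl k) ^ ρ with hh
  set P := ∏ k, D k with hP
  have hren : rename Sum.inl h₀ = h := by
    have := map_diffProd (rename (R := ℂ) (Sum.inl : Fin m → Fin m ⊕ ι)).toRingHom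
      fun k => (X k : MvPolynomial (Fin m) ℂ) ^ ρ
    simpa using this
  have hdet : h = (Matrix.of fun i k : Fin m =>
      Polynomial.aeval (X (Sum.inl k) : MvPolynomial (Fin m ⊕ ι) ℂ)
        (Polynomial.X ^ (ρ * (i : ℕ)) : Polynomial ℂ)).det := by
    rw [hh, diffProd_eq_det]
    simp [pow_mul]
  have hXne : ∀ k l : Fin m, l ≠ k → (Sum.inl l : Fin m ⊕ ι) ≠ Sum.inl k := fun k l hlk =>
    fun h' => hlk (Sum.inl_injective h')
  have hdual : ∑ k, secondOrder (pderiv (Sum.inl k)) (C a₀ + C a₁ * X (Sum.inl k)) (C b₀) (h * P) =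
      -(h * ∑ i, pderiv (Sum.inr i) (pderiv (Sum.inr i) P)) := by
    refine secondOrder_diffProd_mul_prod (fun k => pderiv (Sum.inl k)) (fun i => pderiv (Sum.inr i))
      _ (fun k => C (ρ : ℂ) * X (Sum.inl k) ^ (ρ - 1)) _ _ D hdD ?_ ?_ hlap hgrad ?_ ?_ ?_
    · intro k l hlk
      simp [Derivation.leibniz_pow, pderiv_X_of_ne (hXne k l hlk)]
    · intro k
      simp [Derivation.leibniz_pow]
    · rw [← hh, hdet]
      refine sum_secondOrder_det_of_shift _ _ _ (fun i k : Fin m =>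
        Polynomial.aeval (X (Sum.inl k) : MvPolynomial (Fin m ⊕ ι) ℂ)
          (Polynomial.X ^ (ρ * (i : ℕ)) : Polynomial ℂ)) (fun k l i hlk =>
        pderiv_aeval_X_of_ne (hXne k l hlk) _) fun i => ?_
      simp only [secondOrder_aeval_X]
      rcases hharm i with h0 | ⟨μ, j, hj, h1⟩
      · exact Or.inl fun k => by rw [h0, map_zero]
      · refine Or.inr ⟨C μ, ⟨j, hj.trans i.2⟩, fun h' => hj.ne (congrArg Fin.val h'), fun k => ?_⟩
        rw [h1, map_mul, Polynomial.aeval_C]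
        rfl
    · intro k l hkl
      -- Evaluation with one spectral variable equal to 2 and the others to 1 separates the powers.
      have h1 := congrArg (eval (Sum.elim (fun j => if j = k then (2 : ℂ) else 1) 0)) hkl
      by_contra hne
      simp [Ne.symm hne] at h1
      have h2 : (2 : ℕ) ^ ρ = 1 := by exact_mod_cast h1
      exact absurd h2 (Nat.one_lt_two_pow hρ.ne').ne'
    · intro k hk
      classical
      have := hlead k (Finsupp.single (Sum.inl k) e) (by
        rw [hk, zero_sub, coeff_neg, X_pow_eq_monomial, coeff_monomial, if_pos rfl]
        simp)
      rw [Finsupp.weight_single] at this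
      simp at this
  -- Euler's identity for weighted homogeneity: the Vandermonde product contributes the sum of the
  -- `ρ * i`, and each `D k` contributes `e`, all multiplied by `w`.
  have heul : ∑ i, X (Sum.inr i) * pderiv (Sum.inr i) (h * P) +
      ∑ k, C (w : ℂ) * X (Sum.inl k) * pderiv (Sum.inl k) (h * P) = C ((w : ℂ) * n) * (h * P) := by
    have h1 : ∑ k, C (w : ℂ) * X (Sum.inl k) * pderiv (Sum.inl k) h =
        C ((w : ℂ) * ∑ i : Fin m, ((ρ * i : ℕ) : ℂ)) * h := by
      have := sum_secondOrder_det_of_eigen (fun k : Fin m => pderiv (Sum.inl k)) (fun _ => 0)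
        (fun k => C (w : ℂ) * X (Sum.inl k)) (fun i k : Fin m =>
          Polynomial.aeval (X (Sum.inl k) : MvPolynomial (Fin m ⊕ ι) ℂ)
            (Polynomial.X ^ (ρ * (i : ℕ)) : Polynomial ℂ)) (fun k l i hlk =>
          pderiv_aeval_X_of_ne (hXne k l hlk) _) (fun i => C ((w : ℂ) * (ρ * i : ℕ))) fun i k => by
          rw [secondOrder_apply, pderiv_aeval_X_self, Polynomial.derivative_X_pow]
          rcases Nat.eq_zero_or_pos (ρ * i) with h0 | h0
          · simp [h0]
          · obtain ⟨j, hj⟩ := Nat.exists_eq_add_of_lt h0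
            rw [hj]
            simp [pow_succ]
            ring
      rw [← hdet] at this
      simpa [secondOrder_apply, map_sum, Finset.mul_sum] using this
    have h2 : ∀ k : Fin m, pderiv (Sum.inl k) P =
        (∏ l ∈ Finset.univ.erase k, D l) * pderiv (Sum.inl k) (D k) := fun k => by
      rw [hP, Derivation.map_prod_eq_sum]
      exact Finset.sum_eq_single k (fun l _ hl => by rw [hdD k l hl, mul_zero]) (by simp)
    have h3 : ∑ i, X (Sum.inr i) * pderiv (Sum.inr i) P +
        ∑ k, C (w : ℂ) * X (Sum.inl k) * pderiv (Sum.inl k) P =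
        C ((w : ℂ) * ∑ i : Fin m, (e : ℂ)) * P := by
      simp only [h2]
      simp only [hP, Derivation.map_prod_eq_sum, Finset.mul_sum]
      rw [Finset.sum_comm, ← Finset.sum_add_distrib, map_sum, Finset.sum_mul]
      refine Finset.sum_congr rfl fun k _ => ?_
      rw [← Finset.prod_erase_mul _ _ (Finset.mem_univ k), mul_left_comm (C _), ← heuler,
        mul_add, Finset.mul_sum]
      refine congrArg₂ (· + ·) ?_ ?_
      · exact Finset.sum_congr rfl fun i _ => by ring
      · ring
    have h4 : ∀ i : ι, pderiv (Sum.inr i) h = 0 := fun i => by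
      rw [← hren, pderiv_rename_inl_inr]
    simp only [Derivation.leibniz, smul_eq_mul, h4, mul_zero, add_zero]
    have h5 : (n : ℂ) = ∑ i : Fin m, (e : ℂ) + ∑ i : Fin m, ((ρ * i : ℕ) : ℂ) := by
      rw [hn, ← Finset.sum_add_distrib]
      push_cast
      rfl
    rw [h5, mul_add, C_add, add_mul]
    simp only [mul_add, Finset.sum_add_distrib]
    have h6 : ∀ x : Fin m, C (w : ℂ) * X (Sum.inl x) * (P * pderiv (Sum.inl x) h) =
        P * (C (w : ℂ) * X (Sum.inl x) * pderiv (Sum.inl x) h) := fun x => by ring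
    have h7 : ∀ x : Fin m, C (w : ℂ) * X (Sum.inl x) * (h * pderiv (Sum.inl x) P) =
        h * (C (w : ℂ) * X (Sum.inl x) * pderiv (Sum.inl x) P) := fun x => by ring
    have h8 : ∀ x : ι, X (Sum.inr x) * (h * pderiv (Sum.inr x) P) =
        h * (X (Sum.inr x) * pderiv (Sum.inr x) P) := fun x => by ring
    simp only [h6, h7, h8, ← Finset.mul_sum, h1]
    linear_combination h * h3
  have heigF : ∑ k, secondOrder (pderiv k) (-C v * (C a₀ + C a₁ * X k))
      (C (w : ℂ) * X k - C v * C b₀) (h₀ * partialExp (Fin m) mom P) =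
      C ((w : ℂ) * n) * (h₀ * partialExp (Fin m) mom P) := by
    have hF : h₀ * partialExp (Fin m) mom P = partialExp (Fin m) mom (h * P) := by
      rw [← hren, partialExp_rename_inl_mul]
    have hC : ∀ (c : ℂ) (f : MvPolynomial (Fin m ⊕ ι) ℂ),
        partialExp (Fin m) mom (C c * f) = C c * partialExp (Fin m) mom f := fun c f => by
      rw [← smul_eq_C_mul, map_smul, smul_eq_C_mul]
    have hT : ∀ k, secondOrder (pderiv k) (-C v * (C a₀ + C a₁ * X k))
        (C (w : ℂ) * X k - C v * C b₀) (partialExp (Fin m) mom (h * P)) =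
        partialExp (Fin m) mom (C (w : ℂ) * X (Sum.inl k) * pderiv (Sum.inl k) (h * P)) -
        C v * partialExp (Fin m) mom (secondOrder (pderiv (Sum.inl k))
          (C a₀ + C a₁ * X (Sum.inl k)) (C b₀) (h * P)) := fun k => by
      simp only [secondOrder_apply, add_mul, mul_assoc, map_add, hC, partialExp_X_inl_mul,
        pderiv_partialExp]
      ring
    -- Integration by parts in each coordinate turns the Euler field into `v` times the Laplacian;
    -- `h` involves no Gaussian coordinate and passes through the derivatives.
    have hstein : partialExp (Fin m) mom (∑ i, X (Sum.inr i) * pderiv (Sum.inr i) (h * P)) =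
        C v * partialExp (Fin m) mom (h * ∑ i, pderiv (Sum.inr i) (pderiv (Sum.inr i) P)) := by
      rw [map_sum, Finset.mul_sum, map_sum, Finset.mul_sum]
      refine Finset.sum_congr rfl fun i _ => ?_
      rw [partialExp_X_inr_mul hmom, ← hren]
      simp [pderiv_rename_inl_inr]
    rw [hF, Finset.sum_congr rfl fun k _ => hT k, Finset.sum_sub_distrib, ← map_sum,
      ← Finset.mul_sum, ← map_sum, hdual, map_neg]
    have h1 := congrArg (partialExp (Fin m) mom) heul
    rw [map_add, hstein, hC] at h1
    linear_combination h1
  have heigG : ∑ k, secondOrder (pderiv k) (-C v * (C a₀ + C a₁ * X k))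
      (C (w : ℂ) * X k - C v * C b₀) (Matrix.of fun i k : Fin m =>
        Polynomial.aeval (X k : MvPolynomial (Fin m) ℂ) (r i)).det =
      C ((w : ℂ) * n) * (Matrix.of fun i k : Fin m =>
        Polynomial.aeval (X k : MvPolynomial (Fin m) ℂ) (r i)).det := by
    rw [sum_secondOrder_det_of_eigen _ _ _ _ (fun k l i hlk => pderiv_aeval_X_of_ne hlk _)
      (fun i : Fin m => C ((w : ℂ) * (e + ρ * i : ℕ))) fun i k => ?_]
    · rw [← map_sum, ← Finset.mul_sum, hn, Nat.cast_sum]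
    · have := congrArg (Polynomial.aeval (X k : MvPolynomial (Fin m) ℂ)) (hr i)
      rw [map_mul _ (Polynomial.C _), Polynomial.aeval_C] at this
      rw [← MvPolynomial.algebraMap_eq, ← this]
      simp [secondOrder_apply, spectralOp, MvPolynomial.algebraMap_eq]
      ring
  -- Both sides have the top part det X_k^(e + ρ i), which is the Vandermonde product times ∏ X_k^e.
  have hlow : DegLT 1 n (h₀ * partialExp (Fin m) mom P - (Matrix.of fun i k : Fin m =>
        Polynomial.aeval (X k : MvPolynomial (Fin m) ℂ) (r i)).det) := by
    have hX : ∀ (k : Fin m) (j : ℕ), DegLT 1 (j + 1) (X k ^ j : MvPolynomial (Fin m) ℂ) :=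
      fun k j => by simpa using (DegLT.X (w := 1) (n := 1) k le_rfl).pow j
    have hXB : ∀ (k : Fin m) (j : ℕ),
        DegLT (Sum.elim 1 0) (j + 1) (X (Sum.inl k) ^ j : MvPolynomial (Fin m ⊕ ι) ℂ) :=
      fun k j => by simpa using (DegLT.X (w := Sum.elim 1 0) (n := 1) (Sum.inl k) le_rfl).pow j
    have h1 : DegLT 1 (∑ k : Fin m, e) (partialExp (Fin m) mom P - ∏ k, X k ^ e) := by
      have h2 := degLT_partialExp mom (DegLT.prod_sub_prod Finset.univ (F := D)
        (fun k _ => hXB k e) fun k _ => hlead k)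
      have h3 : partialExp (Fin m) mom (∏ k, X (Sum.inl k) ^ e : MvPolynomial (Fin m ⊕ ι) ℂ) =
          ∏ k, X k ^ e := by
        have h4 := partialExp_rename_inl_mul (ι := ι) mom (∏ k : Fin m, X k ^ e) 1
        have h5 : partialExp (Fin m) mom (1 : MvPolynomial (Fin m ⊕ ι) ℂ) = 1 := by
          rw [← C_1, C_apply, partialExp_monomial]
          simp [hmom₀]
        rw [h5] at h4
        simpa [map_prod] using h4
      rwa [map_sub, h3] at h2
    have h2 : DegLT 1 (∑ i : Fin m, ρ * (i : ℕ) + 1) h₀ := by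
      rw [hh₀, diffProd_eq_det]
      refine DegLT.det fun i k => ?_
      rw [← pow_mul]
      exact hX k _
    have h3 : h₀ * ∏ k, X k ^ e = (Matrix.of fun i k : Fin m =>
        (X k : MvPolynomial (Fin m) ℂ) ^ (e + ρ * (i : ℕ))).det := by
      rw [hh₀, diffProd_eq_det, mul_comm, ← Matrix.det_mul_row]
      simp [pow_add, pow_mul]
    have h4 := DegLT.det_sub_det (w := 1) (N := fun i : Fin m => e + ρ * (i : ℕ))
      (F := fun i k : Fin m => Polynomial.aeval (X k : MvPolynomial (Fin m) ℂ) (r i))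
      (G := fun i k => X k ^ (e + ρ * (i : ℕ))) (fun i k => hX k _) fun i k => by
        have := degLT_aeval_X k (hr_deg i)
        simpa using this
    have h5 := h2.mul h1
    rw [mul_sub, h3, ← Finset.sum_add_distrib] at h5
    simp only [add_comm (ρ * _) e] at h5
    have h6 := h5.sub h4
    rwa [sub_sub_sub_cancel_right] at h6
  rw [← sub_eq_zero]
  refine eq_zero_of_degLT_of_eigen hw v a₀ a₁ b₀ hlow ?_
  simp only [map_sub, Finset.sum_sub_distrib, heigF, heigG, mul_sub]

end DualityExpectation

/-! ### Contraction of traces against covariance tensors. -/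

section TraceSums

variable {A : Type*} [CommRing A] {ι : Type*} [Fintype ι]

theorem sum_trace_mul_trace {p q r s : Type*} [Fintype p] [Fintype q] [Fintype r] [Fintype s]
    (P : Matrix q p A) (Q : Matrix s r A) (E : ι → Matrix p q A) (F : ι → Matrix r s A) :
    ∑ i, (P * E i).trace * (Q * F i).trace =
      ∑ b, ∑ a, ∑ d, ∑ c, P b a * Q d c * ∑ i, E i a b * F i c d := by
  have h : ∀ i, (P * E i).trace * (Q * F i).trace =
      ∑ b, ∑ a, ∑ d, ∑ c, P b a * Q d c * (E i a b * F i c d) := fun i => by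
    simp only [Matrix.trace, Matrix.diag_apply, Matrix.mul_apply]
    rw [Finset.sum_mul]
    refine Finset.sum_congr rfl fun b _ => ?_
    rw [Finset.sum_mul]
    refine Finset.sum_congr rfl fun a _ => ?_
    rw [Finset.mul_sum]
    refine Finset.sum_congr rfl fun d _ => ?_
    rw [Finset.mul_sum]
    refine Finset.sum_congr rfl fun c _ => ?_
    ring
  simp only [h, Finset.mul_sum]
  rw [Finset.sum_comm]
  refine Finset.sum_congr rfl fun b _ => ?_
  rw [Finset.sum_comm]
  refine Finset.sum_congr rfl fun a _ => ?_
  rw [Finset.sum_comm]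
  refine Finset.sum_congr rfl fun d _ => ?_
  rw [Finset.sum_comm]

theorem sum_trace_mul_mul_mul {p q r s : Type*} [Fintype p] [Fintype q] [Fintype r] [Fintype s]
    (P : Matrix s p A) (Q : Matrix q r A) (E : ι → Matrix p q A) (F : ι → Matrix r s A) :
    ∑ i, (P * E i * Q * F i).trace =
      ∑ d, ∑ c, ∑ b, ∑ a, P d a * Q b c * ∑ i, E i a b * F i c d := by
  simp only [Matrix.trace, Matrix.diag_apply, Matrix.mul_apply, Finset.sum_mul, Finset.mul_sum]
  rw [Finset.sum_comm]
  refine Finset.sum_congr rfl fun b _ => ?_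
  rw [Finset.sum_comm]
  refine Finset.sum_congr rfl fun a _ => ?_
  rw [Finset.sum_comm]
  refine Finset.sum_congr rfl fun d _ => ?_
  rw [Finset.sum_comm]
  refine Finset.sum_congr rfl fun c _ => ?_
  refine Finset.sum_congr rfl fun i _ => ?_
  ring

/-- Contracting across two traces merges them into one; contracting inside one trace, as in the next
lemma, splits it into two. -/
theorem sum_trace_mul_trace_of_unitary {p q : Type*} [Fintype p] [Fintype q] [DecidableEq p]
    [DecidableEq q] {t : A} (P : Matrix q p A) (Q : Matrix p q A) (E : ι → Matrix p q A)
    (F : ι → Matrix q p A)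
    (h : ∀ a b c d, ∑ i, E i a b * F i c d = if a = d ∧ b = c then t else 0) :
    ∑ i, (P * E i).trace * (Q * F i).trace = t * (P * Q).trace := by
  rw [sum_trace_mul_trace]
  simp only [h, ite_and, mul_ite, mul_zero, Finset.sum_ite_eq, Finset.mem_univ, if_true,
    Finset.sum_ite_irrel, Finset.sum_const_zero]
  simp only [Matrix.trace, Matrix.diag_apply, Matrix.mul_apply, Finset.mul_sum]
  refine Finset.sum_congr rfl fun b _ => Finset.sum_congr rfl fun a _ => ?_
  ring

theorem sum_trace_mul_mul_mul_of_unitary {p q : Type*} [Fintype p] [Fintype q] [DecidableEq p]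
    [DecidableEq q] {t : A} (P : Matrix p p A) (Q : Matrix q q A) (E : ι → Matrix p q A)
    (F : ι → Matrix q p A)
    (h : ∀ a b c d, ∑ i, E i a b * F i c d = if a = d ∧ b = c then t else 0) :
    ∑ i, (P * E i * Q * F i).trace = t * (P.trace * Q.trace) := by
  rw [sum_trace_mul_mul_mul]
  simp only [h, ite_and, mul_ite, mul_zero, Finset.sum_ite_eq', Finset.mem_univ, if_true]
  simp only [Matrix.trace, Matrix.diag_apply, Finset.mul_sum, Finset.sum_mul]
  rw [Finset.sum_comm]
  refine Finset.sum_congr rfl fun b _ => Finset.sum_congr rfl fun a _ => ?_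
  ring

/-- The matrices `S` and `S'` encode a symmetry S Hᵀ S' = -H of the ensemble; `S = S' = 0` is the
unitary case. -/
theorem sum_trace_mul_trace_of_twisted {p : Type*} [Fintype p] [DecidableEq p]
    (P Q S S' : Matrix p p A) (E : ι → Matrix p p A)
    (h : ∀ a b c d, ∑ i, E i a b * E i c d = (if a = d ∧ b = c then 1 else 0) - S a c * S' d b) :
    ∑ i, (P * E i).trace * (Q * E i).trace = (P * Q).trace - (P * (S * Qᵀ * S')).trace := by
  rw [sum_trace_mul_trace]
  simp only [h, mul_sub, Finset.sum_sub_distrib]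
  congr 1
  · simp only [ite_and, mul_ite, mul_zero, Finset.sum_ite_eq, Finset.mem_univ, if_true,
      Finset.sum_ite_irrel, Finset.sum_const_zero]
    simp only [Matrix.trace, Matrix.diag_apply, Matrix.mul_apply, mul_one]
  · simp only [Matrix.trace, Matrix.diag_apply, Matrix.mul_apply, Finset.mul_sum, Finset.sum_mul,
      Matrix.transpose_apply]
    refine Finset.sum_congr rfl fun b _ => Finset.sum_congr rfl fun a _ =>
      Finset.sum_congr rfl fun d _ => Finset.sum_congr rfl fun c _ => ?_
    ring

/-- The twist enters through `S'ᵀ`, but through `S'` when two traces are contracted. In the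
Laplacian of a determinant the two contributions are subtracted: they cancel for symmetric `S'` and
reinforce each other for antisymmetric `S'`. -/
theorem sum_trace_mul_mul_mul_of_twisted {p : Type*} [Fintype p] [DecidableEq p]
    (P Q S S' : Matrix p p A) (E : ι → Matrix p p A)
    (h : ∀ a b c d, ∑ i, E i a b * E i c d = (if a = d ∧ b = c then 1 else 0) - S a c * S' d b) :
    ∑ i, (P * E i * Q * E i).trace = P.trace * Q.trace - (P * (S * Qᵀ * S'ᵀ)).trace := by
  rw [sum_trace_mul_mul_mul]
  simp only [h, mul_sub, Finset.sum_sub_distrib]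
  congr 1
  · simp only [ite_and, mul_ite, mul_zero, Finset.sum_ite_eq', Finset.mem_univ, if_true]
    simp only [Matrix.trace, Matrix.diag_apply, Finset.mul_sum, Finset.sum_mul, mul_one]
    rw [Finset.sum_comm]
  · simp only [Matrix.trace, Matrix.diag_apply, Matrix.mul_apply, Finset.mul_sum, Finset.sum_mul,
      Matrix.transpose_apply]
    refine Finset.sum_congr rfl fun d _ => ?_
    rw [Finset.sum_comm]
    conv_rhs => rw [Finset.sum_comm]
    refine Finset.sum_congr rfl fun b _ => ?_
    rw [Finset.sum_comm]
    refine Finset.sum_congr rfl fun a _ => Finset.sum_congr rfl fun c _ => ?_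
    ring

end TraceSums

/-! ### Second derivatives of determinants and resolvent identities. -/

section CharDet

variable {R A : Type*} [CommRing R] [CommRing A] [Algebra R A]
  {n : Type*} [Fintype n] [DecidableEq n]

/-- The classical formula (tr M⁻¹dM)² - tr (M⁻¹dM)² + tr M⁻¹d²M for d²(det M)/det M, multiplied by
(det M)² so that no inverse is needed. -/
theorem det_mul_derivation_derivation_det (d : Derivation R A A) (M : Matrix n n A) :
    M.det * d (d M.det) = (M.adjugate * M.map d).trace ^ 2 -
      (M.adjugate * M.map d * M.adjugate * M.map d).trace +
      M.det * (M.adjugate * (M.map d).map d).trace := by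
  have htr : ∀ N : Matrix n n A, d N.trace = (N.map d).trace := fun N => by
    simp [Matrix.trace]
  rw [d.map_det M, htr, Matrix.map_derivation_mul, Matrix.trace_add, mul_add, add_comm]
  congr 1
  rw [← smul_eq_mul, ← Matrix.trace_smul, ← smul_mul_assoc, det_smul_map_adjugate, d.map_det,
    sub_mul, Matrix.trace_sub, smul_mul_assoc, Matrix.trace_smul, smul_eq_mul, sq]

variable {x y : A} {H : Matrix n n A}

theorem trace_adjugate_mul_charMatrix :
    ((x • (1 : Matrix n n A) - H).adjugate * (x • (1 : Matrix n n A) - H)).trace =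
      Fintype.card n * (x • (1 : Matrix n n A) - H).det := by
  rw [Matrix.adjugate_mul, Matrix.trace_smul, Matrix.trace_one, smul_eq_mul, mul_comm]

/-- The resolvent identity, for adjugates. -/
theorem sub_mul_trace_adjugate_mul_adjugate :
    (y - x) * ((x • (1 : Matrix n n A) - H).adjugate * (y • (1 : Matrix n n A) - H).adjugate).trace =
      (x • (1 : Matrix n n A) - H).adjugate.trace * (y • (1 : Matrix n n A) - H).det -
      (x • (1 : Matrix n n A) - H).det * (y • (1 : Matrix n n A) - H).adjugate.trace := by
  set M := x • (1 : Matrix n n A) - H with hM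
  set N := y • (1 : Matrix n n A) - H with hN
  have h1 : M.adjugate * (N - M) * N.adjugate = N.det • M.adjugate - M.det • N.adjugate := by
    rw [mul_sub, sub_mul, mul_assoc, Matrix.mul_adjugate, Matrix.adjugate_mul]
    simp
  have h2 : N - M = (y - x) • (1 : Matrix n n A) := by
    rw [hM, hN, sub_smul]
    abel
  rw [h2] at h1
  have h3 := congrArg Matrix.trace h1
  simp only [mul_smul_comm, smul_mul_assoc, mul_one, Matrix.trace_smul, Matrix.trace_sub,
    smul_eq_mul] at h3
  rw [h3]
  ring

/-- The symmetry gives S (y - H)ᵀ S' = y + H, and (x - H) + (y + H) = x + y. So this is the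
resolvent identity with -H in place of one H, whence x + y instead of y - x. -/
theorem add_mul_trace_adjugate_mul_twisted {S S' : Matrix n n A} (hS : S' * S = 1)
    (hH : S * Hᵀ * S' = -H) :
    (x + y) * ((x • (1 : Matrix n n A) - H).adjugate *
      (S * (y • (1 : Matrix n n A) - H).adjugateᵀ * S')).trace =
      (x • (1 : Matrix n n A) - H).adjugate.trace * (y • (1 : Matrix n n A) - H).det +
      (x • (1 : Matrix n n A) - H).det * (y • (1 : Matrix n n A) - H).adjugate.trace := by
  set M := x • (1 : Matrix n n A) - H with hM
  set N := y • (1 : Matrix n n A) - H with hN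
  have hS' : S * S' = 1 := mul_eq_one_comm.1 hS
  have h0 : S * Nᵀ * S' = y • 1 + H := by
    rw [hN, Matrix.transpose_sub, mul_sub, sub_mul, hH]
    simp [hS']
  have h1 : (y • 1 + H) * (S * N.adjugateᵀ * S') = N.det • 1 := by
    rw [← h0]
    calc S * Nᵀ * S' * (S * N.adjugateᵀ * S') = S * (Nᵀ * (S' * S) * N.adjugateᵀ) * S' := by
          simp only [mul_assoc]
      _ = N.det • 1 := by
          rw [hS, mul_one, ← Matrix.transpose_mul, Matrix.adjugate_mul]
          simp [hS']
  have h2 : (x + y) • (1 : Matrix n n A) = M + (y • 1 + H) := by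
    rw [hM, add_smul]
    abel
  have h3 : (x + y) • (M.adjugate * (S * N.adjugateᵀ * S')) =
      M.det • (S * N.adjugateᵀ * S') + N.det • M.adjugate := by
    calc (x + y) • (M.adjugate * (S * N.adjugateᵀ * S')) =
          M.adjugate * ((x + y) • (1 : Matrix n n A)) * (S * N.adjugateᵀ * S') := by simp
      _ = _ := by
        rw [h2, mul_add, add_mul, Matrix.adjugate_mul, mul_assoc _ (y • 1 + H), h1]
        simp
  have h4 : (S * N.adjugateᵀ * S').trace = N.adjugate.trace := by
    rw [Matrix.trace_mul_comm, ← mul_assoc, hS, one_mul, Matrix.trace_transpose]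
  have h5 := congrArg Matrix.trace h3
  simp only [Matrix.trace_smul, Matrix.trace_add, smul_eq_mul, h4] at h5
  rw [h5]
  ring

end CharDet

/-! ### Characteristic polynomials in the spectral and entry variables. -/

section SpectralDet

open MvPolynomial

variable {m : ℕ} {ι : Type*} {n : Type*} [DecidableEq n]

/-- The matrix `x_k - H`, for a matrix `H` of polynomials in the variables indexed by `ι`. -/
noncomputable def spectralMat (H : Matrix n n (MvPolynomial ι ℂ)) (k : Fin m) :
    Matrix n n (MvPolynomial (Fin m ⊕ ι) ℂ) :=
  (X (Sum.inl k) : MvPolynomial (Fin m ⊕ ι) ℂ) • (1 : Matrix n n (MvPolynomial (Fin m ⊕ ι) ℂ)) -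
    H.map (rename Sum.inr)

/-- The characteristic polynomial `det (x_k - H)`. -/
noncomputable def spectralDet [Fintype n] (H : Matrix n n (MvPolynomial ι ℂ)) (k : Fin m) :
    MvPolynomial (Fin m ⊕ ι) ℂ :=
  (spectralMat H k).det

theorem pderiv_rename_inr_inl {κ ι : Type*} (k : κ) (q : MvPolynomial ι ℂ) :
    pderiv (Sum.inl k : κ ⊕ ι) (rename Sum.inr q) = 0 := by
  induction q using MvPolynomial.induction_on with
  | C a => simp
  | add p q hp hq => simp [hp, hq]
  | mul_X p k hp =>
    rw [map_mul (rename Sum.inr), rename_X, Derivation.leibniz, hp, pderiv_X_of_ne (by simp)]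
    simp

variable (H : Matrix n n (MvPolynomial ι ℂ))

theorem spectralMat_map_pderiv_inl_self (k : Fin m) :
    (spectralMat H k).map (pderiv (Sum.inl k)) = 1 := by
  refine Matrix.ext fun i j => ?_
  by_cases h : i = j <;> simp [spectralMat, Matrix.one_apply, h, pderiv_rename_inr_inl]

theorem spectralMat_map_pderiv_inl_of_ne {k l : Fin m} (hkl : l ≠ k) :
    (spectralMat H l).map (pderiv (Sum.inl k)) = 0 := by
  have hne : (Sum.inl l : Fin m ⊕ ι) ≠ Sum.inl k := fun h => hkl (Sum.inl_injective h)
  refine Matrix.ext fun i j => ?_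
  by_cases h : i = j <;>
    simp [spectralMat, h, pderiv_rename_inr_inl, pderiv_X_of_ne hne]

variable [Fintype n]

theorem pderiv_inl_spectralDet_of_ne {k l : Fin m} (hkl : l ≠ k) :
    pderiv (Sum.inl k) (spectralDet H l) = 0 := by
  rw [spectralDet, Derivation.map_det, spectralMat_map_pderiv_inl_of_ne H hkl]
  simp

theorem pderiv_inl_spectralDet (k : Fin m) :
    pderiv (Sum.inl k) (spectralDet H k) = (spectralMat H k).adjugate.trace := by
  rw [spectralDet, Derivation.map_det, spectralMat_map_pderiv_inl_self, mul_one]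

theorem spectralDet_mul_pderiv_pderiv (k : Fin m) :
    spectralDet H k * pderiv (Sum.inl k) (pderiv (Sum.inl k) (spectralDet H k)) =
      (spectralMat H k).adjugate.trace ^ 2 -
        ((spectralMat H k).adjugate * (spectralMat H k).adjugate).trace := by
  rw [spectralDet, det_mul_derivation_derivation_det, spectralMat_map_pderiv_inl_self]
  have : (1 : Matrix n n (MvPolynomial (Fin m ⊕ ι) ℂ)).map (pderiv (Sum.inl k)) = 0 := by
    refine Matrix.ext fun i j => ?_
    by_cases h : i = j <;> simp [h]
  simp [this]

theorem eval_spectralDet (α : Fin m → ℂ) (g : ι → ℂ) (k : Fin m) :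
    eval (Sum.elim α g) (spectralDet H k) = (α k • (1 : Matrix n n ℂ) - H.map (eval g)).det := by
  rw [spectralDet, RingHom.map_det]
  congr 1
  refine Matrix.ext fun i j => ?_
  have : ∀ q, eval (Sum.elim α g) (rename Sum.inr q) = eval g q := fun q => by
    rw [eval_rename]
    rfl
  by_cases h : i = j <;> simp [spectralMat, h, this]

/-- This is the monic characteristic polynomial of H at the spectral variable; its coefficients
involve only entry variables, which have weight zero. -/
theorem degLT_spectralDet_sub (k : Fin m) :
    DegLT (Sum.elim 1 0) (Fintype.card n) (spectralDet H k - X (Sum.inl k) ^ Fintype.card n) := by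
  have hrange : ∀ q : MvPolynomial ι ℂ,
      DegLT (Sum.elim (1 : Fin m → ℕ) 0) 1 (rename Sum.inr q) := fun q => by
    induction q using MvPolynomial.induction_on with
    | C a => rw [rename_C]; exact DegLT.C a
    | add p q hp hq => rw [map_add]; exact hp.add hq
    | mul_X p i hp =>
      rw [map_mul (rename Sum.inr), rename_X]
      exact hp.mul (p := 0) (q := 1) (DegLT.X (n := 0) _ le_rfl)
  have h1 : spectralDet H k = ∑ j ∈ Finset.range (Fintype.card n + 1),
      rename Sum.inr (H.charpoly.coeff j) * X (Sum.inl k) ^ j := by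
    have h2 : spectralDet H k = H.charpoly.eval₂
        ((rename Sum.inr : MvPolynomial ι ℂ →ₐ[ℂ] MvPolynomial (Fin m ⊕ ι) ℂ) :
          MvPolynomial ι ℂ →+* MvPolynomial (Fin m ⊕ ι) ℂ) (X (Sum.inl k)) := by
      rw [Matrix.charpoly, ← Polynomial.coe_eval₂RingHom, RingHom.map_det, spectralDet]
      congr 1
      refine Matrix.ext fun i j => ?_
      by_cases h : i = j <;> simp [spectralMat, h]
    rw [h2, Polynomial.eval₂_eq_sum_range' _ (n := Fintype.card n + 1)]
    · rfl
    · rw [Matrix.charpoly_natDegree_eq_dim]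
      exact Nat.lt_succ_self _
  rw [h1, Finset.sum_range_succ]
  have h3 : H.charpoly.coeff (Fintype.card n) = 1 := by
    rw [← Matrix.charpoly_natDegree_eq_dim H]
    exact Matrix.charpoly_monic H
  rw [h3, map_one, one_mul, add_sub_cancel_right]
  refine DegLT.sum fun j hj => ?_
  have h4 := (hrange (H.charpoly.coeff j)).mul (p := 0)
    ((DegLT.X (w := Sum.elim (1 : Fin m → ℕ) (0 : ι → ℕ)) (n := 1) (Sum.inl k) le_rfl).pow j)
  refine h4.mono ?_
  have := Finset.mem_range.1 hj
  omega

theorem spectralDet_ne_zero (k : Fin m) : spectralDet H k ≠ 0 := fun h0 => by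
  classical
  have := degLT_spectralDet_sub H k (Finsupp.single (Sum.inl k) (Fintype.card n)) (by
    rw [h0, zero_sub, coeff_neg, X_pow_eq_monomial, coeff_monomial, if_pos rfl]
    simp)
  rw [Finsupp.weight_single] at this
  simp at this

end SpectralDet

/-! ### Matrices depending linearly on the Gaussian coordinates. -/

section LinearModel

open MvPolynomial

variable {m : ℕ} {ι : Type*} [Fintype ι] {n n' : Type*}

/-- The generic linear combination of the matrices `E i`. -/
noncomputable def linMat (E : ι → Matrix n n' ℂ) : Matrix n n' (MvPolynomial ι ℂ) :=
  ∑ i, (X i : MvPolynomial ι ℂ) • (E i).map C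

theorem linMat_map_eval (E : ι → Matrix n n' ℂ) (g : ι → ℂ) :
    (linMat E).map (eval g) = ∑ i, g i • E i := by
  refine Matrix.ext fun a b => ?_
  simp [linMat, Matrix.sum_apply]

theorem linMat_map_rename (E : ι → Matrix n n' ℂ) :
    (linMat E).map (rename (Sum.inr : ι → Fin m ⊕ ι)) =
      ∑ i, (X (Sum.inr i) : MvPolynomial (Fin m ⊕ ι) ℂ) • (E i).map C := by
  refine Matrix.ext fun a b => ?_
  simp [linMat, Matrix.sum_apply]

theorem sum_map_C_mul_map_C {E : ι → Matrix n n ℂ} {a b c d : n} {z : ℂ}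
    (h : ∑ i, E i a b * E i c d = z) :
    ∑ i, ((E i).map C : Matrix n n (MvPolynomial (Fin m ⊕ ι) ℂ)) a b *
      ((E i).map C : Matrix n n (MvPolynomial (Fin m ⊕ ι) ℂ)) c d = C z := by
  simp [← h, map_sum]

variable [DecidableEq n]

theorem spectralMat_linMat_map_pderiv_inr [DecidableEq ι] (E : ι → Matrix n n ℂ) (k : Fin m) (i : ι) :
    (spectralMat (linMat E) k).map (pderiv (Sum.inr i)) = -(E i).map C := by
  refine Matrix.ext fun a b => ?_
  rw [spectralMat, linMat_map_rename]
  by_cases h : a = b <;>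
    simp [Matrix.sum_apply, h, pderiv_X, Pi.single_apply]

variable [Fintype n]

/-- The matrix x_k - H is linear in all variables, so the Euler field reproduces it, and tr(adj M ·
M) is the size of M times det M. -/
theorem euler_spectralDet_linMat (E : ι → Matrix n n ℂ) (k : Fin m) :
    ∑ i, X (Sum.inr i) * pderiv (Sum.inr i) (spectralDet (linMat E) k) +
      X (Sum.inl k) * pderiv (Sum.inl k) (spectralDet (linMat E) k) =
      (Fintype.card n : MvPolynomial (Fin m ⊕ ι) ℂ) * spectralDet (linMat E) k := by
  classical
  have h1 : spectralMat (linMat E) k = (X (Sum.inl k) : MvPolynomial (Fin m ⊕ ι) ℂ) • 1 -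
      ∑ i, (X (Sum.inr i) : MvPolynomial (Fin m ⊕ ι) ℂ) • (E i).map C := by
    rw [spectralMat, linMat_map_rename]
  have h2 : (Fintype.card n : MvPolynomial (Fin m ⊕ ι) ℂ) * spectralDet (linMat E) k =
      ((spectralMat (linMat E) k).adjugate * spectralMat (linMat E) k).trace :=
    trace_adjugate_mul_charMatrix.symm
  rw [h2, congrArg (fun Z => ((spectralMat (linMat E) k).adjugate * Z).trace) h1,
    pderiv_inl_spectralDet, spectralDet, mul_sub, Matrix.trace_sub, Finset.mul_sum,
    Matrix.trace_sum, sub_eq_add_neg, ← Finset.sum_neg_distrib, add_comm]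
  refine congrArg₂ (· + ·) (by simp) ?_
  refine Finset.sum_congr rfl fun i _ => ?_
  rw [Derivation.map_det, spectralMat_linMat_map_pderiv_inr]
  simp

theorem pderiv_inr_spectralDet_linMat (E : ι → Matrix n n ℂ) (k : Fin m) (i : ι) :
    pderiv (Sum.inr i) (spectralDet (linMat E) k) =
      -((spectralMat (linMat E) k).adjugate * (E i).map C).trace := by
  classical
  rw [spectralDet, Derivation.map_det, spectralMat_linMat_map_pderiv_inr, mul_neg, Matrix.trace_neg]

theorem spectralDet_mul_pderiv_pderiv_inr (E : ι → Matrix n n ℂ) (k : Fin m) (i : ι) :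
    spectralDet (linMat E) k * pderiv (Sum.inr i) (pderiv (Sum.inr i) (spectralDet (linMat E) k)) =
      ((spectralMat (linMat E) k).adjugate * (E i).map C).trace *
        ((spectralMat (linMat E) k).adjugate * (E i).map C).trace -
      ((spectralMat (linMat E) k).adjugate * (E i).map C *
        (spectralMat (linMat E) k).adjugate * (E i).map C).trace := by
  classical
  rw [spectralDet, det_mul_derivation_derivation_det, spectralMat_linMat_map_pderiv_inr]
  have : (-(E i).map C : Matrix n n (MvPolynomial (Fin m ⊕ ι) ℂ)).map (pderiv (Sum.inr i)) = 0 := by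
    refine Matrix.ext fun a b => ?_
    simp
  simp [this, sq]

variable {E : ι → Matrix n n ℂ}

/-- For symmetric `S'` the twisted traces cancel and the Laplacian is minus the second spectral
derivative. For antisymmetric `S'` they double, which adds a first order term. -/
theorem laplacian_spectralDet_linMat (S S' : Matrix n n ℂ)
    (hE : ∀ a b c d, ∑ i, E i a b * E i c d = (if a = d ∧ b = c then 1 else 0) - S a c * S' d b)
    (k : Fin m) :
    spectralDet (linMat E) k *
        ∑ i, pderiv (Sum.inr i) (pderiv (Sum.inr i) (spectralDet (linMat E) k)) =
      -(spectralDet (linMat E) k *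
        pderiv (Sum.inl k) (pderiv (Sum.inl k) (spectralDet (linMat E) k))) -
      ((spectralMat (linMat E) k).adjugate *
        (S.map C * (spectralMat (linMat E) k).adjugateᵀ * S'.map C)).trace +
      ((spectralMat (linMat E) k).adjugate *
        (S.map C * (spectralMat (linMat E) k).adjugateᵀ * (S'.map C)ᵀ)).trace := by
  have h : ∀ a b c d, ∑ i, ((E i).map C : Matrix n n (MvPolynomial (Fin m ⊕ ι) ℂ)) a b *
      ((E i).map C : Matrix n n (MvPolynomial (Fin m ⊕ ι) ℂ)) c d =
      (if a = d ∧ b = c then 1 else 0) - (S.map C) a c * (S'.map C) d b := fun a b c d => by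
    rw [sum_map_C_mul_map_C (hE a b c d)]
    split_ifs <;> simp
  rw [Finset.mul_sum, Finset.sum_congr rfl fun i _ => spectralDet_mul_pderiv_pderiv_inr E k i,
    Finset.sum_sub_distrib, sum_trace_mul_trace_of_twisted _ _ _ _ _ h,
    sum_trace_mul_mul_mul_of_twisted _ _ _ _ _ h, spectralDet_mul_pderiv_pderiv]
  ring

theorem gradient_spectralDet_linMat (S S' : Matrix n n ℂ)
    (hE : ∀ a b c d, ∑ i, E i a b * E i c d = (if a = d ∧ b = c then 1 else 0) - S a c * S' d b)
    (k l : Fin m) :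
    ∑ i, pderiv (Sum.inr i) (spectralDet (linMat E) k) *
        pderiv (Sum.inr i) (spectralDet (linMat E) l) =
      ((spectralMat (linMat E) k).adjugate * (spectralMat (linMat E) l).adjugate).trace -
      ((spectralMat (linMat E) k).adjugate *
        (S.map C * (spectralMat (linMat E) l).adjugateᵀ * S'.map C)).trace := by
  have h : ∀ a b c d, ∑ i, ((E i).map C : Matrix n n (MvPolynomial (Fin m ⊕ ι) ℂ)) a b *
      ((E i).map C : Matrix n n (MvPolynomial (Fin m ⊕ ι) ℂ)) c d =
      (if a = d ∧ b = c then 1 else 0) - (S.map C) a c * (S'.map C) d b := fun a b c d => by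
    rw [sum_map_C_mul_map_C (hE a b c d)]
    split_ifs <;> simp
  simp only [pderiv_inr_spectralDet_linMat, neg_mul_neg]
  rw [sum_trace_mul_trace_of_twisted _ _ _ _ _ h]

theorem sub_mul_trace_adjugate_spectralMat {ι : Type*} (H : Matrix n n (MvPolynomial ι ℂ)) (k l : Fin m) :
    (X (Sum.inl l) - X (Sum.inl k)) *
      ((spectralMat H k).adjugate * (spectralMat H l).adjugate).trace =
      pderiv (Sum.inl k) (spectralDet H k) * spectralDet H l -
        spectralDet H k * pderiv (Sum.inl l) (spectralDet H l) := by
  rw [pderiv_inl_spectralDet, pderiv_inl_spectralDet]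
  exact sub_mul_trace_adjugate_mul_adjugate

theorem add_mul_trace_adjugate_spectralMat (S S' : Matrix n n ℂ) (hS : S' * S = 1)
    (hE : ∀ i, S * (E i)ᵀ * S' = -E i) (k l : Fin m) :
    (X (Sum.inl k) + X (Sum.inl l)) * ((spectralMat (linMat E) k).adjugate *
        (S.map C * (spectralMat (linMat E) l).adjugateᵀ * S'.map C)).trace =
      pderiv (Sum.inl k) (spectralDet (linMat E) k) * spectralDet (linMat E) l +
        spectralDet (linMat E) k * pderiv (Sum.inl l) (spectralDet (linMat E) l) := by
  rw [pderiv_inl_spectralDet, pderiv_inl_spectralDet]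
  refine add_mul_trace_adjugate_mul_twisted ?_ ?_
  · rw [← Matrix.map_mul, hS]
    exact Matrix.map_one _ C_0 C_1
  · rw [linMat_map_rename, Matrix.transpose_sum, Matrix.mul_sum, Matrix.sum_mul,
      ← Finset.sum_neg_distrib]
    refine Finset.sum_congr rfl fun i _ => ?_
    rw [Matrix.transpose_smul, mul_smul_comm, smul_mul_assoc, ← smul_neg, ← Matrix.transpose_map,
      ← Matrix.map_mul, ← Matrix.map_mul, hE]
    congr 1
    refine Matrix.ext fun a b => ?_
    simp

end LinearModel

/-! ### Averages of products of characteristic polynomials as formal expectations. -/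

section Averages

open MvPolynomial

variable {m : ℕ} {ι : Type} {n : Type} [Fintype n] [DecidableEq n]

theorem charProd_map_eval (H : Matrix n n (MvPolynomial ι ℂ)) (α : Fin m → ℂ) (g : ι → ℂ) :
    charProd α (H.map (eval g)) = eval (Sum.elim α g) (∏ k, spectralDet H k) := by
  rw [map_prod, charProd]
  exact Finset.prod_congr rfl fun k _ => (eval_spectralDet H α g k).symm

variable [Fintype ι]

theorem integrable_charProd (σ : ℝ) {F : (ι → ℝ) → Matrix n n ℂ} (H : Matrix n n (MvPolynomial ι ℂ))
    (hF : ∀ g, F g = H.map (eval fun i => (g i : ℂ))) (α : Fin m → ℂ) :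
    Integrable (fun g => charProd α (F g)) (iidGaussian ι σ) := by
  simp only [hF, charProd_map_eval]
  exact integrable_eval_iidGaussian σ α _

theorem integral_charProd (σ : ℝ) {F : (ι → ℝ) → Matrix n n ℂ} (H : Matrix n n (MvPolynomial ι ℂ))
    (hF : ∀ g, F g = H.map (eval fun i => (g i : ℂ))) (α : Fin m → ℂ) :
    ∫ g, charProd α (F g) ∂(iidGaussian ι σ) =
      eval α (partialExp (Fin m) (gaussianMoment σ) (∏ k, spectralDet H k)) := by
  simp only [hF, charProd_map_eval]
  exact (eval_partialExp_gaussianMoment σ α _).symm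

end Averages

/-! ### The determinant formula for the GUE and for classes C and D. -/

section LinearEnsembles

theorem spectralOp_X_pow_add_two (j : ℕ) : spectralOp 1 0 0 (Polynomial.X ^ (j + 2)) =
    Polynomial.C (((j : ℂ) + 2) * (j + 1)) * Polynomial.X ^ j := by
  have h2 : (Polynomial.C 2 : Polynomial ℂ) = 2 := map_ofNat Polynomial.C 2
  simp [spectralOp, h2]
  ring

theorem spectralOp_X_pow_succ (a b : ℂ) (j : ℕ) : spectralOp 0 a b (Polynomial.X ^ (j + 1)) =
    Polynomial.C ((j + 1) * (a * j + b)) * Polynomial.X ^ j := by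
  rcases j with _ | j
  · simp [spectralOp]
  · simp [spectralOp]
    ring

theorem spectralOp_X_pow_one_mul (i : ℕ) : spectralOp 1 0 0 (Polynomial.X ^ (1 * i)) = 0 ∨
    ∃ μ : ℂ, ∃ j < i, spectralOp 1 0 0 (Polynomial.X ^ (1 * i)) =
      Polynomial.C μ * Polynomial.X ^ (1 * j) := by
  rcases i with _ | _ | j
  · simp [spectralOp]
  · simp [spectralOp]
  · refine Or.inr ⟨((j : ℂ) + 2) * (j + 1), j, by omega, ?_⟩
    rw [one_mul, one_mul, spectralOp_X_pow_add_two]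

theorem spectralOp_X_pow_two_mul (i : ℕ) : spectralOp 1 0 0 (Polynomial.X ^ (2 * i)) = 0 ∨
    ∃ μ : ℂ, ∃ j < i, spectralOp 1 0 0 (Polynomial.X ^ (2 * i)) =
      Polynomial.C μ * Polynomial.X ^ (2 * j) := by
  rcases i with _ | j
  · simp [spectralOp]
  · refine Or.inr ⟨((2 * j : ℕ) + 2) * ((2 * j : ℕ) + 1), j, by omega, ?_⟩
    rw [mul_add, mul_one, spectralOp_X_pow_add_two]

open MvPolynomial

theorem C_two {σ : Type*} : (C 2 : MvPolynomial σ ℂ) = 2 := map_ofNat C 2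

variable {m : ℕ} {ι : Type*} [Fintype ι] {n : Type*} [Fintype n] [DecidableEq n]
  {mom : ℕ → ℂ} {v : ℂ} {E : ι → Matrix n n ℂ}

theorem diffProd_mul_partialExp_spectralDet_of_unitary
    (hmom₀ : mom 0 = 1) (hmom : ∀ k, mom (k + 1) = v * (k * mom (k - 1)))
    (hE : ∀ a b c d, ∑ i, E i a b * E i c d = if a = d ∧ b = c then 1 else 0)
    (r : ℕ → Polynomial ℂ)
    (hr_deg : ∀ i, (r i - Polynomial.X ^ (Fintype.card n + i)).degree <
      ((Fintype.card n + i : ℕ) : WithBot ℕ))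
    (hr : ∀ i, Polynomial.X * Polynomial.derivative (r i) -
      Polynomial.C v * Polynomial.derivative (Polynomial.derivative (r i)) =
      Polynomial.C ((Fintype.card n + i : ℕ) : ℂ) * r i) :
    diffProd (fun k => (X k : MvPolynomial (Fin m) ℂ)) *
      partialExp (Fin m) mom (∏ k, spectralDet (linMat E) k) =
      (Matrix.of fun i k : Fin m =>
        Polynomial.aeval (X k : MvPolynomial (Fin m) ℂ) (r i)).det := by
  have hE' : ∀ a b c d, ∑ i, E i a b * E i c d = (if a = d ∧ b = c then 1 else 0) -
      (0 : Matrix n n ℂ) a c * (0 : Matrix n n ℂ) d b := fun a b c d => by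
    rw [hE]
    simp
  have h := diffProd_mul_partialExp_prod (m := m) (ι := ι) hmom₀ hmom (ρ := 1)
    (e := Fintype.card n) (w := 1)
    one_pos one_pos 1 0 0 (fun k => spectralDet (linMat E) k)
    (fun k l hkl => pderiv_inl_spectralDet_of_ne _ hkl)
    (fun k => by
      refine mul_left_cancel₀ (spectralDet_ne_zero (linMat E) k) ?_
      rw [laplacian_spectralDet_linMat 0 0 hE', secondOrder_apply]
      simp)
    (fun k l hkl => by
      rw [gradient_spectralDet_linMat 0 0 hE', mul_sub, pow_one, pow_one,
        sub_mul_trace_adjugate_spectralMat]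
      simp)
    (fun k => by
      have := euler_spectralDet_linMat (m := m) E k
      simpa using this)
    (fun k => degLT_spectralDet_sub _ k)
    spectralOp_X_pow_one_mul
    r (by simpa using hr_deg) (fun i => by simpa [spectralOp] using hr i)
  simpa using h

/-- The gradient product has one part with denominator x_l - x_k and one with x_l + x_k. Multiplying
by x_l² - x_k² clears both, which is why squares enter the Vandermonde product. -/
theorem diffProd_mul_partialExp_spectralDet_of_orthogonal
    (hmom₀ : mom 0 = 1) (hmom : ∀ k, mom (k + 1) = v * (k * mom (k - 1)))
    (S S' : Matrix n n ℂ) (hS : S' * S = 1) (hS' : S'ᵀ = S')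
    (hE : ∀ a b c d, ∑ i, E i a b * E i c d = (if a = d ∧ b = c then 1 else 0) - S a c * S' d b)
    (hSE : ∀ i, S * (E i)ᵀ * S' = -E i)
    (r : ℕ → Polynomial ℂ)
    (hr_deg : ∀ i, (r i - Polynomial.X ^ (Fintype.card n + 2 * i)).degree <
      ((Fintype.card n + 2 * i : ℕ) : WithBot ℕ))
    (hr : ∀ i, Polynomial.X * Polynomial.derivative (r i) -
      Polynomial.C v * Polynomial.derivative (Polynomial.derivative (r i)) =
      Polynomial.C ((Fintype.card n + 2 * i : ℕ) : ℂ) * r i) :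
    diffProd (fun k => (X k : MvPolynomial (Fin m) ℂ) ^ 2) *
      partialExp (Fin m) mom (∏ k, spectralDet (linMat E) k) =
      (Matrix.of fun i k : Fin m =>
        Polynomial.aeval (X k : MvPolynomial (Fin m) ℂ) (r i)).det := by
  have h := diffProd_mul_partialExp_prod (m := m) (ι := ι) hmom₀ hmom (ρ := 2)
    (e := Fintype.card n) (w := 1)
    two_pos one_pos 1 0 0 (fun k => spectralDet (linMat E) k)
    (fun k l hkl => pderiv_inl_spectralDet_of_ne _ hkl)
    (fun k => by
      refine mul_left_cancel₀ (spectralDet_ne_zero (linMat E) k) ?_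
      rw [laplacian_spectralDet_linMat S S' hE, secondOrder_apply, ← Matrix.transpose_map, hS']
      simp)
    (fun k l hkl => by
      rw [gradient_spectralDet_linMat S S' hE]
      have h1 := sub_mul_trace_adjugate_spectralMat (m := m) (linMat E) k l
      have h2 := add_mul_trace_adjugate_spectralMat (m := m) S S' hS hSE k l
      simp [C_two]
      linear_combination (X (Sum.inl l) + X (Sum.inl k)) * h1 -
        (X (Sum.inl l) - X (Sum.inl k)) * h2)
    (fun k => by
      have := euler_spectralDet_linMat (m := m) E k
      simpa using this)
    (fun k => degLT_spectralDet_sub _ k)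
    spectralOp_X_pow_two_mul
    r (by simpa using hr_deg) (fun i => by simpa [spectralOp] using hr i)
  simpa using h

/-- For antisymmetric `S'` one finds Δ D = -D'' - (2/x) D', and x (D'' + (2/x) D') = (x D)''.
Multiplying each characteristic polynomial by its spectral variable thus restores the duality with
the plain second derivative, and raises the degree by one. -/
theorem diffProd_mul_partialExp_spectralDet_of_symplectic
    (hmom₀ : mom 0 = 1) (hmom : ∀ k, mom (k + 1) = v * (k * mom (k - 1)))
    (S S' : Matrix n n ℂ) (hS : S' * S = 1) (hS' : S'ᵀ = -S')
    (hE : ∀ a b c d, ∑ i, E i a b * E i c d = (if a = d ∧ b = c then 1 else 0) - S a c * S' d b)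
    (hSE : ∀ i, S * (E i)ᵀ * S' = -E i)
    (r : ℕ → Polynomial ℂ)
    (hr_deg : ∀ i, (r i - Polynomial.X ^ (Fintype.card n + 1 + 2 * i)).degree <
      ((Fintype.card n + 1 + 2 * i : ℕ) : WithBot ℕ))
    (hr : ∀ i, Polynomial.X * Polynomial.derivative (r i) -
      Polynomial.C v * Polynomial.derivative (Polynomial.derivative (r i)) =
      Polynomial.C ((Fintype.card n + 1 + 2 * i : ℕ) : ℂ) * r i) :
    diffProd (fun k => (X k : MvPolynomial (Fin m) ℂ) ^ 2) *
      ((∏ k, X k) * partialExp (Fin m) mom (∏ k, spectralDet (linMat E) k)) =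
      (Matrix.of fun i k : Fin m =>
        Polynomial.aeval (X k : MvPolynomial (Fin m) ℂ) (r i)).det := by
  have hd2 : ∀ k : Fin m, pderiv (Sum.inl k)
      ((X (Sum.inl k) : MvPolynomial (Fin m ⊕ ι) ℂ) * spectralDet (linMat E) k) =
      spectralDet (linMat E) k +
        X (Sum.inl k) * pderiv (Sum.inl k) (spectralDet (linMat E) k) := fun k => by
    rw [Derivation.leibniz, pderiv_X_self, smul_eq_mul, smul_eq_mul, mul_one, add_comm]
  have hd3 : ∀ k : Fin m, ∀ i, pderiv (Sum.inr i)
      ((X (Sum.inl k) : MvPolynomial (Fin m ⊕ ι) ℂ) * spectralDet (linMat E) k) =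
        X (Sum.inl k) * pderiv (Sum.inr i) (spectralDet (linMat E) k) := fun k i => by
    rw [Derivation.leibniz, pderiv_X_of_ne (by simp), smul_eq_mul, smul_eq_mul, mul_zero, add_zero]
  have h := diffProd_mul_partialExp_prod (m := m) (ι := ι) hmom₀ hmom (ρ := 2)
    (e := Fintype.card n + 1) (w := 1)
    two_pos one_pos 1 0 0 (fun k => X (Sum.inl k) * spectralDet (linMat E) k)
    (fun k l hkl => by
      rw [Derivation.leibniz, pderiv_inl_spectralDet_of_ne _ hkl,
        pderiv_X_of_ne fun h => hkl (Sum.inl_injective h)]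
      simp)
    (fun k => by
      refine mul_left_cancel₀ (spectralDet_ne_zero (linMat E) k) ?_
      have h1 := laplacian_spectralDet_linMat (m := m) S S' hE k
      rw [← Matrix.transpose_map, hS'] at h1
      have h2 := add_mul_trace_adjugate_spectralMat (m := m) S S' hS hSE k k
      have h4 : ((-S').map C : Matrix n n (MvPolynomial (Fin m ⊕ ι) ℂ)) = -S'.map C :=
        Matrix.ext fun a b => by simp
      rw [h4, mul_neg, mul_neg, Matrix.trace_neg] at h1
      have h5 : ∑ i, pderiv (Sum.inr i) (pderiv (Sum.inr i)
          ((X (Sum.inl k) : MvPolynomial (Fin m ⊕ ι) ℂ) * spectralDet (linMat E) k)) =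
          X (Sum.inl k) * ∑ i, pderiv (Sum.inr i) (pderiv (Sum.inr i)
            (spectralDet (linMat E) k)) := by
        rw [Finset.mul_sum]
        refine Finset.sum_congr rfl fun i _ => ?_
        rw [hd3, Derivation.leibniz, pderiv_X_of_ne (by simp), smul_eq_mul, smul_eq_mul, mul_zero,
          add_zero]
      rw [h5, secondOrder_apply, hd2, map_add, Derivation.leibniz (pderiv (Sum.inl k)),
        pderiv_X_self]
      simp only [C_0, C_1, zero_mul, add_zero, one_mul, smul_eq_mul, mul_one]
      linear_combination X (Sum.inl k) * h1 - h2)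
    (fun k l hkl => by
      have h0 := gradient_spectralDet_linMat (m := m) S S' hE k l
      have h1 := sub_mul_trace_adjugate_spectralMat (m := m) (linMat E) k l
      have h2 := add_mul_trace_adjugate_spectralMat (m := m) S S' hS hSE k l
      have h5 : ∑ i, pderiv (Sum.inr i)
          ((X (Sum.inl k) : MvPolynomial (Fin m ⊕ ι) ℂ) * spectralDet (linMat E) k) *
          pderiv (Sum.inr i)
          ((X (Sum.inl l) : MvPolynomial (Fin m ⊕ ι) ℂ) * spectralDet (linMat E) l) =
          X (Sum.inl k) * X (Sum.inl l) * ∑ i, pderiv (Sum.inr i) (spectralDet (linMat E) k) *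
          pderiv (Sum.inr i) (spectralDet (linMat E) l) := by
        rw [Finset.mul_sum]
        refine Finset.sum_congr rfl fun i _ => ?_
        rw [hd3, hd3]
        ring
      rw [h5, h0, hd2, hd2]
      simp [C_two]
      linear_combination X (Sum.inl k) * X (Sum.inl l) * (X (Sum.inl l) + X (Sum.inl k)) * h1 -
        X (Sum.inl k) * X (Sum.inl l) * (X (Sum.inl l) - X (Sum.inl k)) * h2)
    (fun k => by
      have h1 := euler_spectralDet_linMat (m := m) E k
      have h5 : ∑ i, X (Sum.inr i) * pderiv (Sum.inr i)
          ((X (Sum.inl k) : MvPolynomial (Fin m ⊕ ι) ℂ) * spectralDet (linMat E) k) =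
          X (Sum.inl k) * ∑ i, X (Sum.inr i) * pderiv (Sum.inr i) (spectralDet (linMat E) k) := by
        rw [Finset.mul_sum]
        refine Finset.sum_congr rfl fun i _ => ?_
        rw [hd3]
        ring
      rw [h5, hd2]
      simp
      linear_combination X (Sum.inl k) * h1)
    (fun k => by
      have h1 := (DegLT.X (w := Sum.elim (1 : Fin m → ℕ) (0 : ι → ℕ)) (n := 1) (Sum.inl k)
        le_rfl).mul (p := 1) (degLT_spectralDet_sub (linMat E) k)
      rw [pow_succ', ← mul_sub]
      exact h1.mono (by omega))
    spectralOp_X_pow_two_mul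
    r (by simpa using hr_deg) (fun i => by simpa [spectralOp] using hr i)
  rw [← h, Finset.prod_mul_distrib, ← partialExp_rename_inl_mul, map_prod]
  simp

end LinearEnsembles

/-! ### Covariance tensors of the concrete ensembles. -/

section EnsembleTensors

variable {p q N : ℕ}

theorem sum_smul_single {ι : Type*} [Fintype ι] [DecidableEq ι] {n n' : Type*}
    (F : (ι → ℝ) →ₗ[ℝ] Matrix n n' ℂ) (g : ι → ℝ) :
    F g = ∑ i, (g i : ℂ) • F (Pi.single i 1) := by
  conv_lhs => rw [← Finset.univ_sum_single g, map_sum]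
  refine Finset.sum_congr rfl fun i _ => ?_
  have : (Pi.single i (g i) : ι → ℝ) = g i • Pi.single i 1 := by
    rw [← Pi.single_smul, smul_eq_mul, mul_one]
  rw [this, map_smul]
  refine Matrix.ext fun a b => ?_
  simp

theorem cplxMatrix_eq_sum (g : EntryIdx p q → ℝ) :
    cplxMatrix g = ∑ i, (g i : ℂ) • cplxMatrix (Pi.single i 1) :=
  sum_smul_single (F := 
    { toFun := cplxMatrix
      map_add' := fun x y => Matrix.ext fun a b => by simp [cplxMatrix]; ring
      map_smul' := fun c x => Matrix.ext fun a b => by simp [cplxMatrix]; ring }) g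

theorem hermitianMatrix_eq_sum (g : EntryIdx N N → ℝ) :
    hermitianMatrix g = ∑ i, (g i : ℂ) • hermitianMatrix (Pi.single i 1) :=
  sum_smul_single (F := 
    { toFun := hermitianMatrix
      map_add' := fun x y => Matrix.ext fun a b => by simp [hermitianMatrix, cplxMatrix]; ring
      map_smul' := fun c x => Matrix.ext fun a b => by
        simp [hermitianMatrix, cplxMatrix]; ring }) g

theorem classCMatrix_eq_sum (g : EntryIdx N N ⊕ EntryIdx N N → ℝ) :
    classCMatrix g = ∑ i, (g i : ℂ) • classCMatrix (Pi.single i 1) :=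
  sum_smul_single (F := 
    { toFun := classCMatrix
      map_add' := fun x y => Matrix.ext fun a b => by
        rcases a with a | a <;> rcases b with b | b <;>
          simp [classCMatrix, hermitianMatrix, symmetricMatrix, cplxMatrix] <;> ring
      map_smul' := fun c x => Matrix.ext fun a b => by
        rcases a with a | a <;> rcases b with b | b <;>
          simp [classCMatrix, hermitianMatrix, symmetricMatrix, cplxMatrix] <;> ring }) g

theorem classDMatrix_eq_sum (g : Fin (2 * N) × Fin (2 * N) → ℝ) :
    classDMatrix g = ∑ i, (g i : ℂ) • classDMatrix (Pi.single i 1) :=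
  sum_smul_single (F := 
    { toFun := classDMatrix
      map_add' := fun x y => Matrix.ext fun a b => by simp [classDMatrix]; ring
      map_smul' := fun c x => Matrix.ext fun a b => by simp [classDMatrix]; ring }) g

theorem cplxMatrix_single_inl (i : Fin p × Fin q) (a : Fin p) (b : Fin q) :
    cplxMatrix (Pi.single (Sum.inl i) 1) a b = if i = (a, b) then 1 else 0 := by
  by_cases h : i = (a, b) <;> simp [cplxMatrix, Pi.single_apply, h, eq_comm]

theorem cplxMatrix_single_inr (i : Fin p × Fin q) (a : Fin p) (b : Fin q) :
    cplxMatrix (Pi.single (Sum.inr i) 1) a b = if i = (a, b) then Complex.I else 0 := by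
  by_cases h : i = (a, b) <;> simp [cplxMatrix, Pi.single_apply, h, eq_comm]

/-- The real and imaginary coordinates contribute 1 and I² = -1. Conjugating one factor changes the
latter to 1, which is the source of the 2 in the mixed sums below. -/
theorem sum_cplxMatrix_mul_cplxMatrix (a : Fin p) (b : Fin q) (c : Fin p) (d : Fin q) :
    ∑ i, cplxMatrix (Pi.single i 1) a b * cplxMatrix (Pi.single i 1) c d = 0 := by
  rw [Fintype.sum_sum_type]
  simp only [cplxMatrix_single_inl, cplxMatrix_single_inr]
  simp [ite_and]
  split_ifs <;> simp

theorem sum_cplxMatrix_mul_star_cplxMatrix (a : Fin p) (b : Fin q) (c : Fin p) (d : Fin q) :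
    ∑ i, cplxMatrix (Pi.single i 1) a b * star (cplxMatrix (Pi.single i 1) c d) =
      if a = c ∧ b = d then 2 else 0 := by
  rw [Fintype.sum_sum_type]
  simp only [cplxMatrix_single_inl, cplxMatrix_single_inr]
  simp
  by_cases h : a = c ∧ b = d
  · simp [h]; norm_num
  · rw [if_neg h, if_neg (by tauto), if_neg (by tauto)]; simp

theorem sum_star_cplxMatrix_mul_cplxMatrix (a : Fin p) (b : Fin q) (c : Fin p) (d : Fin q) :
    ∑ i, star (cplxMatrix (Pi.single i 1) a b) * cplxMatrix (Pi.single i 1) c d =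
      if a = c ∧ b = d then 2 else 0 := by
  simp only [mul_comm (star _)]
  rw [sum_cplxMatrix_mul_star_cplxMatrix]
  simp only [eq_comm]

theorem sum_star_cplxMatrix_mul_star_cplxMatrix (a : Fin p) (b : Fin q) (c : Fin p) (d : Fin q) :
    ∑ i, star (cplxMatrix (Pi.single i 1) a b) * star (cplxMatrix (Pi.single i 1) c d) = 0 := by
  simp only [← star_mul', ← star_sum, sum_cplxMatrix_mul_cplxMatrix, star_zero]

theorem sum_hermitianMatrix_mul_hermitianMatrix (a b c d : Fin N) :
    ∑ i, hermitianMatrix (Pi.single i 1) a b * hermitianMatrix (Pi.single i 1) c d =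
      if a = d ∧ b = c then 1 else 0 := by
  have h : ∀ i : EntryIdx N N, hermitianMatrix (Pi.single i 1) a b *
      hermitianMatrix (Pi.single i 1) c d = 1 / 4 *
      (cplxMatrix (Pi.single i 1) a b * cplxMatrix (Pi.single i 1) c d +
      cplxMatrix (Pi.single i 1) a b * star (cplxMatrix (Pi.single i 1) d c) +
      star (cplxMatrix (Pi.single i 1) b a) * cplxMatrix (Pi.single i 1) c d +
      star (cplxMatrix (Pi.single i 1) b a) * star (cplxMatrix (Pi.single i 1) d c)) := fun i => by
    simp only [hermitianMatrix, Matrix.smul_apply, Matrix.add_apply, Matrix.conjTranspose_apply,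
      smul_eq_mul]
    ring
  simp only [h, ← Finset.mul_sum, Finset.sum_add_distrib, sum_cplxMatrix_mul_cplxMatrix,
    sum_cplxMatrix_mul_star_cplxMatrix, sum_star_cplxMatrix_mul_cplxMatrix,
    sum_star_cplxMatrix_mul_star_cplxMatrix]
  by_cases h1 : a = d <;> by_cases h2 : b = c <;> norm_num [h1, h2]

theorem sum_symmetricMatrix_mul_symmetricMatrix (a b c d : Fin N) :
    ∑ i, symmetricMatrix (Pi.single i 1) a b * symmetricMatrix (Pi.single i 1) c d = 0 := by
  have h : ∀ i : EntryIdx N N, symmetricMatrix (Pi.single i 1) a b *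
      symmetricMatrix (Pi.single i 1) c d = 1 / 4 *
      (cplxMatrix (Pi.single i 1) a b * cplxMatrix (Pi.single i 1) c d +
      cplxMatrix (Pi.single i 1) a b * cplxMatrix (Pi.single i 1) d c +
      cplxMatrix (Pi.single i 1) b a * cplxMatrix (Pi.single i 1) c d +
      cplxMatrix (Pi.single i 1) b a * cplxMatrix (Pi.single i 1) d c) := fun i => by
    simp only [symmetricMatrix, Matrix.smul_apply, Matrix.add_apply, Matrix.transpose_apply,
      smul_eq_mul]
    ring
  simp only [h, ← Finset.mul_sum, Finset.sum_add_distrib, sum_cplxMatrix_mul_cplxMatrix]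
  norm_num

theorem sum_symmetricMatrix_mul_star_symmetricMatrix (a b c d : Fin N) :
    ∑ i, symmetricMatrix (Pi.single i 1) a b * star (symmetricMatrix (Pi.single i 1) c d) =
      (if a = c ∧ b = d then 1 else 0) + (if a = d ∧ b = c then 1 else 0) := by
  have h : ∀ i : EntryIdx N N, symmetricMatrix (Pi.single i 1) a b *
      star (symmetricMatrix (Pi.single i 1) c d) = 1 / 4 *
      (cplxMatrix (Pi.single i 1) a b * star (cplxMatrix (Pi.single i 1) c d) +
      cplxMatrix (Pi.single i 1) a b * star (cplxMatrix (Pi.single i 1) d c) +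
      cplxMatrix (Pi.single i 1) b a * star (cplxMatrix (Pi.single i 1) c d) +
      cplxMatrix (Pi.single i 1) b a * star (cplxMatrix (Pi.single i 1) d c)) := fun i => by
    simp only [symmetricMatrix, Matrix.smul_apply, Matrix.add_apply, Matrix.transpose_apply,
      smul_eq_mul, star_mul', star_add]
    simp
    ring
  simp only [h, ← Finset.mul_sum, Finset.sum_add_distrib, sum_cplxMatrix_mul_star_cplxMatrix]
  rw [ite_congr (propext and_comm : (b = c ∧ a = d) = (a = d ∧ b = c)) (fun _ => rfl) fun _ => rfl,
    ite_congr (propext and_comm : (b = d ∧ a = c) = (a = c ∧ b = d)) (fun _ => rfl) fun _ => rfl]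
  split_ifs <;> norm_num

theorem hermitianMatrix_zero : hermitianMatrix (0 : EntryIdx N N → ℝ) = 0 := by
  refine Matrix.ext fun a b => ?_
  simp [hermitianMatrix, cplxMatrix]

theorem symmetricMatrix_zero : symmetricMatrix (0 : EntryIdx N N → ℝ) = 0 := by
  refine Matrix.ext fun a b => ?_
  simp [symmetricMatrix, cplxMatrix]

theorem classCMatrix_single_inl (i : EntryIdx N N) : classCMatrix (Pi.single (Sum.inl i) 1) =
    Matrix.fromBlocks (hermitianMatrix (Pi.single i 1)) 0 0 (-(hermitianMatrix (Pi.single i 1))ᵀ) := by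
  have h1 : (fun j : EntryIdx N N => (Pi.single (Sum.inl i) 1 : EntryIdx N N ⊕ EntryIdx N N → ℝ)
      (Sum.inl j)) = Pi.single i 1 := by
    funext j
    simp [Pi.single_apply]
  have h2 : (fun j : EntryIdx N N => (Pi.single (Sum.inl i) 1 : EntryIdx N N ⊕ EntryIdx N N → ℝ)
      (Sum.inr j)) = 0 := by
    funext j
    simp
  rw [classCMatrix, h1, h2, symmetricMatrix_zero, Matrix.conjTranspose_zero]

theorem classCMatrix_single_inr (i : EntryIdx N N) : classCMatrix (Pi.single (Sum.inr i) 1) =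
    Matrix.fromBlocks 0 (symmetricMatrix (Pi.single i 1)) (symmetricMatrix (Pi.single i 1))ᴴ 0 := by
  have h1 : (fun j : EntryIdx N N => (Pi.single (Sum.inr i) 1 : EntryIdx N N ⊕ EntryIdx N N → ℝ)
      (Sum.inr j)) = Pi.single i 1 := by
    funext j
    simp [Pi.single_apply]
  have h2 : (fun j : EntryIdx N N => (Pi.single (Sum.inr i) 1 : EntryIdx N N ⊕ EntryIdx N N → ℝ)
      (Sum.inl j)) = 0 := by
    funext j
    simp
  rw [classCMatrix, h1, h2, hermitianMatrix_zero, Matrix.transpose_zero, neg_zero]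

/-- The twist is by the symplectic form, with the antisymmetric `S' = -J`; for class D below it is
by the identity, which is symmetric. -/
theorem sum_classCMatrix_mul_classCMatrix (a b c d : Fin N ⊕ Fin N) :
    ∑ i, classCMatrix (Pi.single i 1) a b * classCMatrix (Pi.single i 1) c d =
      (if a = d ∧ b = c then 1 else 0) - Matrix.J (Fin N) ℂ a c * (-Matrix.J (Fin N) ℂ) d b := by
  have h1 : ∀ a b c d, ∑ i : EntryIdx N N, symmetricMatrix (Pi.single i 1) a b *
      (starRingEnd ℂ) (symmetricMatrix (Pi.single i 1) c d) =
      (if a = c ∧ b = d then 1 else 0) + (if a = d ∧ b = c then 1 else 0) :=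
    sum_symmetricMatrix_mul_star_symmetricMatrix
  have h2 : ∀ a b c d, ∑ i : EntryIdx N N, (starRingEnd ℂ) (symmetricMatrix (Pi.single i 1) c d) *
      symmetricMatrix (Pi.single i 1) a b =
      (if a = c ∧ b = d then 1 else 0) + (if a = d ∧ b = c then 1 else 0) := fun a b c d => by
    simp only [mul_comm ((starRingEnd ℂ) _), h1]
  have h3 : ∀ a b c d, ∑ i : EntryIdx N N, (starRingEnd ℂ) (symmetricMatrix (Pi.single i 1) a b) *
      (starRingEnd ℂ) (symmetricMatrix (Pi.single i 1) c d) = 0 := fun a b c d => by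
    simp only [← map_mul, ← map_sum, sum_symmetricMatrix_mul_symmetricMatrix, map_zero]
  rw [Fintype.sum_sum_type]
  simp only [classCMatrix_single_inl, classCMatrix_single_inr]
  rcases a with a | a <;> rcases b with b | b <;> rcases c with c | c <;> rcases d with d | d <;>
    simp [-Fintype.sum_sum_type, Matrix.J, sum_hermitianMatrix_mul_hermitianMatrix, Matrix.one_apply,
      sum_symmetricMatrix_mul_symmetricMatrix, h1, h2, h3]
  all_goals grind

theorem sum_classDMatrix_mul_classDMatrix (a b c d : Fin (2 * N)) :
    ∑ i, classDMatrix (Pi.single i 1) a b * classDMatrix (Pi.single i 1) c d =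
      (if a = d ∧ b = c then 1 else 0) - (1 : Matrix (Fin (2 * N)) (Fin (2 * N)) ℂ) a c *
        (1 : Matrix (Fin (2 * N)) (Fin (2 * N)) ℂ) d b := by
  have h : ∀ i : Fin (2 * N) × Fin (2 * N), ∀ a b,
      classDMatrix (Pi.single i 1) a b = Complex.I / (√2 : ℝ) *
        ((if (a, b) = i then 1 else 0) - (if (b, a) = i then 1 else 0)) := fun i a b => by
    simp only [classDMatrix, Matrix.of_apply, Pi.single_apply]
    split_ifs <;> push_cast <;> ring
  have h2 : Complex.I / (√2 : ℝ) * (Complex.I / (√2 : ℝ)) = -(1 / 2) := by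
    have : ((√2 : ℝ) : ℂ) * ((√2 : ℝ) : ℂ) = 2 := by
      rw [← Complex.ofReal_mul, Real.mul_self_sqrt (by norm_num)]
      norm_num
    rw [div_mul_div_comm, this, Complex.I_mul_I]
    norm_num
  have h3 : ∀ i : Fin (2 * N) × Fin (2 * N),
      classDMatrix (Pi.single i 1) a b * classDMatrix (Pi.single i 1) c d = -(1 / 2) *
        (((if (a, b) = i then 1 else 0) - (if (b, a) = i then 1 else 0)) *
          ((if (c, d) = i then 1 else 0) - (if (d, c) = i then 1 else 0))) := fun i => by
    rw [h, h, ← h2]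
    ring
  simp only [h3, ← Finset.mul_sum, sub_mul, mul_sub, Finset.sum_sub_distrib, ite_mul, one_mul,
    zero_mul, Finset.sum_ite_eq, Finset.mem_univ, if_true, Prod.mk.injEq, Matrix.one_apply]
  grind

end EnsembleTensors

/-! ### Contractions for products of a matrix and its adjoint. -/

section ChiralTraces

variable {A : Type*} [CommRing A] {ι : Type*} [Fintype ι] {p q : Type*} [Fintype p] [Fintype q]
  [DecidableEq p] [DecidableEq q] {t : A} {E : ι → Matrix p q A} {E' : ι → Matrix q p A}

/-- The matrix `U * E i + E' i * V` models a first derivative of M†M. Only contractions of `E` with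
`E'` survive, and each of them merges the two traces. -/
theorem sum_trace_mul_trace_of_chiral (hE : ∀ a b c d, ∑ i, E i a b * E i c d = 0)
    (hE' : ∀ a b c d, ∑ i, E' i a b * E' i c d = 0)
    (hEE' : ∀ a b c d, ∑ i, E i a b * E' i c d = if a = d ∧ b = c then t else 0)
    (P Q : Matrix q q A) (U : Matrix q p A) (V : Matrix p q A) :
    ∑ i, (P * (U * E i + E' i * V)).trace * (Q * (U * E i + E' i * V)).trace =
      t * ((P * (U * V) * Q).trace + (Q * (U * V) * P).trace) := by
  have h0 : ∀ (R : Matrix q q A) i, (R * (U * E i + E' i * V)).trace =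
      (R * U * E i).trace + (V * R * E' i).trace := fun R i => by
    rw [Matrix.mul_add, Matrix.trace_add, ← Matrix.mul_assoc, ← Matrix.mul_assoc, Matrix.trace_mul_comm (R * E' i) V,
      ← Matrix.mul_assoc]
  have h1 : ∑ i, (P * U * E i).trace * (Q * U * E i).trace = 0 := by
    rw [sum_trace_mul_trace]
    simp [hE]
  have h2 : ∑ i, (V * P * E' i).trace * (V * Q * E' i).trace = 0 := by
    rw [sum_trace_mul_trace]
    simp [hE']
  have h3 := sum_trace_mul_trace_of_unitary (P * U) (V * Q) E E' hEE'
  have h4 := sum_trace_mul_trace_of_unitary (Q * U) (V * P) E E' hEE'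
  simp only [h0]
  simp only [add_mul, mul_add, Finset.sum_add_distrib]
  rw [h1, h2, h3]
  simp only [mul_comm (V * P * E' _).trace]
  rw [h4]
  simp only [Matrix.mul_assoc]
  ring

theorem sum_trace_mul_mul_mul_of_chiral (hE : ∀ a b c d, ∑ i, E i a b * E i c d = 0)
    (hE' : ∀ a b c d, ∑ i, E' i a b * E' i c d = 0)
    (hEE' : ∀ a b c d, ∑ i, E i a b * E' i c d = if a = d ∧ b = c then t else 0)
    (P : Matrix q q A) (U : Matrix q p A) (V : Matrix p q A) :
    ∑ i, (P * (U * E i + E' i * V) * P * (U * E i + E' i * V)).trace =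
      2 * t * ((P * (U * V)).trace * P.trace) := by
  have h0 : ∀ i, (P * (U * E i + E' i * V) * P * (U * E i + E' i * V)).trace =
      (P * U * E i * (P * U) * E i).trace + (V * P * E' i * (V * P) * E' i).trace +
      2 * (V * P * U * E i * P * E' i).trace := fun i => by
    simp only [Matrix.mul_add, Matrix.add_mul, Matrix.trace_add]
    have h1 : (P * (E' i * V) * P * (U * E i)).trace = (V * P * U * E i * P * E' i).trace := by
      rw [← Matrix.mul_assoc P, Matrix.mul_assoc (P * E' i), Matrix.mul_assoc (P * E' i),
        Matrix.trace_mul_comm]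
      simp only [Matrix.mul_assoc]
    have h2 : (P * (U * E i) * P * (E' i * V)).trace = (V * P * U * E i * P * E' i).trace := by
      rw [← Matrix.mul_assoc _ (E' i), Matrix.trace_mul_comm]
      simp only [Matrix.mul_assoc]
    have h3 : (P * (E' i * V) * P * (E' i * V)).trace = (V * P * E' i * (V * P) * E' i).trace := by
      rw [← Matrix.mul_assoc _ (E' i) V, Matrix.trace_mul_comm]
      simp only [Matrix.mul_assoc]
    have h4 : (P * (U * E i) * P * (U * E i)).trace = (P * U * E i * (P * U) * E i).trace := by
      simp only [Matrix.mul_assoc]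
    rw [h1, h2, h3, h4]
    ring
  have h1 : ∑ i, (P * U * E i * (P * U) * E i).trace = 0 := by
    rw [sum_trace_mul_mul_mul]
    simp [hE]
  have h2 : ∑ i, (V * P * E' i * (V * P) * E' i).trace = 0 := by
    rw [sum_trace_mul_mul_mul]
    simp [hE']
  simp only [h0, Finset.sum_add_distrib, ← Finset.mul_sum]
  rw [h1, h2, sum_trace_mul_mul_mul_of_unitary _ _ E E' hEE', Matrix.mul_assoc V,
    Matrix.trace_mul_comm V, Matrix.mul_assoc P]
  ring

/-- Needed for the second derivative of M†M, which is constant; the number of rows enters the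
Laplacian through it. -/
theorem sum_mul_of_chiral {q : Type*} [DecidableEq q] {E : ι → Matrix p q A}
    {E' : ι → Matrix q p A} (hEE' : ∀ a b c d, ∑ i, E i a b * E' i c d = if a = d ∧ b = c then t else 0) :
    ∑ i, E' i * E i = (Fintype.card p * t) • 1 := by
  refine Matrix.ext fun c d => ?_
  simp only [Matrix.sum_apply, Matrix.mul_apply]
  rw [Finset.sum_comm]
  have : ∀ a, ∑ i, E' i c a * E i a d = if d = c then t else 0 := fun a => by
    simp only [mul_comm (E' _ c a), hEE', true_and]
  simp only [this, Finset.sum_const, Finset.card_univ, Matrix.smul_apply, Matrix.one_apply,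
    eq_comm (a := c)]
  split_ifs <;> simp

end ChiralTraces

/-! ### Laplacian, gradient and homogeneity of the chiral characteristic polynomial. -/

section ChiralModel

open MvPolynomial

theorem linMat_map_rename_map_pderiv {m : ℕ} {ι : Type*} [Fintype ι] [DecidableEq ι] {p q : Type*}
    (E : ι → Matrix p q ℂ) (i : ι) :
    ((linMat E).map (rename (Sum.inr : ι → Fin m ⊕ ι))).map (pderiv (Sum.inr i)) = (E i).map C := by
  refine Matrix.ext fun a b => ?_
  rw [linMat_map_rename]
  simp [Matrix.sum_apply, pderiv_X, Pi.single_apply]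

/-- The generic linear combination of the matrices `E i`, in the larger polynomial ring. -/
noncomputable abbrev linMatInr (m : ℕ) {ι : Type*} [Fintype ι] {p q : Type*}
    (E : ι → Matrix p q ℂ) : Matrix p q (MvPolynomial (Fin m ⊕ ι) ℂ) :=
  (linMat E).map (rename Sum.inr)

/-- The matrix of constants. -/
noncomputable abbrev matC (κ : Type*) {p q : Type*} (M : Matrix p q ℂ) :
    Matrix p q (MvPolynomial κ ℂ) :=
  M.map C

variable {m : ℕ} {ι : Type*} [Fintype ι] {p q : Type*} [Fintype p] [DecidableEq q]

theorem spectralMat_chiral (E : ι → Matrix p q ℂ) (E' : ι → Matrix q p ℂ) (k : Fin m) :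
    spectralMat (linMat E' * linMat E) k = (X (Sum.inl k) : MvPolynomial (Fin m ⊕ ι) ℂ) • 1 -
      linMatInr m E' * linMatInr m E := by
  rw [spectralMat, Matrix.map_mul]

theorem X_inl_smul_one_map_pderiv_inr {ι : Type*} (k : Fin m) (i : ι) :
    ((X (Sum.inl k) : MvPolynomial (Fin m ⊕ ι) ℂ) •
      (1 : Matrix q q (MvPolynomial (Fin m ⊕ ι) ℂ))).map (pderiv (Sum.inr i)) = 0 := by
  refine Matrix.ext fun a b => ?_
  by_cases h : a = b <;> simp [h, pderiv_X_of_ne]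

theorem spectralMat_chiral_map_pderiv [DecidableEq ι] (E : ι → Matrix p q ℂ)
    (E' : ι → Matrix q p ℂ) (k : Fin m) (i : ι) :
    (spectralMat (linMat E' * linMat E) k).map (pderiv (Sum.inr i)) =
      -(linMatInr m E' * matC (Fin m ⊕ ι) (E i) +
        matC (Fin m ⊕ ι) (E' i) * linMatInr m E) := by
  rw [spectralMat_chiral, Matrix.map_sub _ (map_sub _), X_inl_smul_one_map_pderiv_inr, Matrix.map_derivation_mul,
    linMat_map_rename_map_pderiv, linMat_map_rename_map_pderiv, zero_sub]

theorem spectralMat_chiral_map_pderiv_pderiv [DecidableEq ι] (E : ι → Matrix p q ℂ)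
    (E' : ι → Matrix q p ℂ) (k : Fin m) (i : ι) :
    ((spectralMat (linMat E' * linMat E) k).map (pderiv (Sum.inr i))).map (pderiv (Sum.inr i)) =
      -((2 : MvPolynomial (Fin m ⊕ ι) ℂ) • (matC (Fin m ⊕ ι) (E' i) * matC (Fin m ⊕ ι) (E i))) := by
  have h1 : (matC (Fin m ⊕ ι) (E i)).map (pderiv (Sum.inr i)) = 0 := by
    refine Matrix.ext fun a b => ?_
    simp
  have h3 : (matC (Fin m ⊕ ι) (E' i)).map (pderiv (Sum.inr i)) = 0 := by
    refine Matrix.ext fun a b => ?_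
    simp
  have h2 : ∀ M : Matrix q q (MvPolynomial (Fin m ⊕ ι) ℂ), (-M).map (pderiv (Sum.inr i)) =
      -M.map (pderiv (Sum.inr i)) := fun M => by
    refine Matrix.ext fun a b => ?_
    simp
  rw [spectralMat_chiral_map_pderiv, h2, Matrix.map_add _ (map_add _), Matrix.map_derivation_mul,
    Matrix.map_derivation_mul, linMat_map_rename_map_pderiv, linMat_map_rename_map_pderiv, h1, h3]
  rw [Matrix.mul_zero, Matrix.zero_mul, zero_add, add_zero, two_smul]

theorem sum_matC_mul_matC_eq_zero {κ : Type*} {p q : Type*} {E : ι → Matrix p q ℂ}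
    (hE : ∀ a b c d, ∑ i, E i a b * E i c d = 0) (a : p) (b : q) (c : p) (d : q) :
    ∑ i, matC κ (E i) a b * matC κ (E i) c d = 0 := by
  simp only [matC, Matrix.map_apply, ← map_mul, ← map_sum, hE, map_zero]

theorem sum_matC_mul_matC_eq_ite {κ : Type*} {p q : Type*} [DecidableEq p] [DecidableEq q]
    {E : ι → Matrix p q ℂ} {E' : ι → Matrix q p ℂ}
    (hEE' : ∀ a b c d, ∑ i, E i a b * E' i c d = if a = d ∧ b = c then 2 else 0)
    (a : p) (b c : q) (d : p) :
    ∑ i, matC κ (E i) a b * matC κ (E' i) c d = if a = d ∧ b = c then 2 else 0 := by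
  simp only [matC, Matrix.map_apply, ← map_mul, ← map_sum, hEE']
  split_ifs
  · exact C_two
  · exact C_0

variable [Fintype q] {E : ι → Matrix p q ℂ} {E' : ι → Matrix q p ℂ}

/-- With W = M†M, writing W = x - (x - W) removes W from the traces left by the contractions,
leaving traces of adjugates and determinants. -/
theorem adjugate_spectralMat_chiral_mul (k : Fin m) :
    (spectralMat (linMat E' * linMat E) k).adjugate *
      (linMatInr m E' * linMatInr m E) =
      (X (Sum.inl k) : MvPolynomial (Fin m ⊕ ι) ℂ) •
        (spectralMat (linMat E' * linMat E) k).adjugate -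
      spectralDet (linMat E' * linMat E) k • 1 := by
  have h1 := Matrix.adjugate_mul (spectralMat (m := m) (linMat E' * linMat E) k)
  have h2 := congrArg ((spectralMat (m := m) (linMat E' * linMat E) k).adjugate * ·)
    (spectralMat_chiral E E' k)
  simp only [mul_sub, mul_smul_comm, mul_one] at h2
  rw [h1] at h2
  rw [spectralDet, h2, sub_sub_cancel]

theorem pderiv_inr_spectralDet_chiral (k : Fin m) (i : ι) :
    pderiv (Sum.inr i) (spectralDet (linMat E' * linMat E) k) =
      -((spectralMat (linMat E' * linMat E) k).adjugate *
        (linMatInr m E' * matC (Fin m ⊕ ι) (E i) +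
        matC (Fin m ⊕ ι) (E' i) * linMatInr m E)).trace := by
  classical
  rw [spectralDet, Derivation.map_det, spectralMat_chiral_map_pderiv, mul_neg, Matrix.trace_neg]

/-- M†M is quadratic in the coordinates, so the spectral variable has weight two. -/
theorem euler_spectralDet_chiral (k : Fin m) :
    ∑ i, X (Sum.inr i) * pderiv (Sum.inr i) (spectralDet (linMat E' * linMat E) k) +
      2 * X (Sum.inl k) * pderiv (Sum.inl k) (spectralDet (linMat E' * linMat E) k) =
      2 * (Fintype.card q : MvPolynomial (Fin m ⊕ ι) ℂ) *
        spectralDet (linMat E' * linMat E) k := by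
  set A := (spectralMat (m := m) (linMat E' * linMat E) k).adjugate with hA
  set U := linMatInr m E' with hU
  set V := linMatInr m E with hV
  have h1 : ∑ i, X (Sum.inr i) * pderiv (Sum.inr i) (spectralDet (linMat E' * linMat E) k) =
      -((A * (U * V)).trace + (A * (U * V)).trace) := by
    have h2 : A * (U * V) = ∑ i, (X (Sum.inr i) : MvPolynomial (Fin m ⊕ ι) ℂ) •
        (A * (U * matC (Fin m ⊕ ι) (E i))) := by
      rw [hV, linMatInr, linMat_map_rename]
      simp only [Matrix.mul_sum, Matrix.mul_smul]
    have h3 : A * (U * V) = ∑ i, (X (Sum.inr i) : MvPolynomial (Fin m ⊕ ι) ℂ) •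
        (A * (matC (Fin m ⊕ ι) (E' i) * V)) := by
      rw [hU, linMatInr, linMat_map_rename]
      simp only [Matrix.mul_sum, Matrix.sum_mul, Matrix.smul_mul, Matrix.mul_smul]
    have h4 : (A * (U * V)).trace + (A * (U * V)).trace =
        ∑ i, (X (Sum.inr i) * (A * (U * matC (Fin m ⊕ ι) (E i))).trace +
          X (Sum.inr i) * (A * (matC (Fin m ⊕ ι) (E' i) * V)).trace) := by
      rw [Finset.sum_add_distrib]
      refine congrArg₂ (· + ·) ?_ ?_
      · rw [h2, Matrix.trace_sum]
        exact Finset.sum_congr rfl fun i _ => Matrix.trace_smul _ _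
      · rw [h3, Matrix.trace_sum]
        exact Finset.sum_congr rfl fun i _ => Matrix.trace_smul _ _
    rw [h4, ← Finset.sum_neg_distrib]
    refine Finset.sum_congr rfl fun i _ => ?_
    rw [pderiv_inr_spectralDet_chiral, Matrix.mul_add, Matrix.trace_add]
    ring
  rw [h1, hA, hU, hV, adjugate_spectralMat_chiral_mul, pderiv_inl_spectralDet, Matrix.trace_sub,
    Matrix.trace_smul, Matrix.trace_smul, Matrix.trace_one]
  simp only [smul_eq_mul]
  ring

theorem gradient_spectralDet_chiral
    [DecidableEq p] (hE : ∀ a b c d, ∑ i, E i a b * E i c d = 0)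
    (hE' : ∀ a b c d, ∑ i, E' i a b * E' i c d = 0)
    (hEE' : ∀ a b c d, ∑ i, E i a b * E' i c d = if a = d ∧ b = c then 2 else 0) (k l : Fin m) :
    ∑ i, pderiv (Sum.inr i) (spectralDet (linMat E' * linMat E) k) *
        pderiv (Sum.inr i) (spectralDet (linMat E' * linMat E) l) =
      2 * ((X (Sum.inl k) + X (Sum.inl l)) *
        ((spectralMat (linMat E' * linMat E) k).adjugate *
          (spectralMat (linMat E' * linMat E) l).adjugate).trace -
        pderiv (Sum.inl k) (spectralDet (linMat E' * linMat E) k) *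
          spectralDet (linMat E' * linMat E) l -
        spectralDet (linMat E' * linMat E) k *
          pderiv (Sum.inl l) (spectralDet (linMat E' * linMat E) l)) := by
  simp only [pderiv_inr_spectralDet_chiral, neg_mul_neg]
  rw [sum_trace_mul_trace_of_chiral (sum_matC_mul_matC_eq_zero hE)
    (sum_matC_mul_matC_eq_zero hE') (sum_matC_mul_matC_eq_ite hEE'),
    adjugate_spectralMat_chiral_mul, adjugate_spectralMat_chiral_mul, pderiv_inl_spectralDet,
    pderiv_inl_spectralDet]
  simp only [sub_mul, smul_mul_assoc, one_mul, Matrix.trace_sub, Matrix.trace_smul, smul_eq_mul]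
  rw [Matrix.trace_mul_comm (spectralMat _ l).adjugate]
  ring

/-- The dual operator is 4x ∂² + 4(p - q + 1) ∂, for a matrix with p rows and q columns. Here p
comes from the constant second derivative of M†M and 1 - q from the contracted traces; with p = N +
ν and q = N this is the Laguerre operator of index ν. -/
theorem laplacian_spectralDet_chiral
    [DecidableEq p] (hE : ∀ a b c d, ∑ i, E i a b * E i c d = 0)
    (hE' : ∀ a b c d, ∑ i, E' i a b * E' i c d = 0)
    (hEE' : ∀ a b c d, ∑ i, E i a b * E' i c d = if a = d ∧ b = c then 2 else 0) (k : Fin m) :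
    ∑ i, pderiv (Sum.inr i) (pderiv (Sum.inr i) (spectralDet (linMat E' * linMat E) k)) =
      4 * ((Fintype.card q : MvPolynomial (Fin m ⊕ ι) ℂ) - 1 -
        (Fintype.card p : MvPolynomial (Fin m ⊕ ι) ℂ)) *
        pderiv (Sum.inl k) (spectralDet (linMat E' * linMat E) k) - 4 * X (Sum.inl k) *
        pderiv (Sum.inl k) (pderiv (Sum.inl k) (spectralDet (linMat E' * linMat E) k)) := by
  classical
  refine mul_left_cancel₀ (spectralDet_ne_zero (linMat E' * linMat E) k) ?_
  have h1 : ∀ i, spectralDet (linMat E' * linMat E) k *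
      pderiv (Sum.inr i) (pderiv (Sum.inr i) (spectralDet (linMat E' * linMat E) k)) =
      ((spectralMat (linMat E' * linMat E) k).adjugate *
        (linMatInr m E' * matC (Fin m ⊕ ι) (E i) + matC (Fin m ⊕ ι) (E' i) * linMatInr m E)).trace *
      ((spectralMat (linMat E' * linMat E) k).adjugate *
        (linMatInr m E' * matC (Fin m ⊕ ι) (E i) + matC (Fin m ⊕ ι) (E' i) * linMatInr m E)).trace -
      ((spectralMat (linMat E' * linMat E) k).adjugate *
        (linMatInr m E' * matC (Fin m ⊕ ι) (E i) + matC (Fin m ⊕ ι) (E' i) * linMatInr m E) *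
        (spectralMat (linMat E' * linMat E) k).adjugate *
        (linMatInr m E' * matC (Fin m ⊕ ι) (E i) +
          matC (Fin m ⊕ ι) (E' i) * linMatInr m E)).trace -
      2 * (spectralDet (linMat E' * linMat E) k * ((spectralMat (linMat E' * linMat E) k).adjugate *
        (matC (Fin m ⊕ ι) (E' i) * matC (Fin m ⊕ ι) (E i))).trace) := fun i => by
    rw [spectralDet, det_mul_derivation_derivation_det, spectralMat_chiral_map_pderiv_pderiv,
      spectralMat_chiral_map_pderiv]
    simp only [mul_neg, neg_mul, neg_neg, Matrix.trace_neg, mul_smul_comm, Matrix.trace_smul,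
      smul_eq_mul]
    ring
  have h2 : ∑ i, ((spectralMat (linMat E' * linMat E) k).adjugate *
        (matC (Fin m ⊕ ι) (E' i) * matC (Fin m ⊕ ι) (E i))).trace =
      Fintype.card p * 2 * (spectralMat (linMat E' * linMat E) k).adjugate.trace := by
    rw [← Matrix.trace_sum, ← Matrix.mul_sum, sum_mul_of_chiral (sum_matC_mul_matC_eq_ite hEE'),
      mul_smul_comm, mul_one, Matrix.trace_smul, smul_eq_mul]
  have h3 := spectralDet_mul_pderiv_pderiv (m := m) (linMat E' * linMat E) k
  rw [Finset.mul_sum]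
  simp only [h1, Finset.sum_sub_distrib, ← Finset.mul_sum]
  rw [h2, sum_trace_mul_trace_of_chiral (sum_matC_mul_matC_eq_zero hE)
    (sum_matC_mul_matC_eq_zero hE') (sum_matC_mul_matC_eq_ite hEE'),
    sum_trace_mul_mul_mul_of_chiral (sum_matC_mul_matC_eq_zero hE)
    (sum_matC_mul_matC_eq_zero hE') (sum_matC_mul_matC_eq_ite hEE'),
    adjugate_spectralMat_chiral_mul]
  simp only [sub_mul, smul_mul_assoc, one_mul, Matrix.trace_sub, Matrix.trace_smul, smul_eq_mul,
    Matrix.trace_one]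
  rw [pderiv_inl_spectralDet] at h3 ⊢
  linear_combination 4 * X (Sum.inl k) * h3

end ChiralModel

/-! ### The determinant formula for the chiral GUE. -/

section ChiralEnsemble

open MvPolynomial

variable {m : ℕ} {ι : Type*} [Fintype ι] {p q : Type*} [Fintype p] [Fintype q] [DecidableEq p]
  [DecidableEq q] {mom : ℕ → ℂ} {v : ℂ} {E : ι → Matrix p q ℂ} {E' : ι → Matrix q p ℂ}

theorem diffProd_mul_partialExp_spectralDet_of_chiral
    (hmom₀ : mom 0 = 1) (hmom : ∀ k, mom (k + 1) = v * (k * mom (k - 1)))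
    (hE : ∀ a b c d, ∑ i, E i a b * E i c d = 0)
    (hE' : ∀ a b c d, ∑ i, E' i a b * E' i c d = 0)
    (hEE' : ∀ a b c d, ∑ i, E i a b * E' i c d = if a = d ∧ b = c then 2 else 0)
    (r : ℕ → Polynomial ℂ)
    (hr_deg : ∀ i, (r i - Polynomial.X ^ (Fintype.card q + i)).degree <
      ((Fintype.card q + i : ℕ) : WithBot ℕ))
    (hr : ∀ i, Polynomial.C 2 * Polynomial.X * Polynomial.derivative (r i) -
      Polynomial.C v * spectralOp 0 4 (4 * ((Fintype.card p : ℂ) - Fintype.card q + 1)) (r i) =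
      Polynomial.C (2 * (Fintype.card q + i : ℕ) : ℂ) * r i) :
    diffProd (fun k => (X k : MvPolynomial (Fin m) ℂ)) *
      partialExp (Fin m) mom (∏ k, spectralDet (linMat E' * linMat E) k) =
      (Matrix.of fun i k : Fin m =>
        Polynomial.aeval (X k : MvPolynomial (Fin m) ℂ) (r i)).det := by
  have h4 : (C 4 : MvPolynomial (Fin m ⊕ ι) ℂ) = 4 := map_ofNat C 4
  have h := diffProd_mul_partialExp_prod (m := m) (ι := ι) hmom₀ hmom (ρ := 1)
    (e := Fintype.card q) (w := 2)
    one_pos two_pos 0 4 (4 * ((Fintype.card p : ℂ) - Fintype.card q + 1))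
    (fun k => spectralDet (linMat E' * linMat E) k)
    (fun k l hkl => pderiv_inl_spectralDet_of_ne _ hkl)
    (fun k => by
      rw [laplacian_spectralDet_chiral hE hE' hEE', secondOrder_apply]
      simp [h4]
      ring)
    (fun k l hkl => by
      rw [gradient_spectralDet_chiral hE hE' hEE']
      have h1 := sub_mul_trace_adjugate_spectralMat (m := m) (linMat E' * linMat E) k l
      simp [h4]
      linear_combination 2 * (X (Sum.inl k) + X (Sum.inl l)) * h1)
    (fun k => by
      have := euler_spectralDet_chiral (m := m) (E := E) (E' := E') k
      simpa [C_two] using this)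
    (fun k => degLT_spectralDet_sub _ k)
    (fun i => by
      rcases i with _ | j
      · simp [spectralOp]
      · exact Or.inr ⟨_, j, by omega, by rw [one_mul, one_mul, spectralOp_X_pow_succ]⟩)
    r (by simpa using hr_deg) (fun i => by simpa using hr i)
  simpa using h

end ChiralEnsemble

/-! ### Integrability, continuity and determinant formulas for the Gaussian ensembles. -/

section EnsembleAverages

open MvPolynomial

theorem eval_diffProd {m : ℕ} (f : Fin m → MvPolynomial (Fin m) ℂ) (α : Fin m → ℂ) :
    eval α (diffProd f) = diffProd fun k => eval α (f k) :=
  map_diffProd (eval α) f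

theorem eval_det_aeval {m : ℕ} (r : ℕ → Polynomial ℂ) (α : Fin m → ℂ) :
    eval α (Matrix.of fun i k : Fin m =>
      Polynomial.aeval (X k : MvPolynomial (Fin m) ℂ) (r i)).det =
      (Matrix.of fun i k : Fin m => (r i).eval (α k)).det := by
  rw [RingHom.map_det]
  congr 1
  refine Matrix.ext fun i k => ?_
  have h := Polynomial.aeval_algHom_apply (MvPolynomial.aeval (R := ℂ) α) (X k) (r i)
  rw [aeval_X] at h
  simpa [MvPolynomial.coe_aeval_eq_eval, Polynomial.coe_aeval_eq_eval] using h.symm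

variable {m N : ℕ} {σ : ℝ}

theorem hermitianMatrix_eq_map_eval (g : EntryIdx N N → ℝ) :
    hermitianMatrix g = (linMat fun i : EntryIdx N N => hermitianMatrix (Pi.single i 1)).map
      (eval fun i => (g i : ℂ)) := by
  rw [linMat_map_eval, ← hermitianMatrix_eq_sum]

theorem classCMatrix_eq_map_eval (g : EntryIdx N N ⊕ EntryIdx N N → ℝ) :
    classCMatrix g = (linMat fun i : EntryIdx N N ⊕ EntryIdx N N =>
      classCMatrix (Pi.single i 1)).map (eval fun i => (g i : ℂ)) := by
  rw [linMat_map_eval, ← classCMatrix_eq_sum]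

theorem classDMatrix_eq_map_eval (g : Fin (2 * N) × Fin (2 * N) → ℝ) :
    classDMatrix g = (linMat fun i : Fin (2 * N) × Fin (2 * N) =>
      classDMatrix (Pi.single i 1)).map (eval fun i => (g i : ℂ)) := by
  rw [linMat_map_eval, ← classDMatrix_eq_sum]

/-- The coordinates are real, so conjugate transposition acts only on the coefficient matrices, and
M†M is a polynomial in the coordinates. -/
theorem chGUE_eq_map_eval {p q : ℕ} (g : EntryIdx p q → ℝ) :
    (cplxMatrix g)ᴴ * cplxMatrix g =
      ((linMat fun i : EntryIdx p q => (cplxMatrix (Pi.single i 1))ᴴ) *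
        linMat fun i : EntryIdx p q => cplxMatrix (Pi.single i 1)).map
      (eval fun i => (g i : ℂ)) := by
  have h : (cplxMatrix g)ᴴ = ∑ i, (g i : ℂ) • (cplxMatrix (Pi.single i 1))ᴴ := by
    conv_lhs => rw [cplxMatrix_eq_sum g]
    rw [Matrix.conjTranspose_sum]
    refine Finset.sum_congr rfl fun i _ => ?_
    rw [Matrix.conjTranspose_smul, Complex.star_def, Complex.conj_ofReal]
  rw [Matrix.map_mul, linMat_map_eval, linMat_map_eval, ← cplxMatrix_eq_sum, h]

theorem integrable_charProd_GUE (σ : ℝ) (α : Fin m → ℂ) :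
    Integrable (fun g => charProd α (hermitianMatrix g)) (iidGaussian (EntryIdx N N) σ) :=
  integrable_charProd σ _ hermitianMatrix_eq_map_eval α

theorem integrable_charProd_classC (σ : ℝ) (α : Fin m → ℂ) :
    Integrable (fun g => charProd α (classCMatrix g))
      (iidGaussian (EntryIdx N N ⊕ EntryIdx N N) σ) :=
  integrable_charProd σ _ classCMatrix_eq_map_eval α

theorem integrable_charProd_classD (σ : ℝ) (α : Fin m → ℂ) :
    Integrable (fun g => charProd α (classDMatrix g))
      (iidGaussian (Fin (2 * N) × Fin (2 * N)) σ) :=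
  integrable_charProd σ _ classDMatrix_eq_map_eval α

theorem integrable_charProd_chGUE {p q : ℕ} (σ : ℝ) (α : Fin m → ℂ) :
    Integrable (fun g => charProd α ((cplxMatrix g)ᴴ * cplxMatrix g))
      (iidGaussian (EntryIdx p q) σ) :=
  integrable_charProd σ _ chGUE_eq_map_eval α

/-- The average is a polynomial in α. -/
theorem continuous_integral_charProd {ι n : Type} [Fintype ι] [Fintype n] [DecidableEq n] (σ : ℝ)
    {F : (ι → ℝ) → Matrix n n ℂ} (H : Matrix n n (MvPolynomial ι ℂ))
    (hF : ∀ g, F g = H.map (eval fun i => (g i : ℂ))) :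
    Continuous fun α : Fin m → ℂ => ∫ g, charProd α (F g) ∂(iidGaussian ι σ) := by
  simp only [integral_charProd σ H hF]
  exact MvPolynomial.continuous_eval _

theorem continuous_avgGUE : Continuous (avgGUE (m := m) N σ) :=
  continuous_integral_charProd σ _ hermitianMatrix_eq_map_eval

theorem continuous_avgClassC : Continuous (avgClassC (m := m) N σ) :=
  continuous_integral_charProd σ _ classCMatrix_eq_map_eval

theorem continuous_avgClassD : Continuous (avgClassD (m := m) N σ) :=
  continuous_integral_charProd σ _ classDMatrix_eq_map_eval

theorem continuous_avgChGUE {ν : ℕ} : Continuous (avgChGUE (m := m) ν N σ) :=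
  continuous_integral_charProd σ _ chGUE_eq_map_eval

theorem diffProd_mul_avgGUE (hσ : 0 < σ) (r : ℕ → Polynomial ℂ)
    (hr_deg : ∀ i, (r i - Polynomial.X ^ (N + i)).degree < ((N + i : ℕ) : WithBot ℕ))
    (hr : ∀ i, Polynomial.X * Polynomial.derivative (r i) -
      Polynomial.C ((σ : ℂ) ^ 2) * Polynomial.derivative (Polynomial.derivative (r i)) =
      Polynomial.C ((N + i : ℕ) : ℂ) * r i) (α : Fin m → ℂ) :
    diffProd α * avgGUE N σ α = (Matrix.of fun i k : Fin m => (r i).eval (α k)).det := by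
  have h := diffProd_mul_partialExp_spectralDet_of_unitary (m := m) (mom := gaussianMoment σ)
    (gaussianMoment_zero σ) (gaussianMoment_succ hσ) sum_hermitianMatrix_mul_hermitianMatrix
    r (by simpa using hr_deg) (by simpa using hr)
  have h1 := congrArg (eval α) h
  rw [map_mul, eval_diffProd, eval_det_aeval] at h1
  simp only [eval_X] at h1
  rw [← h1, avgGUE, integral_charProd σ _ hermitianMatrix_eq_map_eval]

theorem diffProd_mul_avgClassD (hσ : 0 < σ) (r : ℕ → Polynomial ℂ)
    (hr_deg : ∀ i, (r i - Polynomial.X ^ (2 * N + 2 * i)).degree <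
      ((2 * N + 2 * i : ℕ) : WithBot ℕ))
    (hr : ∀ i, Polynomial.X * Polynomial.derivative (r i) -
      Polynomial.C ((σ : ℂ) ^ 2) * Polynomial.derivative (Polynomial.derivative (r i)) =
      Polynomial.C ((2 * N + 2 * i : ℕ) : ℂ) * r i) (α : Fin m → ℂ) :
    diffProd (fun k => α k ^ 2) * avgClassD N σ α =
      (Matrix.of fun i k : Fin m => (r i).eval (α k)).det := by
  have hskew : ∀ i : Fin (2 * N) × Fin (2 * N),
      (1 : Matrix (Fin (2 * N)) (Fin (2 * N)) ℂ) * (classDMatrix (Pi.single i 1))ᵀ * 1 =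
        -classDMatrix (Pi.single i 1) := fun i => by
    rw [one_mul, mul_one]
    exact (LieAlgebra.Orthogonal.mem_so _ _ _).1 (classDMatrix_mem _).2
  have h := diffProd_mul_partialExp_spectralDet_of_orthogonal (m := m) (mom := gaussianMoment σ)
    (gaussianMoment_zero σ) (gaussianMoment_succ hσ) 1 1 (mul_one 1) Matrix.transpose_one
    sum_classDMatrix_mul_classDMatrix hskew
    r (by simpa using hr_deg) (by simpa using hr)
  have h1 := congrArg (eval α) h
  rw [map_mul, eval_diffProd, eval_det_aeval] at h1
  simp only [eval_X, map_pow] at h1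
  rw [← h1, avgClassD, integral_charProd σ _ classDMatrix_eq_map_eval]

theorem diffProd_mul_avgChGUE {ν : ℕ} (hσ : 0 < σ) (r : ℕ → Polynomial ℂ)
    (hr_deg : ∀ i, (r i - Polynomial.X ^ (N + i)).degree < ((N + i : ℕ) : WithBot ℕ))
    (hr : ∀ i, Polynomial.C 2 * Polynomial.X * Polynomial.derivative (r i) -
      Polynomial.C ((σ : ℂ) ^ 2) * spectralOp 0 4 (4 * ((ν : ℂ) + 1)) (r i) =
      Polynomial.C (2 * (N + i : ℕ) : ℂ) * r i) (α : Fin m → ℂ) :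
    diffProd α * avgChGUE ν N σ α = (Matrix.of fun i k : Fin m => (r i).eval (α k)).det := by
  have h := diffProd_mul_partialExp_spectralDet_of_chiral (m := m) (mom := gaussianMoment σ)
    (ι := EntryIdx (N + ν) N)
    (E := fun i => cplxMatrix (Pi.single i 1)) (E' := fun i => (cplxMatrix (Pi.single i 1))ᴴ)
    (gaussianMoment_zero σ) (gaussianMoment_succ hσ) sum_cplxMatrix_mul_cplxMatrix
    (fun a b c d => sum_star_cplxMatrix_mul_star_cplxMatrix b a d c)
    (fun a b c d => sum_cplxMatrix_mul_star_cplxMatrix a b d c)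
    r (by simpa using hr_deg) (fun i => by
      have : ((Fintype.card (Fin (N + ν)) : ℂ) - Fintype.card (Fin N) + 1) = ν + 1 := by
        simp
      rw [this]
      simpa using hr i)
  have h1 := congrArg (eval α) h
  rw [map_mul, eval_diffProd, eval_det_aeval] at h1
  simp only [eval_X] at h1
  rw [← h1, avgChGUE, integral_charProd σ _ chGUE_eq_map_eval]

theorem diffProd_mul_avgClassC (hσ : 0 < σ) (r : ℕ → Polynomial ℂ)
    (hr_deg : ∀ i, (Polynomial.X * r i - Polynomial.X ^ (2 * N + 1 + 2 * i)).degree <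
      ((2 * N + 1 + 2 * i : ℕ) : WithBot ℕ))
    (hr : ∀ i, Polynomial.X * Polynomial.derivative (Polynomial.X * r i) -
      Polynomial.C ((σ : ℂ) ^ 2) * Polynomial.derivative (Polynomial.derivative
        (Polynomial.X * r i)) =
      Polynomial.C ((2 * N + 1 + 2 * i : ℕ) : ℂ) * (Polynomial.X * r i)) (α : Fin m → ℂ) :
    diffProd (fun k => α k ^ 2) * avgClassC N σ α =
      (Matrix.of fun i k : Fin m => (r i).eval (α k)).det := by
  have hJ : (Matrix.J (Fin N) ℂ)ᵀ = -Matrix.J (Fin N) ℂ := Matrix.J_transpose _ _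
  have hJ2 : Matrix.J (Fin N) ℂ * Matrix.J (Fin N) ℂ = -1 := Matrix.J_squared _ _
  have hskew : ∀ i : EntryIdx N N ⊕ EntryIdx N N,
      Matrix.J (Fin N) ℂ * (classCMatrix (Pi.single i 1))ᵀ * (-Matrix.J (Fin N) ℂ) =
        -classCMatrix (Pi.single i 1) := fun i => by
    have h := (classCMatrix_mem (Pi.single i 1)).2
    rw [LieAlgebra.Symplectic.sp, mem_skewAdjointMatricesLieSubalgebra,
      mem_skewAdjointMatricesSubmodule, Matrix.IsSkewAdjoint, Matrix.IsAdjointPair] at h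
    rw [mul_neg, mul_assoc, h, ← mul_assoc, hJ2, neg_mul_neg, one_mul]
  have h := diffProd_mul_partialExp_spectralDet_of_symplectic (m := m) (mom := gaussianMoment σ)
    (gaussianMoment_zero σ) (gaussianMoment_succ hσ) (Matrix.J (Fin N) ℂ) (-Matrix.J (Fin N) ℂ)
    (by rw [neg_mul, hJ2, neg_neg]) (by rw [Matrix.transpose_neg, hJ])
    sum_classCMatrix_mul_classCMatrix hskew
    (fun i => Polynomial.X * r i) (by simpa [← two_mul] using hr_deg)
    (by simpa [← two_mul] using hr)
  have h2 : (Matrix.of fun i k : Fin m =>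
        Polynomial.aeval (X k : MvPolynomial (Fin m) ℂ) (Polynomial.X * r i)).det =
      (∏ k, X k) * (Matrix.of fun i k : Fin m =>
        Polynomial.aeval (X k : MvPolynomial (Fin m) ℂ) (r i)).det := by
    rw [← Matrix.det_mul_row]
    congr 1
    refine Matrix.ext fun i k => ?_
    simp
  rw [h2, mul_left_comm] at h
  -- The product of the spectral variables is cancelled between polynomials, before evaluation, so
  -- points with some α_k = 0 need no separate treatment.
  replace h := mul_left_cancel₀ (Finset.prod_ne_zero_iff.2 fun k _ => X_ne_zero k) h
  have h1 := congrArg (eval α) h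
  rw [map_mul, eval_diffProd, eval_det_aeval] at h1
  simp only [eval_X, map_pow] at h1
  rw [← h1, avgClassC, integral_charProd σ _ classCMatrix_eq_map_eval]

end EnsembleAverages

/-! ### Monic polynomials defined by a three-term recurrence. -/

section MonicRecurrence

open Polynomial

/-- The monic polynomials with `p_{j+1} = (X - b_j) p_j - c_j p_{j-1}`. -/
noncomputable def monicRec (b c : ℕ → ℂ) : ℕ → ℂ[X]
  | 0 => 1
  | 1 => X - C (b 0)
  | n + 2 => (X - C (b (n + 1))) * monicRec b c (n + 1) - C (c (n + 1)) * monicRec b c n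

variable (b c : ℕ → ℂ)

theorem monicRec_zero : monicRec b c 0 = 1 := by
  rw [monicRec]

theorem monicRec_one : monicRec b c 1 = X - C (b 0) := by
  rw [monicRec]

theorem monicRec_add_two (n : ℕ) : monicRec b c (n + 2) =
    (X - C (b (n + 1))) * monicRec b c (n + 1) - C (c (n + 1)) * monicRec b c n := by
  rw [monicRec]

theorem monicRec_monic_natDegree (n : ℕ) :
    (monicRec b c n).Monic ∧ (monicRec b c n).natDegree = n := by
  induction n using Nat.twoStepInduction with
  | zero => simp [monicRec_zero]
  | one => simp [monicRec_one, monic_X_sub_C]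
  | more n h0 h1 =>
    have hm : ((X - C (b (n + 1))) * monicRec b c (n + 1)).Monic := (monic_X_sub_C _).mul h1.1
    have hd : ((X - C (b (n + 1))) * monicRec b c (n + 1)).natDegree = n + 2 := by
      rw [(monic_X_sub_C _).natDegree_mul h1.1, natDegree_X_sub_C, h1.2]
      omega
    have hlt : (C (c (n + 1)) * monicRec b c n).degree <
        ((X - C (b (n + 1))) * monicRec b c (n + 1)).degree := by
      rw [degree_eq_natDegree hm.ne_zero, hd]
      rw [C_mul']
      refine lt_of_le_of_lt (degree_smul_le _ _) ?_
      rw [degree_eq_natDegree h0.1.ne_zero, h0.2]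
      exact_mod_cast (by omega : n < n + 2)
    rw [monicRec_add_two]
    exact ⟨hm.sub_of_left hlt, by rw [natDegree_eq_of_degree_eq (degree_sub_eq_left_of_degree_lt hlt), hd]⟩

theorem monicRec_monic (n : ℕ) : (monicRec b c n).Monic := (monicRec_monic_natDegree b c n).1

theorem natDegree_monicRec (n : ℕ) : (monicRec b c n).natDegree = n :=
  (monicRec_monic_natDegree b c n).2

theorem degree_sub_X_pow_lt {p : ℂ[X]} {n : ℕ} (hp : p.Monic) (hn : p.natDegree = n) :
    (p - X ^ n).degree < (n : WithBot ℕ) := by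
  have h : p.degree = n := by rw [degree_eq_natDegree hp.ne_zero, hn]
  rw [← h]
  exact degree_sub_lt_left (by rw [h, degree_X_pow]) hp.ne_zero (by rw [hp, leadingCoeff_X_pow])

end MonicRecurrence

/-! ### Monic Hermite polynomials: differential equation and explicit form. -/

section HermiteMonic

open Polynomial

/-- The monic Hermite polynomials of variance `v`. -/
noncomputable def hermiteMonic (v : ℂ) : ℕ → ℂ[X] := monicRec 0 fun j => j * v

variable (v : ℂ)

theorem hermiteMonic_add_two (n : ℕ) : hermiteMonic v (n + 2) =
    X * hermiteMonic v (n + 1) - C ((n + 1) * v) * hermiteMonic v n := by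
  rw [hermiteMonic, monicRec_add_two]
  simp

theorem derivative_hermiteMonic_succ (n : ℕ) :
    derivative (hermiteMonic v (n + 1)) = C (n + 1 : ℂ) * hermiteMonic v n := by
  induction n using Nat.twoStepInduction with
  | zero => simp [hermiteMonic, monicRec_one, monicRec_zero]
  | one =>
    rw [hermiteMonic_add_two]
    simp [hermiteMonic, monicRec_one, monicRec_zero]
    ring
  | more n h0 h1 =>
    rw [hermiteMonic_add_two, derivative_sub, derivative_mul, derivative_mul, h1, h0,
      hermiteMonic_add_two]
    have : (C 2 : ℂ[X]) = 2 := map_ofNat C 2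
    simp [this]
    ring

theorem hermiteMonic_ode (n : ℕ) : X * derivative (hermiteMonic v n) -
    C v * derivative (derivative (hermiteMonic v n)) = C (n : ℂ) * hermiteMonic v n := by
  rcases n with _ | _ | n
  · simp [hermiteMonic, monicRec_zero]
  · simp [hermiteMonic, monicRec_one]
  · rw [derivative_hermiteMonic_succ, derivative_mul, derivative_hermiteMonic_succ,
      hermiteMonic_add_two]
    simp
    ring

theorem coeff_hermiteMonic (n j : ℕ) : ((n : ℂ) - j) * (hermiteMonic v n).coeff j =
    -(v * ((j + 2) * (j + 1)) * (hermiteMonic v n).coeff (j + 2)) := by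
  have h := congrArg (fun p => coeff p j) (hermiteMonic_ode v n)
  simp only [coeff_sub, coeff_C_mul, coeff_derivative] at h
  rcases j with _ | j
  · simp at h ⊢
    linear_combination -h
  · rw [coeff_X_mul, coeff_derivative] at h
    push_cast at h ⊢
    linear_combination -h

/-- The differential equation is a two-step recursion for the coefficients, solved downwards from
the leading coefficient 1. -/
theorem coeff_hermiteMonic_sub_two_mul (n k : ℕ) (hk : 2 * k ≤ n) :
    (hermiteMonic v n).coeff (n - 2 * k) =
      n ! * (-v / 2) ^ k / (k ! * (n - 2 * k)!) := by
  induction k with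
  | zero =>
    have h := monicRec_monic 0 (fun j => (j : ℂ) * v) n
    have h2 := natDegree_monicRec 0 (fun j => (j : ℂ) * v) n
    rw [Monic, leadingCoeff, h2] at h
    have : (n ! : ℂ) ≠ 0 := by exact_mod_cast n.factorial_ne_zero
    simpa [hermiteMonic, this] using h
  | succ k ih =>
    obtain ⟨j, rfl⟩ := Nat.exists_eq_add_of_le hk
    have h := coeff_hermiteMonic v (2 * (k + 1) + j) j
    have e1 : 2 * (k + 1) + j - 2 * k = j + 2 := by omega
    have e2 : 2 * (k + 1) + j - 2 * (k + 1) = j := by omega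
    rw [e1] at ih
    rw [e2]
    rw [ih (by omega)] at h
    have h1 : (k ! : ℂ) ≠ 0 := by exact_mod_cast k.factorial_ne_zero
    have h2 : (j ! : ℂ) ≠ 0 := by exact_mod_cast j.factorial_ne_zero
    have h3 : (k + 1 : ℂ) ≠ 0 := by exact_mod_cast k.succ_ne_zero
    have h4 : (j + 1 : ℂ) ≠ 0 := by exact_mod_cast j.succ_ne_zero
    have h5 : (j + 2 : ℂ) ≠ 0 := by exact_mod_cast (j + 1).succ_ne_zero
    have e3 : ((j + 2)! : ℂ) = (j + 2) * (j + 1) * j ! := by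
      rw [Nat.factorial_succ (j + 1), Nat.factorial_succ j]
      push_cast
      ring
    have e4 : ((k + 1)! : ℂ) = (k + 1) * k ! := by
      rw [Nat.factorial_succ]
      push_cast
      ring
    have e5 : ((2 * (k + 1) + j : ℕ) : ℂ) - j = 2 * (k + 1) := by
      push_cast
      ring
    rw [e3, e5] at h
    rw [e4]
    refine mul_left_cancel₀ (mul_ne_zero two_ne_zero h3) (h.trans ?_)
    field_simp
    ring

theorem coeff_hermiteMonic_eq_zero (j k : ℕ) :
    (hermiteMonic v (j + 2 * k + 1)).coeff j = 0 := by
  induction k generalizing j with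
  | zero =>
    have h := coeff_hermiteMonic v (j + 1) j
    rw [coeff_eq_zero_of_natDegree_lt (n := j + 2) (by
      rw [hermiteMonic, natDegree_monicRec]
      omega)] at h
    simpa using h
  | succ k ih =>
    have h := coeff_hermiteMonic v (j + 2 * (k + 1) + 1) j
    rw [show j + 2 * (k + 1) + 1 = j + 2 + 2 * k + 1 by ring, ih, mul_zero, neg_zero] at h
    rw [show j + 2 * (k + 1) + 1 = j + 2 + 2 * k + 1 by ring]
    refine (mul_eq_zero.1 h).resolve_left (sub_ne_zero.2 ?_)
    exact_mod_cast (by omega : j + 2 + 2 * k + 1 ≠ j)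

theorem eval_hermiteMonic {σ : ℝ} (hσ : 0 < σ) (n : ℕ) (z : ℂ) :
    (hermiteMonic ((σ : ℂ) ^ 2) n).eval z =
      ((σ / √2 : ℝ) : ℂ) ^ n * hermiteH n (z / (√(2 * σ ^ 2) : ℝ)) := by
  have hs : √2 ≠ 0 := by positivity
  have h2 : √(2 * σ ^ 2) = √2 * σ := by
    rw [Real.sqrt_mul (by norm_num), Real.sqrt_sq hσ.le]
  have h3 : ((σ / √2 : ℝ) : ℂ) * (2 * (z / (√(2 * σ ^ 2) : ℝ))) = z := by
    have h4 : ((√2 : ℝ) : ℂ) * ((√2 : ℝ) : ℂ) = 2 := by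
      rw [← Complex.ofReal_mul, Real.mul_self_sqrt (by norm_num)]
      norm_num
    have h5 : ((√2 : ℝ) : ℂ) ≠ 0 := Complex.ofReal_ne_zero.2 hs
    have h6 : (σ : ℂ) ≠ 0 := Complex.ofReal_ne_zero.2 hσ.ne'
    rw [h2]
    push_cast
    field_simp
    linear_combination -z * h4
  have h7 : (((σ / √2 : ℝ) : ℂ)) ^ 2 = (σ : ℂ) ^ 2 / 2 := by
    rw [← Complex.ofReal_pow, div_pow, Real.sq_sqrt (by norm_num)]
    push_cast
    ring
  rw [eval_eq_sum_range' (n := n + 1) (by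
    rw [hermiteMonic, natDegree_monicRec]
    exact n.lt_succ_self), hermiteH, Finset.mul_sum, Finset.mul_sum]
  symm
  -- The explicit sum lists the coefficients in degrees `n - 2 * k`; those of the other parity
  -- vanish.
  refine Finset.sum_of_injOn (fun k => n - 2 * k) ?_ ?_ ?_ ?_
  · intro a ha b hb hab
    simp only [Finset.coe_range, Set.mem_Iio] at ha hb hab
    omega
  · intro a ha
    simp only [Finset.coe_range, Set.mem_Iio] at ha ⊢
    omega
  · intro j hj hj'
    have hj := Finset.mem_range.1 hj
    have hodd : ∃ k, n = j + 2 * k + 1 := by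
      by_contra hcon
      refine hj' ⟨(n - j) / 2, ?_, ?_⟩
      · simp only [Finset.coe_range, Set.mem_Iio]
        omega
      · have : ¬ n = j + 2 * ((n - j) / 2) + 1 := fun h => hcon ⟨_, h⟩
        simp only
        omega
    obtain ⟨k, rfl⟩ := hodd
    rw [coeff_hermiteMonic_eq_zero, zero_mul]
  · intro k hk
    have hk := Finset.mem_range.1 hk
    rw [coeff_hermiteMonic_sub_two_mul _ _ _ (by omega)]
    have h8 : ((σ / √2 : ℝ) : ℂ) ^ n = ((σ : ℂ) ^ 2 / 2) ^ k *
        ((σ / √2 : ℝ) : ℂ) ^ (n - 2 * k) := by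
      rw [← h7, ← pow_mul, ← pow_add]
      congr 1
      omega
    have h9 : z ^ (n - 2 * k) = ((σ / √2 : ℝ) : ℂ) ^ (n - 2 * k) *
        (2 * (z / (√(2 * σ ^ 2) : ℝ))) ^ (n - 2 * k) := by
      rw [← mul_pow, h3]
    have h10 : (-(σ : ℂ) ^ 2 / 2) ^ k = (-1) ^ k * ((σ : ℂ) ^ 2 / 2) ^ k := by
      rw [← mul_pow]
      ring
    rw [h8, h9, h10]
    ring

end HermiteMonic

/-! ### Monic Laguerre polynomials, and their quadratic substitution into Hermite polynomials. -/

section LaguerreMonic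

open Polynomial

/-- The monic Laguerre polynomials of index `ν` and scale `s`. -/
noncomputable def laguerreMonic (ν s : ℂ) : ℕ → ℂ[X] :=
  monicRec (fun j => s * (2 * j + ν + 1)) fun j => s ^ 2 * (j * (j + ν))

variable (ν s : ℂ)

theorem laguerreMonic_add_two (n : ℕ) : laguerreMonic ν s (n + 2) =
    (X - C (s * (2 * n + ν + 3))) * laguerreMonic ν s (n + 1) -
      C (s ^ 2 * ((n + 1) * (n + 1 + ν))) * laguerreMonic ν s n := by
  rw [laguerreMonic, monicRec_add_two]
  have : s * (2 * (n + 1 : ℕ) + ν + 1) = s * (2 * n + ν + 3) := by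
    push_cast
    ring
  rw [this]
  simp

/-- The two relations are proved together since the induction step mixes them. Differentiating the
first and eliminating the lower polynomial with the second gives the differential equation. -/
theorem laguerreMonic_ladder (n : ℕ) :
    X * derivative (laguerreMonic ν s (n + 1)) = C (n + 1 : ℂ) * laguerreMonic ν s (n + 1) +
      C (s * ((n + 1) * (n + 1 + ν))) * laguerreMonic ν s n ∧
    derivative (laguerreMonic ν s (n + 1)) =
      C (n + 1 : ℂ) * (laguerreMonic ν s n - C s * derivative (laguerreMonic ν s n)) := by
  induction n with
  | zero =>
    simp [laguerreMonic, monicRec_one, monicRec_zero]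
    ring
  | succ n ih =>
    obtain ⟨h1, h2⟩ := ih
    have h3 : derivative (laguerreMonic ν s (n + 2)) = C (n + 2 : ℂ) * (laguerreMonic ν s (n + 1) -
        C s * derivative (laguerreMonic ν s (n + 1))) := by
      rw [laguerreMonic_add_two, derivative_sub, derivative_mul, derivative_mul, derivative_C,
        derivative_sub, derivative_X, derivative_C]
      simp only [C_mul, C_add, C_pow, map_ofNat, map_one, map_natCast] at h1 h2 ⊢
      linear_combination h1 - (C s * ((n : ℂ[X]) + 1 + C ν)) * h2
    have h4 := laguerreMonic_add_two ν s n
    constructor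
    · rw [h3]
      simp only [C_mul, C_add, C_pow, map_ofNat, map_one, map_natCast, Nat.cast_add,
        Nat.cast_one] at h1 h4 ⊢
      rw [show n + 1 + 1 = n + 2 from rfl]
      linear_combination -((n : ℂ[X]) + 2) * C s * h1 - ((n : ℂ[X]) + 2) * h4
    · rw [show n + 1 + 1 = n + 2 from rfl, h3]
      push_cast
      ring_nf

theorem laguerreMonic_ode (n : ℕ) : X * derivative (laguerreMonic ν s n) -
    C s * (X * derivative (derivative (laguerreMonic ν s n)) +
      C (ν + 1) * derivative (laguerreMonic ν s n)) = C (n : ℂ) * laguerreMonic ν s n := by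
  rcases n with _ | n
  · simp [laguerreMonic, monicRec_zero]
  · obtain ⟨h1, h2⟩ := laguerreMonic_ladder ν s n
    have h3 := congrArg derivative h1
    simp only [derivative_mul, derivative_X, derivative_add, derivative_C, zero_mul, zero_add,
      one_mul] at h3
    simp only [C_mul, C_add, map_one, map_natCast, Nat.cast_add, Nat.cast_one] at h1 h2 h3 ⊢
    linear_combination h1 - C s * h3 - C s * ((n : ℂ[X]) + 1 + C ν) * h2

theorem coeff_laguerreMonic (n j : ℕ) : ((n : ℂ) - j) * (laguerreMonic ν s n).coeff j =
    -(s * ((j + 1) * (j + 1 + ν)) * (laguerreMonic ν s n).coeff (j + 1)) := by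
  have h := congrArg (fun p => coeff p j) (laguerreMonic_ode ν s n)
  simp only [coeff_sub, coeff_add, coeff_C_mul, coeff_derivative] at h
  rcases j with _ | j
  · simp at h ⊢
    linear_combination -h
  · rw [coeff_X_mul, coeff_X_mul, coeff_derivative, coeff_derivative, coeff_derivative] at h
    push_cast at h ⊢
    linear_combination -h

theorem coeff_laguerreMonic_add {ν : ℝ} (hν : -1 < ν) (k d : ℕ) :
    (laguerreMonic ν s (k + d)).coeff k = (-1) ^ d * (k + d)! * s ^ d *
      (Real.Gamma ((k + d : ℕ) + ν + 1) : ℝ) / ((Real.Gamma (k + ν + 1) : ℝ) * d ! * k !) := by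
  have hΓ : ∀ j : ℕ, ((Real.Gamma (j + ν + 1) : ℝ) : ℂ) ≠ 0 := fun j =>
    Complex.ofReal_ne_zero.2 (Real.Gamma_pos_of_pos (by
      have : (0 : ℝ) ≤ j := j.cast_nonneg
      linarith)).ne'
  have hfac : ∀ j : ℕ, (j ! : ℂ) ≠ 0 := fun j => by exact_mod_cast j.factorial_ne_zero
  induction d generalizing k with
  | zero =>
    have h := monicRec_monic (fun j => s * (2 * j + ν + 1)) (fun j => s ^ 2 * (j * (j + ν))) k
    have h2 := natDegree_monicRec (fun j => s * (2 * j + (ν : ℂ) + 1))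
      (fun j => s ^ 2 * (j * (j + (ν : ℂ)))) k
    rw [Monic, leadingCoeff, h2] at h
    rw [add_zero, laguerreMonic, h]
    have := hΓ k
    have := hfac k
    field_simp
    simp
  | succ d ih =>
    have h := coeff_laguerreMonic ν s (k + (d + 1)) k
    have h0 := ih (k + 1)
    rw [show k + 1 + d = k + (d + 1) by ring] at h0
    rw [h0] at h
    have h1 : Real.Gamma ((k + 1 : ℕ) + ν + 1) = (k + 1 + ν) * Real.Gamma (k + ν + 1) := by
      have h2 : (0 : ℝ) ≤ k := k.cast_nonneg
      have := Real.Gamma_add_one (s := k + ν + 1) (by linarith)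
      push_cast
      rw [show (k : ℝ) + 1 + ν + 1 = k + ν + 1 + 1 by ring, this]
      ring
    have h2 : (k + 1 + ν : ℂ) ≠ 0 := by
      have h2 : (0 : ℝ) ≤ k := k.cast_nonneg
      exact_mod_cast (by linarith : (0 : ℝ) < k + 1 + ν).ne'
    have h3 : (d + 1 : ℂ) ≠ 0 := by exact_mod_cast d.succ_ne_zero
    have h4 : (k + 1 : ℂ) ≠ 0 := by exact_mod_cast k.succ_ne_zero
    have e4 : ((d + 1)! : ℂ) = (d + 1) * d ! := by
      rw [Nat.factorial_succ]
      push_cast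
      ring
    have e3 : ((k + 1)! : ℂ) = (k + 1) * k ! := by
      rw [Nat.factorial_succ]
      push_cast
      ring
    have e5 : ((k + (d + 1) : ℕ) : ℂ) - k = d + 1 := by
      push_cast
      ring
    rw [h1, e5, e3] at h
    rw [e4]
    refine mul_left_cancel₀ h3 (h.trans ?_)
    have h5 := hΓ k
    have h6 := hfac k
    have h7 := hfac d
    push_cast
    field_simp
    ring

theorem eval_laguerreMonic {s ν : ℝ} (hs : 0 < s) (hν : -1 < ν) (n : ℕ) (z : ℂ) :
    (laguerreMonic ν s n).eval z = (-1) ^ n * n ! * s ^ n * laguerreL ν n (z / s) := by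
  rw [eval_eq_sum_range' (n := n + 1) (by
    rw [laguerreMonic, natDegree_monicRec]
    exact n.lt_succ_self), laguerreL, Finset.mul_sum]
  refine Finset.sum_congr rfl fun k hk => ?_
  obtain ⟨d, rfl⟩ := Nat.exists_eq_add_of_le (Nat.lt_succ_iff.1 (Finset.mem_range.1 hk))
  have hs' : (s : ℂ) ≠ 0 := Complex.ofReal_ne_zero.2 hs.ne'
  have h1 : (-1 : ℂ) ^ (k + d) * (-1) ^ k = (-1) ^ d := by
    rw [← pow_add, show k + d + k = 2 * k + d by ring, pow_add, pow_mul]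
    simp
  rw [coeff_laguerreMonic_add _ hν, ← h1, Nat.add_sub_cancel_left, div_pow, pow_add (s : ℂ)]
  field_simp

/-- Index -1/2 and scale 2σ² at x² give the even Hermite polynomials of variance σ²; index 1/2,
multiplied by x, gives the odd ones. The Hermite differential equation is what the class C and D
averages require. -/
theorem laguerreMonic_expand_ode_neg_half (σ : ℂ) (n : ℕ) :
    X * derivative (expand ℂ 2 (laguerreMonic (-1 / 2) (2 * σ ^ 2) n)) -
      C (σ ^ 2) * derivative (derivative (expand ℂ 2 (laguerreMonic (-1 / 2) (2 * σ ^ 2) n))) =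
      C ((2 * n : ℕ) : ℂ) * expand ℂ 2 (laguerreMonic (-1 / 2) (2 * σ ^ 2) n) := by
  have h := congrArg (expand ℂ 2) (laguerreMonic_ode (-1 / 2) (2 * σ ^ 2) n)
  have h2 : (C (-1 / 2 + 1) : ℂ[X]) * 2 = 1 := by
    rw [← map_ofNat C 2, ← C_mul]
    norm_num
  simp only [map_sub, map_mul, map_add, expand_C, expand_X, map_ofNat] at h h2
  simp only [derivative_expand, derivative_mul, derivative_X, Nat.cast_ofNat, derivative_ofNat,
    Nat.add_one_sub_one, pow_one]
  simp only [map_natCast] at h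
  rw [map_natCast C (2 * n)]
  push_cast
  linear_combination 2 * h + 2 * C (σ ^ 2) *
    expand ℂ 2 (derivative (laguerreMonic (-1 / 2) (2 * σ ^ 2) n)) * h2

theorem laguerreMonic_expand_ode_half (σ : ℂ) (n : ℕ) :
    X * derivative (X * expand ℂ 2 (laguerreMonic (1 / 2) (2 * σ ^ 2) n)) -
      C (σ ^ 2) * derivative (derivative
        (X * expand ℂ 2 (laguerreMonic (1 / 2) (2 * σ ^ 2) n))) =
      C ((2 * n + 1 : ℕ) : ℂ) * (X * expand ℂ 2 (laguerreMonic (1 / 2) (2 * σ ^ 2) n)) := by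
  have h := congrArg (expand ℂ 2) (laguerreMonic_ode (1 / 2) (2 * σ ^ 2) n)
  have h2 : (C (1 / 2 + 1) : ℂ[X]) * 2 = 3 := by
    rw [← map_ofNat C 2, ← map_ofNat C 3, ← C_mul]
    norm_num
  simp only [map_sub, map_mul, map_add, expand_C, expand_X, map_ofNat] at h h2
  simp only [derivative_expand, derivative_mul, derivative_X, Nat.cast_ofNat, derivative_ofNat,
    Nat.add_one_sub_one, pow_one, derivative_add, derivative_one]
  simp only [map_natCast] at h
  rw [map_natCast C (2 * n + 1)]
  push_cast
  linear_combination 2 * X * h + 2 * C (σ ^ 2) * X *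
    expand ℂ 2 (derivative (laguerreMonic (1 / 2) (2 * σ ^ 2) n)) * h2

end LaguerreMonic

/-! ### Block determinants and triangularity with respect to a weight. -/

section BlockDeterminants

/-- Block elimination multiplies the determinant by det A, which may vanish. Replacing A by X + A
makes this factor a monic polynomial, which can be cancelled before setting X = 0. -/
theorem det_fromBlocks_of_commute {R n : Type*} [CommRing R] [IsDomain R] [Fintype n] [DecidableEq n]
    (A B C D : Matrix n n R) (h : A * C = C * A) :
    (Matrix.fromBlocks A B C D).det = (A * D - C * B).det := by
  set A' : Matrix n n (Polynomial R) := (-A).charmatrix with hA'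
  have hdet : A'.det ≠ 0 := (Matrix.charpoly_monic (-A)).ne_zero
  have heq : A' = (Polynomial.X : Polynomial R) • 1 + A.map Polynomial.C := by
    refine Matrix.ext fun i j => ?_
    by_cases hij : i = j <;> simp [hA', hij, Matrix.charmatrix_apply_ne]
  have hcomm : A' * C.map Polynomial.C = C.map Polynomial.C * A' := by
    rw [heq, add_mul, mul_add, ← Matrix.map_mul, ← Matrix.map_mul, h]
    simp
  have h1 : Matrix.fromBlocks 1 0 (-C.map Polynomial.C) A' *
      Matrix.fromBlocks A' (B.map Polynomial.C) (C.map Polynomial.C) (D.map Polynomial.C) =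
      Matrix.fromBlocks A' (B.map Polynomial.C) 0
        (A' * D.map Polynomial.C - C.map Polynomial.C * B.map Polynomial.C) := by
    rw [Matrix.fromBlocks_multiply, hcomm]
    simp [sub_eq_add_neg, add_comm]
  have h2 := congrArg Matrix.det h1
  rw [Matrix.det_mul, Matrix.det_fromBlocks_zero₁₂, Matrix.det_fromBlocks_zero₂₁, Matrix.det_one,
    one_mul] at h2
  have h3 := congrArg (Polynomial.evalRingHom 0) (mul_left_cancel₀ hdet h2)
  rw [RingHom.map_det, RingHom.map_det] at h3
  have hc : ∀ M : Matrix n n R, (M.map Polynomial.C).map (Polynomial.evalRingHom 0) = M := fun M =>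
    Matrix.ext fun i j => by simp
  have hA : A'.map (Polynomial.evalRingHom 0) = A := by
    refine Matrix.ext fun i j => ?_
    by_cases hij : i = j <;> simp [heq, hij]
  simpa only [RingHom.mapMatrix_apply, Matrix.fromBlocks_map, Matrix.map_sub _ (map_sub _),
    Matrix.map_mul, hc, hA] using h3

/-- The weight `s` need not be injective. A permutation other than the identity with nonzero term
would strictly increase the sum of the weights, which is invariant under permutation. -/
theorem det_diagonal_add_of_triangular {R ι : Type*} [CommRing R] [Fintype ι] [DecidableEq ι]
    (s : ι → ℕ) (d : ι → R) (u : Matrix ι ι R) (hu : ∀ i j, s i ≤ s j → u i j = 0) :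
    (Matrix.diagonal d + u).det = ∏ i, d i := by
  rw [Matrix.det_apply', Finset.sum_eq_single 1]
  · simp [hu]
  · intro τ _ hτ
    obtain ⟨i, hi⟩ : ∃ i, (Matrix.diagonal d + u) (τ i) i = 0 := by
      by_contra hcon
      push Not at hcon
      have h1 : ∀ i, τ i ≠ i → s i < s (τ i) := fun i hi => by
        by_contra hlt
        exact hcon i (by simp [Matrix.diagonal_apply_ne _ hi, hu _ _ (not_lt.1 hlt)])
      obtain ⟨j, hj⟩ : ∃ j, τ j ≠ j := by
        by_contra hall
        push Not at hall
        exact hτ (Equiv.ext hall)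
      have h2 : ∑ i, s i < ∑ i, s (τ i) := by
        refine Finset.sum_lt_sum (fun i _ => ?_) ⟨j, Finset.mem_univ _, h1 j hj⟩
        by_cases hi : τ i = i
        · rw [hi]
        · exact (h1 i hi).le
      rw [Equiv.sum_comp] at h2
      exact lt_irrefl _ h2
    exact mul_eq_zero_of_right _ (Finset.prod_eq_zero (Finset.mem_univ i) hi)
  · simp

end BlockDeterminants

/-! ### Determinants built from two polynomials at two sets of nodes. -/

section TwoPolynomials

open Polynomial

variable {n : ℕ}

theorem sum_pow_mul_eval_basis {a : Fin n → ℂ} (ha : Function.Injective a) (x : ℂ) {i : ℕ}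
    (hi : i < n) :
    ∑ j, a j ^ i * (Lagrange.basis Finset.univ a j).eval x = x ^ i := by
  have h := Lagrange.eq_interpolate (s := Finset.univ) (v := a) (f := (X ^ i : ℂ[X])) ha.injOn (by
    rw [degree_X_pow]
    simpa using hi)
  have h2 := congrArg (eval x) h
  rw [Lagrange.interpolate_apply, eval_finsetSum] at h2
  simpa using h2.symm

/-- Away from the nodes the Lagrange basis is a Cauchy matrix up to row and column factors; this
produces the denominators of the kernel. -/
theorem eval_basis_eq_div {a : Fin n → ℂ} {x : ℂ} (hx : ∀ j, x ≠ a j) (j : Fin n) :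
    (Lagrange.basis Finset.univ a j).eval x =
      (∏ i, (x - a i)) * (∏ i ∈ Finset.univ.erase j, (a j - a i))⁻¹ * (x - a j)⁻¹ := by
  rw [Lagrange.basis, eval_prod, ← Finset.mul_prod_erase _ _ (Finset.mem_univ j),
    mul_comm (x - a j)]
  have h0 : x - a j ≠ 0 := sub_ne_zero.2 (hx j)
  simp only [Lagrange.basisDivisor, eval_mul, eval_C, eval_sub, eval_X, Finset.prod_mul_distrib,
    Finset.prod_inv_distrib]
  field_simp

/-- Reversing the exponents in one of the two Vandermonde determinants turns x_j - x_i into x_i -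
x_j, so that the product has no sign; it is exactly the product of the Lagrange denominators. -/
theorem det_pow_rev_mul_det_pow (a : Fin n → ℂ) :
    (Matrix.of fun i j : Fin n => a j ^ (i.rev : ℕ)).det *
      (Matrix.of fun i j : Fin n => a j ^ (i : ℕ)).det =
      ∏ j, ∏ i ∈ Finset.univ.erase j, (a j - a i) := by
  have h1 : (Matrix.of fun i j : Fin n => a j ^ (i.rev : ℕ)) =
      (Matrix.projVandermonde 1 a)ᵀ := by
    refine Matrix.ext fun i j => ?_
    simp [Matrix.projVandermonde_apply]
  have h2 : (Matrix.of fun i j : Fin n => a j ^ (i : ℕ)) = (Matrix.vandermonde a)ᵀ := by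
    refine Matrix.ext fun i j => ?_
    simp [Matrix.vandermonde_apply]
  rw [h1, h2, Matrix.det_transpose, Matrix.det_transpose, Matrix.det_projVandermonde,
    Matrix.det_vandermonde]
  have h3 : ∏ i : Fin n, ∏ j ∈ Finset.Ioi i, (a j - a i) =
      ∏ j : Fin n, ∏ i ∈ Finset.Iio j, (a j - a i) :=
    Finset.prod_comm' fun i j => by simp
  rw [h3, ← Finset.prod_mul_distrib]
  refine Finset.prod_congr rfl fun j _ => ?_
  have h4 : Finset.univ.erase j = Finset.Ioi j ∪ Finset.Iio j := by
    ext i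
    simp only [Finset.mem_erase, Finset.mem_univ, and_true, Finset.mem_union, Finset.mem_Ioi,
      Finset.mem_Iio]
    exact ⟨fun h => (lt_or_gt_of_ne h).symm, fun h => h.elim ne_of_gt ne_of_lt⟩
  rw [h4, Finset.prod_union]
  · simp
  · rw [Finset.disjoint_left]
    intro i hi hi'
    exact lt_asymm (Finset.mem_Ioi.1 hi) (Finset.mem_Iio.1 hi')

/-- The determinant of the values of `X^i g` and `X^i f` at two sets of nodes. -/
theorem det_two_polynomials {a β : Fin n → ℂ} (ha : Function.Injective a) (hβ : ∀ j k, β k ≠ a j)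
    (f g : ℂ → ℂ) :
    (Matrix.fromBlocks (Matrix.of fun i j : Fin n => a j ^ (i.rev : ℕ) * g (a j))
      (Matrix.of fun i k : Fin n => β k ^ (i.rev : ℕ) * g (β k))
      (Matrix.of fun i j : Fin n => a j ^ (i : ℕ) * f (a j))
      (Matrix.of fun i k : Fin n => β k ^ (i : ℕ) * f (β k))).det =
    (∏ j, ∏ k, (β k - a j)) * (Matrix.of fun j k : Fin n =>
      (f (a j) * g (β k) - g (a j) * f (β k)) / (a j - β k)).det := by
  set L : Matrix (Fin n) (Fin n) ℂ :=
    Matrix.of fun j k => (Lagrange.basis Finset.univ a j).eval (β k) with hL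
  -- Interpolation from the nodes `a` is exact on powers below `n`. So the columns at `β` factor
  -- through the Vandermonde matrices at `a`, leaving blocks in which the two left ones are diagonal
  -- and hence commute.
  have h1 : Matrix.fromBlocks (Matrix.of fun i j : Fin n => a j ^ (i.rev : ℕ) * g (a j))
      (Matrix.of fun i k : Fin n => β k ^ (i.rev : ℕ) * g (β k))
      (Matrix.of fun i j : Fin n => a j ^ (i : ℕ) * f (a j))
      (Matrix.of fun i k : Fin n => β k ^ (i : ℕ) * f (β k)) =
      Matrix.fromBlocks (Matrix.of fun i j : Fin n => a j ^ (i.rev : ℕ)) 0 0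
        (Matrix.of fun i j : Fin n => a j ^ (i : ℕ)) *
      Matrix.fromBlocks (Matrix.diagonal fun j => g (a j))
        (L * Matrix.diagonal fun k => g (β k)) (Matrix.diagonal fun j => f (a j))
        (L * Matrix.diagonal fun k => f (β k)) := by
    have h2 : (Matrix.of fun i j : Fin n => a j ^ (i.rev : ℕ)) * L =
        Matrix.of fun i k : Fin n => β k ^ (i.rev : ℕ) := by
      refine Matrix.ext fun i k => ?_
      rw [Matrix.mul_apply]
      exact sum_pow_mul_eval_basis ha (β k) i.rev.isLt
    have h3 : (Matrix.of fun i j : Fin n => a j ^ (i : ℕ)) * L =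
        Matrix.of fun i k : Fin n => β k ^ (i : ℕ) := by
      refine Matrix.ext fun i k => ?_
      rw [Matrix.mul_apply]
      exact sum_pow_mul_eval_basis ha (β k) i.isLt
    rw [Matrix.fromBlocks_multiply]
    simp only [zero_mul, add_zero, zero_add, ← mul_assoc, h2, h3]
    congr 1 <;> refine Matrix.ext fun i j => ?_ <;> simp
  have h4 : (Matrix.diagonal fun j => g (a j)) * (L * Matrix.diagonal fun k => f (β k)) -
      (Matrix.diagonal fun j => f (a j)) * (L * Matrix.diagonal fun k => g (β k)) =
      Matrix.of fun j k => (∏ i, (β k - a i)) * ((∏ i ∈ Finset.univ.erase j, (a j - a i))⁻¹ *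
        ((f (a j) * g (β k) - g (a j) * f (β k)) / (a j - β k))) := by
    refine Matrix.ext fun j k => ?_
    have h5 : β k - a j ≠ 0 := sub_ne_zero.2 (hβ j k)
    have h6 : (a j - β k)⁻¹ = -(β k - a j)⁻¹ := by rw [← inv_neg, neg_sub]
    rw [Matrix.sub_apply, Matrix.diagonal_mul, Matrix.mul_diagonal, Matrix.diagonal_mul,
      Matrix.mul_diagonal, Matrix.of_apply, hL, Matrix.of_apply,
      eval_basis_eq_div (fun j => hβ j k), div_eq_mul_inv, h6]
    ring
  rw [h1, Matrix.det_mul, Matrix.det_fromBlocks_zero₁₂, det_pow_rev_mul_det_pow,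
    det_fromBlocks_of_commute _ _ _ _ (by simp [mul_comm]), h4]
  have h7 : (Matrix.of fun j k : Fin n => (∏ i, (β k - a i)) *
      ((∏ i ∈ Finset.univ.erase j, (a j - a i))⁻¹ *
        ((f (a j) * g (β k) - g (a j) * f (β k)) / (a j - β k)))).det =
      (∏ k, ∏ i, (β k - a i)) * ((∏ j, (∏ i ∈ Finset.univ.erase j, (a j - a i))⁻¹) *
      (Matrix.of fun j k : Fin n =>
        (f (a j) * g (β k) - g (a j) * f (β k)) / (a j - β k)).det) := by
    rw [← Matrix.det_mul_column, ← Matrix.det_mul_row]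
    rfl
  have h8 : (∏ j, ∏ i ∈ Finset.univ.erase j, (a j - a i)) ≠ 0 :=
    Finset.prod_ne_zero_iff.2 fun j _ => Finset.prod_ne_zero_iff.2 fun i hi =>
      sub_ne_zero.2 fun h => (Finset.mem_erase.1 hi).1 (ha h).symm
  rw [h7, Finset.prod_inv_distrib, Finset.prod_comm]
  field_simp

end TwoPolynomials

/-! ### Reduction of consecutive polynomials to the middle pair. -/

section MonicRecurrenceDet

open Polynomial

variable (b c : ℕ → ℂ)

theorem degree_X_sub_C_mul_lt {p : ℂ[X]} {n : ℕ} (z : ℂ) (hp : p.degree < (n : WithBot ℕ)) :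
    ((X - C z) * p).degree < ((n + 1 : ℕ) : WithBot ℕ) := by
  rw [degree_mul, degree_X_sub_C, add_comm]
  push_cast
  exact WithBot.add_lt_add_right (by simp) hp

theorem degree_C_mul_lt {p : ℂ[X]} {n : WithBot ℕ} (z : ℂ) (hp : p.degree < n) :
    (C z * p).degree < n := by
  rw [C_mul']
  exact (degree_smul_le _ _).trans_lt hp

theorem degree_sub_lt_of_lt {p q : ℂ[X]} {n : WithBot ℕ} (hp : p.degree < n) (hq : q.degree < n) :
    (p - q).degree < n :=
  (degree_sub_le _ _).trans_lt (max_lt hp hq)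

/-- Above the pair `(p_{m+1}, p_m)`. -/
theorem exists_monicRec_add (m s : ℕ) : ∃ A B : ℂ[X], A.degree < (s : WithBot ℕ) ∧
    B.degree < (s : WithBot ℕ) ∧
    monicRec b c (m + 1 + s) = (X ^ s + A) * monicRec b c (m + 1) + B * monicRec b c m := by
  induction s using Nat.twoStepInduction with
  | zero => exact ⟨0, 0, by simp, by simp, by simp⟩
  | one =>
    refine ⟨-C (b (m + 1)), -C (c (m + 1)), ?_, ?_, ?_⟩
    · rw [degree_neg]
      exact degree_C_lt
    · rw [degree_neg]
      exact degree_C_lt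
    · rw [show m + 1 + 1 = m + 2 from rfl, monicRec_add_two]
      ring
  | more s h0 h1 =>
    obtain ⟨A, B, hA, hB, h⟩ := h0
    obtain ⟨A', B', hA', hB', h'⟩ := h1
    have hs : ((s + 1 : ℕ) : WithBot ℕ) < ((s + 2 : ℕ) : WithBot ℕ) := by
      exact_mod_cast (by omega : s + 1 < s + 2)
    have hs' : ((s : ℕ) : WithBot ℕ) < ((s + 2 : ℕ) : WithBot ℕ) := by
      exact_mod_cast (by omega : s < s + 2)
    refine ⟨(X - C (b (m + 1 + s + 1))) * A' - C (b (m + 1 + s + 1)) * X ^ (s + 1) -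
      C (c (m + 1 + s + 1)) * (X ^ s + A),
      (X - C (b (m + 1 + s + 1))) * B' - C (c (m + 1 + s + 1)) * B, ?_, ?_, ?_⟩
    · refine degree_sub_lt_of_lt (degree_sub_lt_of_lt (degree_X_sub_C_mul_lt _ hA')
        (degree_C_mul_lt _ ?_)) (degree_C_mul_lt _ ?_)
      · rwa [degree_X_pow]
      · refine (degree_add_le _ _).trans_lt (max_lt ?_ (hA.trans hs'))
        rwa [degree_X_pow]
    · exact degree_sub_lt_of_lt (degree_X_sub_C_mul_lt _ hB') (degree_C_mul_lt _ (hB.trans hs'))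
    · rw [show m + 1 + (s + 2) = m + 1 + s + 2 by ring, monicRec_add_two, h,
        show m + 1 + s + 1 = m + 1 + (s + 1) by ring, h']
      ring

/-- Below the pair `(p_{m+1}, p_m)`. -/
theorem exists_monicRec_sub {m : ℕ} (hc : ∀ j, 1 ≤ j → j ≤ m → c j ≠ 0) (s : ℕ) (hs : s ≤ m) :
    ∃ A B : ℂ[X], A.degree < (s : WithBot ℕ) ∧ B.degree < (s : WithBot ℕ) ∧
    monicRec b c (m - s) = A * monicRec b c (m + 1) +
      (C (∏ t ∈ Finset.range s, (c (m - t))⁻¹) * X ^ s + B) * monicRec b c m := by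
  -- The recurrence run downwards; this is where the `c j` must be nonzero, and each step
  -- contributes one inverse to the leading coefficient.
  have hstep : ∀ j, j + 1 ≤ m → monicRec b c j = C (c (j + 1))⁻¹ *
      ((X - C (b (j + 1))) * monicRec b c (j + 1) - monicRec b c (j + 2)) := fun j hj => by
    have h1 : (C (c (j + 1))⁻¹ : ℂ[X]) * C (c (j + 1)) = 1 := by
      rw [← C_mul, inv_mul_cancel₀ (hc _ (by omega) hj), C_1]
    rw [monicRec_add_two]
    linear_combination -monicRec b c j * h1
  induction s using Nat.twoStepInduction with
  | zero => exact ⟨0, 0, by simp, by simp, by simp⟩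
  | one =>
    refine ⟨-C (c m)⁻¹, -C ((c m)⁻¹ * b m), ?_, ?_, ?_⟩
    · rw [degree_neg]
      exact degree_C_lt
    · rw [degree_neg]
      exact degree_C_lt
    · obtain ⟨j, rfl⟩ := Nat.exists_eq_add_of_le' hs
      rw [Nat.add_sub_cancel, hstep j le_rfl]
      simp
      ring
  | more s h0 h1 =>
    obtain ⟨A, B, hA, hB, h⟩ := h0 (by omega)
    obtain ⟨A', B', hA', hB', h'⟩ := h1 (by omega)
    have hs1 : ((s + 1 : ℕ) : WithBot ℕ) < ((s + 2 : ℕ) : WithBot ℕ) := by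
      exact_mod_cast (by omega : s + 1 < s + 2)
    have hs' : ((s : ℕ) : WithBot ℕ) < ((s + 2 : ℕ) : WithBot ℕ) := by
      exact_mod_cast (by omega : s < s + 2)
    obtain ⟨j, rfl⟩ := Nat.exists_eq_add_of_le' hs
    have e1 : j + (s + 2) - (s + 2) = j := by omega
    have e2 : j + (s + 2) - (s + 1) = j + 1 := by omega
    have e3 : j + (s + 2) - s = j + 2 := by omega
    rw [e2] at h'
    rw [e3] at h
    rw [e1]
    refine ⟨C (c (j + 1))⁻¹ * ((X - C (b (j + 1))) * A' - A),
      C (c (j + 1))⁻¹ * ((X - C (b (j + 1))) * B' -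
        C (b (j + 1)) * (C (∏ t ∈ Finset.range (s + 1), (c (j + (s + 2) - t))⁻¹) * X ^ (s + 1)) -
        (C (∏ t ∈ Finset.range s, (c (j + (s + 2) - t))⁻¹) * X ^ s + B)), ?_, ?_, ?_⟩
    · exact degree_C_mul_lt _ (degree_sub_lt_of_lt (degree_X_sub_C_mul_lt _ hA') (hA.trans hs'))
    · refine degree_C_mul_lt _ (degree_sub_lt_of_lt (degree_sub_lt_of_lt
        (degree_X_sub_C_mul_lt _ hB') (degree_C_mul_lt _ (degree_C_mul_lt _ ?_))) ?_)
      · rwa [degree_X_pow]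
      · refine (degree_add_le _ _).trans_lt (max_lt (degree_C_mul_lt _ ?_) (hB.trans hs'))
        rwa [degree_X_pow]
    · rw [Finset.prod_range_succ _ (s + 1), e2, hstep j (by omega), h, h', C_mul]
      ring

variable {n : ℕ}

theorem sum_coeff_mul_pow {p : ℂ[X]} {d : ℕ} (hp : p.degree < (d : WithBot ℕ)) (hd : d ≤ n) (x : ℂ) :
    ∑ j : Fin n, p.coeff j * x ^ (j : ℕ) = p.eval x := by
  rcases Nat.eq_zero_or_pos n with rfl | hn
  · have : p = 0 := Polynomial.ext fun k =>
      (degree_lt_iff_coeff_zero p d).1 hp k (by omega)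
    simp [this]
  · rw [Fin.sum_univ_eq_sum_range fun j => p.coeff j * x ^ j, eval_eq_sum_range' (n := n)]
    rcases eq_or_ne p 0 with rfl | h0
    · simpa using hn
    · exact (natDegree_lt_iff_degree_lt h0).2 (hp.trans_le (by exact_mod_cast hd))

/-- Up to an explicit factor, the determinant of consecutive orthogonal polynomials evaluated at
two sets of nodes is a determinant of Christoffel--Darboux kernels. -/
theorem det_monicRec {N m : ℕ} (hm : m + 1 = N + n) (hc : ∀ j, 1 ≤ j → j ≤ m → c j ≠ 0)
    {α : Fin (n + n) → ℂ} (hα : Function.Injective α) :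
    (Matrix.of fun i k : Fin (n + n) => (monicRec b c (N + i)).eval (α k)).det =
      (∏ s ∈ Finset.range n, ∏ t ∈ Finset.range s, (c (m - t))⁻¹) *
      ((∏ j, ∏ k, (secondHalf α k - firstHalf α j)) * (Matrix.of fun j k : Fin n =>
        ((monicRec b c (m + 1)).eval (firstHalf α j) * (monicRec b c m).eval (secondHalf α k) -
          (monicRec b c m).eval (firstHalf α j) * (monicRec b c (m + 1)).eval (secondHalf α k)) /
          (firstHalf α j - secondHalf α k)).det) := by
  have hlow : ∀ i : Fin n, m - (i.rev : ℕ) = N + i := fun i => by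
    have := i.isLt
    rw [Fin.val_rev]
    omega
  choose A B hA hB hAB using fun i : Fin n => exists_monicRec_add b c m i
  choose A' B' hA' hB' hAB' using fun i : Fin n => exists_monicRec_sub b c hc (i.rev : ℕ) (by
    have := i.isLt
    rw [Fin.val_rev]
    omega)
  -- The first block is indexed by the multiples of p_m, the second by those of p_{m+1}, and `s` is
  -- the exponent of X in the multiplier. The row p_{N+i} = p_{m - rev i} has leading exponent `rev
  -- i`, and all other coefficients have smaller exponents, so the transition matrix is triangular
  -- for `s`.
  set s : Fin n ⊕ Fin n → ℕ := Sum.elim (fun i => (i.rev : ℕ)) fun i => (i : ℕ) with hs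
  set d : Fin n ⊕ Fin n → ℂ :=
    Sum.elim (fun i => ∏ t ∈ Finset.range (i.rev : ℕ), (c (m - t))⁻¹) fun _ => 1 with hd
  set u : Matrix (Fin n ⊕ Fin n) (Fin n ⊕ Fin n) ℂ := Matrix.fromBlocks
    (Matrix.of fun i j => (B' i).coeff (j.rev : ℕ)) (Matrix.of fun i j => (A' i).coeff j)
    (Matrix.of fun i j => (B i).coeff (j.rev : ℕ)) (Matrix.of fun i j => (A i).coeff j) with hu
  set f : ℂ → ℂ := fun x => (monicRec b c (m + 1)).eval x with hf
  set g : ℂ → ℂ := fun x => (monicRec b c m).eval x with hg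
  have hrev : ∀ (p : ℂ[X]) (k : ℕ), p.degree < (k : WithBot ℕ) → k ≤ n → ∀ x : ℂ,
      ∑ j : Fin n, p.coeff (j.rev : ℕ) * x ^ (j.rev : ℕ) = p.eval x := fun p k hp hk x => by
    rw [← sum_coeff_mul_pow hp hk x, ← Equiv.sum_comp Fin.revPerm]
    simp only [Fin.revPerm_apply, Fin.rev_rev]
  have hmul : (Matrix.of fun i k : Fin (n + n) => (monicRec b c (N + i)).eval (α k)).submatrix
      finSumFinEquiv finSumFinEquiv = (Matrix.diagonal d + u) *
      Matrix.fromBlocks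
        (Matrix.of fun i j : Fin n => firstHalf α j ^ (i.rev : ℕ) * g (firstHalf α j))
        (Matrix.of fun i k : Fin n => secondHalf α k ^ (i.rev : ℕ) * g (secondHalf α k))
        (Matrix.of fun i j : Fin n => firstHalf α j ^ (i : ℕ) * f (firstHalf α j))
        (Matrix.of fun i k : Fin n => secondHalf α k ^ (i : ℕ) * f (secondHalf α k)) := by
    have key1 : ∀ (i : Fin n) (x : ℂ), (monicRec b c (N + i)).eval x =
        d (Sum.inl i) * (x ^ (i.rev : ℕ) * g x) +
        (∑ j : Fin n, (B' i).coeff (j.rev : ℕ) * (x ^ (j.rev : ℕ) * g x) +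
          ∑ j : Fin n, (A' i).coeff j * (x ^ (j : ℕ) * f x)) := fun i x => by
      simp only [← mul_assoc, ← Finset.sum_mul]
      rw [hrev _ _ (hB' i) i.rev.isLt.le, sum_coeff_mul_pow (hA' i) i.rev.isLt.le, ← hlow, hAB']
      simp only [eval_add, eval_mul, eval_C, eval_pow, eval_X, hd, hf, hg, Sum.elim_inl]
      ring
    have key2 : ∀ (i : Fin n) (x : ℂ), (monicRec b c (m + 1 + i)).eval x =
        d (Sum.inr i) * (x ^ (i : ℕ) * f x) +
        (∑ j : Fin n, (B i).coeff (j.rev : ℕ) * (x ^ (j.rev : ℕ) * g x) +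
          ∑ j : Fin n, (A i).coeff j * (x ^ (j : ℕ) * f x)) := fun i x => by
      simp only [← mul_assoc, ← Finset.sum_mul]
      rw [hrev _ _ (hB i) i.isLt.le, sum_coeff_mul_pow (hA i) i.isLt.le, hAB]
      simp only [eval_add, eval_mul, eval_pow, eval_X, hd, hf, hg, Sum.elim_inr]
      ring
    refine Matrix.ext fun x y => ?_
    rw [add_mul, Matrix.add_apply, Matrix.diagonal_mul, Matrix.mul_apply, Fintype.sum_sum_type]
    have e : ∀ i : Fin n, m + 1 + (i : ℕ) = N + i + n := fun i => by omega
    rcases x with i | i <;> rcases y with k | k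
    · simpa [firstHalf, hu] using key1 i (firstHalf α k)
    · simpa [secondHalf, hu] using key1 i (secondHalf α k)
    · simpa [firstHalf, hu, ← add_assoc, e] using key2 i (firstHalf α k)
    · simpa [secondHalf, hu, ← add_assoc, e] using key2 i (secondHalf α k)
  have hdet : (Matrix.diagonal d + u).det = ∏ x, d x := by
    refine det_diagonal_add_of_triangular s d u fun x y hxy => ?_
    rcases x with i | i <;> rcases y with j | j
    · exact coeff_eq_zero_of_degree_lt ((hB' i).trans_le (by exact_mod_cast hxy))
    · exact coeff_eq_zero_of_degree_lt ((hA' i).trans_le (by exact_mod_cast hxy))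
    · exact coeff_eq_zero_of_degree_lt ((hB i).trans_le (by exact_mod_cast hxy))
    · exact coeff_eq_zero_of_degree_lt ((hA i).trans_le (by exact_mod_cast hxy))
  rw [← Matrix.det_submatrix_equiv_self finSumFinEquiv, hmul, Matrix.det_mul, hdet,
    det_two_polynomials (fun i j h => by
      simpa using hα h) (fun j k h => by
      have := hα h
      simp [Fin.ext_iff] at this
      omega)]
  congr 1
  rw [Fintype.prod_sum_type]
  simp only [hd, Sum.elim_inl, Sum.elim_inr, Finset.prod_const_one, mul_one]
  rw [← Equiv.prod_comp Fin.revPerm]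
  simp only [Fin.revPerm_apply, Fin.rev_rev]
  exact Fin.prod_univ_eq_prod_range (fun s => ∏ t ∈ Finset.range s, (c (m - t))⁻¹) n

end MonicRecurrenceDet

/-! ### Integrals of determinants, column by column. -/

section ColumnIntegrals

variable {ι κ : Type*} [Fintype ι] [Fintype κ] [DecidableEq ι] [DecidableEq κ]

theorem integral_det_columns (μ : Measure ℝ) [SigmaFinite μ] (f : ι ⊕ κ → ι → ℝ → ℂ)
    (hf : ∀ r j, Integrable (f r j) μ) (A : ι ⊕ κ → κ → ℂ) :
    Integrable (fun x : ι → ℝ => (Matrix.of fun r c : ι ⊕ κ =>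
      Sum.elim (fun j => f r j (x j)) (A r) c).det) (Measure.pi fun _ => μ) ∧
    ∫ x : ι → ℝ, (Matrix.of fun r c : ι ⊕ κ => Sum.elim (fun j => f r j (x j)) (A r) c).det
      ∂(Measure.pi fun _ => μ) =
      (Matrix.of fun r c : ι ⊕ κ => Sum.elim (fun j => ∫ x, f r j x ∂μ) (A r) c).det := by
  simp only [Matrix.det_apply', Fintype.prod_sum_type, Matrix.of_apply, Sum.elim_inl, Sum.elim_inr]
  have hint : ∀ τ : Equiv.Perm (ι ⊕ κ), Integrable (fun x : ι → ℝ =>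
      ((Equiv.Perm.sign τ : ℤ) : ℂ) * ((∏ j, f (τ (Sum.inl j)) j (x j)) *
        ∏ k, A (τ (Sum.inr k)) k)) (Measure.pi fun _ => μ) := fun τ =>
    ((Integrable.fintype_prod (μ := fun _ : ι => μ) (f := fun j => f (τ (Sum.inl j)) j)
      fun j => hf _ _).mul_const _).const_mul _
  refine ⟨integrable_finsetSum _ fun τ _ => hint τ, ?_⟩
  rw [integral_finsetSum _ fun τ _ => hint τ]
  refine Finset.sum_congr rfl fun τ _ => ?_
  rw [integral_const_mul, integral_mul_const,
    integral_fintype_prod_eq_prod (fun j => f (τ (Sum.inl j)) j)]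

end ColumnIntegrals

/-! ### Averages against a product weight through orthogonal polynomials. -/

section OrthogonalPolynomials

open Polynomial

variable {N m : ℕ}

theorem integrable_eval_mul (μ : Measure ℝ) (w : ℝ → ℂ)
    (hw : ∀ k : ℕ, Integrable (fun x : ℝ => (x : ℂ) ^ k * w x) μ) (q : ℂ[X]) :
    Integrable (fun x : ℝ => q.eval (x : ℂ) * w x) μ := by
  induction q using Polynomial.induction_on' with
  | add p q hp hq =>
    refine (hp.add hq).congr (ae_of_all _ fun x => ?_)
    simp [add_mul]
  | monomial n a =>
    refine ((hw n).const_mul a).congr (ae_of_all _ fun x => ?_)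
    simp [mul_assoc]

/-- The average of `h_N(x)^2 ∏ (α_k - x_j)` against a product weight, in terms of the orthogonal
polynomials of the weight. -/
theorem integral_det_mul_det (μ : Measure ℝ) [SigmaFinite μ] (w : ℝ → ℂ)
    (hw : ∀ k : ℕ, Integrable (fun x : ℝ => (x : ℂ) ^ k * w x) μ) (p : ℕ → ℂ[X]) (h : ℕ → ℂ)
    (horth : ∀ i j, ∫ x, (p i).eval (x : ℂ) * (p j).eval (x : ℂ) * w x ∂μ =
      if i = j then h i else 0) (α : Fin m → ℂ) :
    ∫ x : Fin N → ℝ, (Matrix.of fun i j : Fin N => (p i).eval (x j : ℂ)).det *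
      (Matrix.of fun r c : Fin N ⊕ Fin m => (p (finSumFinEquiv r)).eval
        (Sum.elim (fun j => (x j : ℂ)) α c)).det * ∏ j, w (x j) ∂(Measure.pi fun _ => μ) =
      N ! * ((∏ i : Fin N, h i) * (Matrix.of fun i k : Fin m => (p (N + i)).eval (α k)).det) := by
  have hint : ∀ (τ : Equiv.Perm (Fin N)) (r : Fin N ⊕ Fin m) (j : Fin N),
      Integrable (fun x : ℝ => (p (finSumFinEquiv r)).eval (x : ℂ) *
        (p (τ j)).eval (x : ℂ) * w x) μ := fun τ r j => by
    simpa using integrable_eval_mul μ w hw (p (finSumFinEquiv r) * p (τ j))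
  -- Only the smaller determinant is expanded. Each of its terms, with the weight, is absorbed into
  -- the columns of the larger determinant, which then depend on one variable each.
  have hexp : ∀ x : Fin N → ℝ, (Matrix.of fun i j : Fin N => (p i).eval (x j : ℂ)).det *
      (Matrix.of fun r c : Fin N ⊕ Fin m => (p (finSumFinEquiv r)).eval
        (Sum.elim (fun j => (x j : ℂ)) α c)).det * ∏ j, w (x j) =
      ∑ τ : Equiv.Perm (Fin N), ((Equiv.Perm.sign τ : ℤ) : ℂ) *
        (Matrix.of fun r c : Fin N ⊕ Fin m => Sum.elim (fun j =>
          (p (finSumFinEquiv r)).eval (x j : ℂ) * (p (τ j)).eval (x j : ℂ) * w (x j))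
          (fun k => (p (finSumFinEquiv r)).eval (α k)) c).det := fun x => by
    rw [Matrix.det_apply' (Matrix.of fun i j : Fin N => (p i).eval (x j : ℂ)), Finset.sum_mul,
      Finset.sum_mul]
    refine Finset.sum_congr rfl fun τ _ => ?_
    have h1 : (Matrix.of fun r c : Fin N ⊕ Fin m => Sum.elim (fun j =>
          (p (finSumFinEquiv r)).eval (x j : ℂ) * (p (τ j)).eval (x j : ℂ) * w (x j))
          (fun k => (p (finSumFinEquiv r)).eval (α k)) c) =
        Matrix.of fun r c : Fin N ⊕ Fin m =>
          Sum.elim (fun j => (p (τ j)).eval (x j : ℂ) * w (x j)) (fun _ => 1) c *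
          (Matrix.of fun r c : Fin N ⊕ Fin m => (p (finSumFinEquiv r)).eval
            (Sum.elim (fun j => (x j : ℂ)) α c)) r c := by
      refine Matrix.ext fun r c => ?_
      rcases c with c | c
      · simp
        ring
      · simp
    rw [h1, Matrix.det_mul_row, Fintype.prod_sum_type]
    simp only [Sum.elim_inl, Sum.elim_inr, Finset.prod_const_one, mul_one, Finset.prod_mul_distrib,
      Matrix.of_apply]
    ring
  simp only [hexp]
  rw [integral_finsetSum _ fun τ _ =>
    (integral_det_columns μ _ (hint τ) _).1.const_mul _]
  have hterm : ∀ τ : Equiv.Perm (Fin N), ∫ x : Fin N → ℝ, ((Equiv.Perm.sign τ : ℤ) : ℂ) *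
        (Matrix.of fun r c : Fin N ⊕ Fin m => Sum.elim (fun j =>
          (p (finSumFinEquiv r)).eval (x j : ℂ) * (p (τ j)).eval (x j : ℂ) * w (x j))
          (fun k => (p (finSumFinEquiv r)).eval (α k)) c).det ∂(Measure.pi fun _ => μ) =
      (∏ i : Fin N, h i) * (Matrix.of fun i k : Fin m => (p (N + i)).eval (α k)).det := fun τ => by
    rw [integral_const_mul, (integral_det_columns μ _ (hint τ) _).2]
    -- By orthogonality the integrated columns form a permuted diagonal block above a zero block,
    -- the rows below having index at least `N`. The sign of the permutation cancels that of the
    -- expansion, so all N! terms agree.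
    have h1 : (Matrix.of fun r c : Fin N ⊕ Fin m => Sum.elim (fun j =>
        ∫ x, (p (finSumFinEquiv r)).eval (x : ℂ) * (p (τ j)).eval (x : ℂ) * w x ∂μ)
          (fun k => (p (finSumFinEquiv r)).eval (α k)) c) =
        Matrix.fromBlocks ((Matrix.diagonal fun i : Fin N => h i).submatrix id τ)
          (Matrix.of fun (i : Fin N) (k : Fin m) => (p i).eval (α k)) 0
          (Matrix.of fun i k : Fin m => (p (N + i)).eval (α k)) := by
      refine Matrix.ext fun r c => ?_
      rcases r with r | r <;> rcases c with c | c
      · simp only [Matrix.of_apply, Sum.elim_inl, horth, Matrix.fromBlocks_apply₁₁,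
          Matrix.submatrix_apply, Matrix.diagonal_apply, id_eq, finSumFinEquiv_apply_left,
          Fin.val_castAdd, Fin.ext_iff]
        by_cases hr : (r : ℕ) = τ c
        · exact (if_pos hr).trans (if_pos hr).symm
        · exact (if_neg hr).trans (if_neg hr).symm
      · simp
      · have : (N + r : ℕ) ≠ τ c := by
          have := (τ c).isLt
          omega
        simp only [Matrix.of_apply, Sum.elim_inl, horth, Matrix.fromBlocks_apply₂₁,
          finSumFinEquiv_apply_right, Fin.val_natAdd, Matrix.zero_apply]
        exact if_neg this
      · simp
    rw [h1, Matrix.det_fromBlocks_zero₂₁, Matrix.det_permute', Matrix.det_diagonal]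
    have h2 : ((Equiv.Perm.sign τ : ℤ) : ℂ) * ((Equiv.Perm.sign τ : ℤ) : ℂ) = 1 := by
      rw [← Int.cast_mul, ← Units.val_mul, Int.units_mul_self]
      simp
    linear_combination ((∏ i : Fin N, h i) *
      (Matrix.of fun i k : Fin m => (p (N + i)).eval (α k)).det) * h2
  rw [Finset.sum_congr rfl fun τ _ => hterm τ, Finset.sum_const, Finset.card_univ,
    Fintype.card_perm, Fintype.card_fin, nsmul_eq_mul]

theorem diffProd_eq_det_eval {M : ℕ} (p : ℕ → ℂ[X]) (hmonic : ∀ i, (p i).Monic)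
    (hdeg : ∀ i, (p i).natDegree = i) (y : Fin M → ℂ) :
    (Matrix.of fun i k : Fin M => (p i).eval (y k)).det = diffProd y := by
  rw [← Matrix.det_transpose]
  have h := Matrix.det_eval_matrixOfPolynomials_eq_det_vandermonde y (fun i => p i)
    (fun i => hdeg i) (fun i => hmonic i)
  have h2 : (Matrix.of fun i k : Fin M => (p i).eval (y k))ᵀ =
      Matrix.of fun i j : Fin M => ((fun i : Fin M => p i) j).eval (y i) := by
    refine Matrix.ext fun i j => ?_
    simp
  rw [h2, ← h, Matrix.det_vandermonde]
  rfl

theorem diffProd_add {R : Type*} [CommRing R] (y : Fin (N + m) → R) :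
    diffProd y = diffProd (fun j : Fin N => y (Fin.castAdd m j)) *
      diffProd (fun k : Fin m => y (Fin.natAdd N k)) *
      ∏ j : Fin N, ∏ k : Fin m, (y (Fin.natAdd N k) - y (Fin.castAdd m j)) := by
  have h : ∀ {M : ℕ} (z : Fin M → R), diffProd z = ∏ i, ∏ j, if i < j then z j - z i else 1 :=
    fun z => by
      refine Finset.prod_congr rfl fun i _ => ?_
      rw [← Finset.prod_filter]
      refine Finset.prod_congr ?_ fun _ _ => rfl
      ext j
      simp
  rw [h, h, h, Fin.prod_univ_add]
  simp only [Fin.prod_univ_add]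
  have h1 : ∀ (k : Fin m) (j : Fin N), ¬ Fin.natAdd N k < Fin.castAdd m j := fun k j hlt => by
    have := Fin.lt_def.1 hlt
    simp at this
    omega
  have h2 : ∀ (k : Fin m) (j : Fin N), Fin.castAdd m j < Fin.natAdd N k := fun k j => by
    rw [Fin.lt_def]
    simp
    omega
  have h3 : ∀ i j : Fin N, Fin.castAdd m i < Fin.castAdd m j ↔ i < j := fun _ _ => Iff.rfl
  simp only [h1, h2, h3, if_true, if_false, Finset.prod_const_one, one_mul, Finset.prod_mul_distrib,
    Fin.natAdd_lt_natAdd_iff]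
  ring

end OrthogonalPolynomials

/-! ### Orthogonality of the Laguerre polynomials from the moment recursion. -/

section LaguerreOrthogonality

open Polynomial

/-- The functional `q ↦ ∫ q w dμ` on polynomials. -/
noncomputable def weightFunctional (μ : Measure ℝ) (w : ℝ → ℂ)
    (hw : ∀ k : ℕ, Integrable (fun x : ℝ => (x : ℂ) ^ k * w x) μ) : ℂ[X] →ₗ[ℂ] ℂ where
  toFun q := ∫ x, q.eval (x : ℂ) * w x ∂μ
  map_add' p q := by
    simp only [eval_add, add_mul]
    exact integral_add (integrable_eval_mul μ w hw p) (integrable_eval_mul μ w hw q)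
  map_smul' c q := by
    simp only [eval_smul, smul_eq_mul, mul_assoc, integral_const_mul, RingHom.id_apply]

variable {ν s : ℂ} {L : ℂ[X] →ₗ[ℂ] ℂ}

theorem cast_descFactorial_succ (k i : ℕ) :
    (k.descFactorial (i + 1) : ℂ) = ((k : ℂ) - i) * k.descFactorial i := by
  rcases lt_or_ge k i with h | h
  · rw [Nat.descFactorial_of_lt h, Nat.descFactorial_of_lt (h.trans i.lt_succ_self)]
    simp
  · rw [Nat.descFactorial_succ]
    push_cast [Nat.cast_sub h]
    ring

/-- The falling factorial vanishes for `k < i` and is i! for `k = i`, so this one formula yields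
both orthogonality and norms. -/
theorem laguerreMonic_functional_mul_X_pow (hL : ∀ k : ℕ, L (X ^ (k + 1)) =
    s * (k + 1 + ν) * L (X ^ k)) (i k : ℕ) :
    L (laguerreMonic ν s i * X ^ k) = s ^ i * k.descFactorial i * L (X ^ k) := by
  have hC : ∀ (a : ℂ) (q : ℂ[X]), L (C a * q) = a * L q := fun a q => by
    rw [C_mul', map_smul, smul_eq_mul]
  induction i using Nat.twoStepInduction generalizing k with
  | zero => simp [laguerreMonic, monicRec_zero]
  | one =>
    rw [laguerreMonic, monicRec_one, sub_mul, ← pow_succ', map_sub, hC, hL]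
    simp
    ring
  | more i h0 h1 =>
    have h : laguerreMonic ν s (i + 2) * X ^ k = laguerreMonic ν s (i + 1) * X ^ (k + 1) -
        C (s * (2 * i + ν + 3)) * (laguerreMonic ν s (i + 1) * X ^ k) -
        C (s ^ 2 * ((i + 1) * (i + 1 + ν))) * (laguerreMonic ν s i * X ^ k) := by
      rw [laguerreMonic_add_two]
      ring
    rw [h, map_sub, map_sub, hC, hC, h1, h1, h0, hL, cast_descFactorial_succ k (i + 1),
      cast_descFactorial_succ k i, Nat.succ_descFactorial_succ]
    push_cast
    ring

theorem laguerreMonic_orthogonal (hL : ∀ k : ℕ, L (X ^ (k + 1)) = s * (k + 1 + ν) * L (X ^ k))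
    (i j : ℕ) : L (laguerreMonic ν s i * laguerreMonic ν s j) =
      if i = j then s ^ i * i ! * L (X ^ i) else 0 := by
  have key : ∀ i j : ℕ, j ≤ i → L (laguerreMonic ν s i * laguerreMonic ν s j) =
      if i = j then s ^ i * i ! * L (X ^ i) else 0 := fun i j hji => by
    have hdeg : (laguerreMonic ν s j).natDegree = j := natDegree_monicRec _ _ j
    have hlead : (laguerreMonic ν s j).coeff j = 1 := by
      have h := monicRec_monic (fun j => s * (2 * j + ν + 1)) (fun j => s ^ 2 * (j * (j + ν))) j
      rw [Monic, leadingCoeff] at h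
      rw [← h, ← laguerreMonic, hdeg]
    conv_lhs => rw [(laguerreMonic ν s j).as_sum_range_C_mul_X_pow, hdeg]
    rw [Finset.mul_sum, map_sum]
    have hterm : ∀ k, L (laguerreMonic ν s i * (C ((laguerreMonic ν s j).coeff k) * X ^ k)) =
        (laguerreMonic ν s j).coeff k * (s ^ i * k.descFactorial i * L (X ^ k)) := fun k => by
      rw [mul_left_comm, C_mul', map_smul, smul_eq_mul, laguerreMonic_functional_mul_X_pow hL]
    simp only [hterm]
    rw [Finset.sum_range_succ, Finset.sum_eq_zero, zero_add, hlead, one_mul]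
    · split_ifs with h
      · rw [← h, Nat.descFactorial_self]
      · rw [Nat.descFactorial_of_lt (lt_of_le_of_ne hji (Ne.symm h))]
        simp
    · intro k hk
      rw [Nat.descFactorial_of_lt (lt_of_lt_of_le (Finset.mem_range.1 hk) hji)]
      simp
  rcases le_total j i with h | h
  · exact key i j h
  · rw [mul_comm, key j i h]
    by_cases hij : i = j
    · rw [hij]
    · rw [if_neg hij, if_neg (Ne.symm hij)]

end LaguerreOrthogonality

/-! ### Moments of the Laguerre weight. -/

section LaguerreMoments

theorem integrableOn_laguerreMoment {ν s : ℝ} (hν : -1 < ν) (hs : 0 < s) (k : ℕ) :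
    IntegrableOn (fun x : ℝ => x ^ k * (x ^ ν * Real.exp (-x / s))) (Set.Ici 0) ∧
    ∫ x in Set.Ici (0 : ℝ), x ^ k * (x ^ ν * Real.exp (-x / s)) =
      s ^ k * (s ^ (ν + 1) * Real.Gamma (k + ν + 1)) := by
  have hk : (0 : ℝ) ≤ k := k.cast_nonneg
  have ha : 0 < k + ν + 1 := by linarith
  have hr : 0 < 1 / s := by positivity
  have hval := Real.integral_rpow_mul_exp_neg_mul_Ioi ha hr
  have hpos : (1 / (1 / s)) ^ (k + ν + 1) * Real.Gamma (k + ν + 1) ≠ 0 := by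
    have := Real.Gamma_pos_of_pos ha
    positivity
  -- Integrability is inferred from the nonzero value: the integral of a non-integrable function is
  -- zero by convention.
  have hint : IntegrableOn (fun t : ℝ => t ^ (k + ν + 1 - 1) * Real.exp (-(1 / s * t)))
      (Set.Ioi 0) := .of_integral_ne_zero (by rw [hval]; exact hpos)
  have hcongr : Set.EqOn (fun t : ℝ => t ^ (k + ν + 1 - 1) * Real.exp (-(1 / s * t)))
      (fun x : ℝ => x ^ k * (x ^ ν * Real.exp (-x / s))) (Set.Ioi 0) := fun t ht => by
    simp only
    rw [show (k : ℝ) + ν + 1 - 1 = k + ν by ring, Real.rpow_add ht, Real.rpow_natCast, mul_assoc]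
    congr 3
    field_simp
  rw [integrableOn_Ici_iff_integrableOn_Ioi, integral_Ici_eq_integral_Ioi]
  refine ⟨hint.congr_fun hcongr measurableSet_Ioi, ?_⟩
  rw [← setIntegral_congr_fun measurableSet_Ioi hcongr, hval, one_div_one_div, add_assoc,
    Real.rpow_add hs, Real.rpow_natCast, mul_assoc]

/-- The Laguerre weight. -/
noncomputable def laguerreWeight (ν s : ℝ) (x : ℝ) : ℂ := ((x ^ ν * Real.exp (-x / s) : ℝ) : ℂ)

theorem integrable_pow_mul_laguerreWeight {ν s : ℝ} (hν : -1 < ν) (hs : 0 < s) (k : ℕ) :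
    Integrable (fun x : ℝ => (x : ℂ) ^ k * laguerreWeight ν s x)
      (volume.restrict (Set.Ici (0 : ℝ))) := by
  simpa [laguerreWeight] using (integrableOn_laguerreMoment hν hs k).1.ofReal (𝕜 := ℂ)

theorem integral_pow_mul_laguerreWeight {ν s : ℝ} (hν : -1 < ν) (hs : 0 < s) (k : ℕ) :
    ∫ x in Set.Ici (0 : ℝ), (x : ℂ) ^ k * laguerreWeight ν s x =
      ((s ^ k * (s ^ (ν + 1) * Real.Gamma (k + ν + 1)) : ℝ) : ℂ) := by
  rw [← (integrableOn_laguerreMoment hν hs k).2, ← integral_complex_ofReal]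
  simp [laguerreWeight]

open Polynomial in
theorem laguerreWeight_orthogonal {ν s : ℝ} (hν : -1 < ν) (hs : 0 < s) (i j : ℕ) :
    ∫ x in Set.Ici (0 : ℝ), (laguerreMonic ν s i).eval (x : ℂ) *
      (laguerreMonic ν s j).eval (x : ℂ) * laguerreWeight ν s x =
      if i = j then
        ((s ^ i * i ! * (s ^ i * (s ^ (ν + 1) * Real.Gamma (i + ν + 1))) : ℝ) : ℂ) else 0 := by
  have hval : ∀ k : ℕ, weightFunctional _ _ (integrable_pow_mul_laguerreWeight hν hs) (X ^ k) =
      ((s ^ k * (s ^ (ν + 1) * Real.Gamma (k + ν + 1)) : ℝ) : ℂ) := fun k => by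
    rw [← integral_pow_mul_laguerreWeight hν hs]
    simp [weightFunctional]
  have h := laguerreMonic_orthogonal (ν := ν) (s := s)
    (L := weightFunctional _ _ (integrable_pow_mul_laguerreWeight hν hs)) (fun k => by
      have hk : (0 : ℝ) ≤ k := k.cast_nonneg
      have h1 := Real.Gamma_add_one (s := k + ν + 1) (by linarith)
      rw [hval, hval]
      push_cast
      rw [show (k : ℝ) + 1 + ν + 1 = k + ν + 1 + 1 by ring, h1]
      push_cast
      ring) i j
  rw [hval] at h
  simp only [weightFunctional, LinearMap.coe_mk, AddHom.coe_mk, eval_mul] at h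
  rw [h]
  push_cast
  rfl

end LaguerreMoments

/-! ### The average over the Laguerre-type ensemble. -/

section LaguerreAverage

variable {m : ℕ}

/-- The normalization of the Laguerre-type ensemble. -/
noncomputable def laguerreNorm (ν : ℝ) (N : ℕ) (σ : ℝ) : ℝ :=
  σ ^ (-(2 * (N : ℝ) * (N + ν))) / ((2 : ℝ) ^ ((N : ℝ) * (N + ν)) *
    ∏ j ∈ Finset.Icc 1 N, Real.Gamma j * Real.Gamma (j + ν))

/-- The factors of the product are the squared norms of the monic Laguerre polynomials, so the
density is correctly normalized. -/
theorem laguerreNorm_mul_prod {ν σ : ℝ} (hν : -1 < ν) (hσ : 0 < σ) (N : ℕ) :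
    laguerreNorm ν N σ * ∏ i : Fin N, ((2 * σ ^ 2) ^ (i : ℕ) * (i : ℕ)! * ((2 * σ ^ 2) ^ (i : ℕ) *
      ((2 * σ ^ 2) ^ (ν + 1) * Real.Gamma ((i : ℕ) + ν + 1)))) = 1 := by
  have hs : 0 < 2 * σ ^ 2 := by positivity
  have h1 : ∏ j ∈ Finset.Icc 1 N, Real.Gamma j * Real.Gamma (j + ν) =
      ∏ i ∈ Finset.range N, (i ! * Real.Gamma (i + ν + 1)) := by
    rw [← Finset.Ico_add_one_right_eq_Icc, Finset.prod_Ico_eq_prod_range]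
    refine Finset.prod_congr (by simp) fun i _ => ?_
    rw [← Real.Gamma_nat_eq_factorial]
    push_cast
    ring_nf
  have h2 : ∏ i ∈ Finset.range N, ((2 * σ ^ 2) ^ i * i ! * ((2 * σ ^ 2) ^ i *
      ((2 * σ ^ 2) ^ (ν + 1) * Real.Gamma (i + ν + 1)))) =
      (2 * σ ^ 2) ^ ((N : ℝ) * (N + ν)) * ∏ i ∈ Finset.range N, (i ! * Real.Gamma (i + ν + 1)) := by
    clear h1
    induction N with
    | zero => simp
    | succ N ih =>
      have h : (2 * σ ^ 2) ^ (((N + 1 : ℕ) : ℝ) * ((N + 1 : ℕ) + ν)) =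
          (2 * σ ^ 2) ^ ((N : ℝ) * (N + ν)) * (2 * σ ^ 2) ^ N * (2 * σ ^ 2) ^ N *
            (2 * σ ^ 2) ^ (ν + 1) := by
        rw [← Real.rpow_natCast _ N, ← Real.rpow_add hs, ← Real.rpow_add hs, ← Real.rpow_add hs]
        push_cast
        ring_nf
      rw [Finset.prod_range_succ, Finset.prod_range_succ, ih, h]
      ring
  have h3 : (2 * σ ^ 2) ^ ((N : ℝ) * (N + ν)) =
      (2 : ℝ) ^ ((N : ℝ) * (N + ν)) * σ ^ (2 * (N : ℝ) * (N + ν)) := by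
    rw [Real.mul_rpow (by norm_num) (by positivity), ← Real.rpow_natCast, ← Real.rpow_mul hσ.le]
    push_cast
    ring_nf
  have h4 : ∏ i ∈ Finset.range N, (i ! * Real.Gamma (i + ν + 1)) ≠ 0 :=
    Finset.prod_ne_zero_iff.2 fun i _ => mul_ne_zero (by exact_mod_cast i.factorial_ne_zero)
      (Real.Gamma_pos_of_pos (by
        have : (0 : ℝ) ≤ i := i.cast_nonneg
        linarith)).ne'
  rw [Fin.prod_univ_eq_prod_range (fun i => (2 * σ ^ 2) ^ i * (i ! : ℝ) * ((2 * σ ^ 2) ^ i *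
      ((2 * σ ^ 2) ^ (ν + 1) * Real.Gamma (i + ν + 1)))) N, h2, laguerreNorm, h1, h3,
    Real.rpow_neg hσ.le]
  have h5 : (2 : ℝ) ^ ((N : ℝ) * (N + ν)) ≠ 0 := by positivity
  have h6 : σ ^ (2 * (N : ℝ) * (N + ν)) ≠ 0 := by positivity
  field_simp

theorem restrict_nonneg_eq_pi (N : ℕ) :
    (volume : Measure (Fin N → ℝ)).restrict {x | ∀ j, 0 ≤ x j} =
      Measure.pi fun _ => volume.restrict (Set.Ici (0 : ℝ)) := by
  have : {x : Fin N → ℝ | ∀ j, 0 ≤ x j} = Set.univ.pi fun _ => Set.Ici (0 : ℝ) := by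
    ext x
    simp only [Set.mem_ofPred_eq, Set.mem_univ_pi, Set.mem_Ici]
  rw [this, volume_pi, Measure.restrict_pi_pi]

open MvPolynomial in
/-- `∏_k ∏_j (α_k - x_j) h_N(x)^2` as a polynomial. -/
noncomputable def laguerrePoly (m N : ℕ) : MvPolynomial (Fin m ⊕ Fin N) ℂ :=
  (∏ k, ∏ j, (X (Sum.inl k) - X (Sum.inr j))) * diffProd (fun j => X (Sum.inr j)) ^ 2

theorem eval_laguerrePoly (N : ℕ) (α : Fin m → ℂ) (x : Fin N → ℂ) :
    MvPolynomial.eval (Sum.elim α x) (laguerrePoly m N) =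
      (∏ k, ∏ j, (α k - x j)) * diffProd x ^ 2 := by
  simp [laguerrePoly, map_prod, map_diffProd]

theorem laguerreIntegrand_eq (ν : ℝ) (N : ℕ) (σ : ℝ) (α : Fin m → ℂ) (x : Fin N → ℝ) :
    laguerreIntegrand ν N σ α x = (laguerreNorm ν N σ : ℂ) *
      (MvPolynomial.eval (Sum.elim α fun j => (x j : ℂ)) (laguerrePoly m N) *
        ∏ j, laguerreWeight ν (2 * σ ^ 2) (x j)) := by
  rw [laguerreIntegrand, laguerreDensity, ← laguerreNorm, eval_laguerrePoly]
  have h : ((diffProd x : ℝ) : ℂ) = diffProd fun j => (x j : ℂ) := map_diffProd Complex.ofRealHom x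
  rw [Complex.ofReal_mul, Complex.ofReal_mul, Complex.ofReal_pow, h, Complex.ofReal_prod]
  simp only [laguerreWeight]
  ring

theorem integrableOn_laguerreIntegrand {ν σ : ℝ} (hν : -1 < ν) (hσ : 0 < σ) (N : ℕ)
    (α : Fin m → ℂ) :
    IntegrableOn (laguerreIntegrand ν N σ α) {x : Fin N → ℝ | ∀ j, 0 ≤ x j} := by
  have hs : 0 < 2 * σ ^ 2 := by positivity
  rw [IntegrableOn, restrict_nonneg_eq_pi]
  refine ((integrable_eval_mul_prod _ _ (integrable_pow_mul_laguerreWeight hν hs) α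
    (laguerrePoly m N)).const_mul (laguerreNorm ν N σ : ℂ)).congr (ae_of_all _ fun x => ?_)
  exact (laguerreIntegrand_eq ν N σ α x).symm

theorem continuous_avgLaguerre {ν σ : ℝ} (hν : -1 < ν) (hσ : 0 < σ) (N : ℕ) :
    Continuous (avgLaguerre (m := m) ν N σ) := by
  have hs : 0 < 2 * σ ^ 2 := by positivity
  have h : avgLaguerre (m := m) ν N σ = fun α => 1 / (N ! : ℂ) * ((laguerreNorm ν N σ : ℂ) *
      MvPolynomial.eval α (partialExp (Fin m)
        (fun k => ∫ x in Set.Ici (0 : ℝ), (x : ℂ) ^ k * laguerreWeight ν (2 * σ ^ 2) x)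
        (laguerrePoly m N))) := by
    funext α
    rw [eval_partialExp _ _ (integrable_pow_mul_laguerreWeight hν hs), avgLaguerre,
      restrict_nonneg_eq_pi]
    simp only [laguerreIntegrand_eq, integral_const_mul]
  rw [h]
  have := fun f : MvPolynomial (Fin m) ℂ => MvPolynomial.continuous_eval f
  fun_prop

theorem diffProd_mul_avgLaguerre {ν σ : ℝ} (hν : -1 < ν) (hσ : 0 < σ) (N : ℕ) (α : Fin m → ℂ) :
    diffProd α * avgLaguerre ν N σ α = (Matrix.of fun i k : Fin m =>
      (laguerreMonic ν ((2 * σ ^ 2 : ℝ) : ℂ) (N + i)).eval (α k)).det := by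
  have hs : 0 < 2 * σ ^ 2 := by positivity
  have hmonic : ∀ i, (laguerreMonic ν ((2 * σ ^ 2 : ℝ) : ℂ) i).Monic := monicRec_monic _ _
  have hdeg : ∀ i, (laguerreMonic ν ((2 * σ ^ 2 : ℝ) : ℂ) i).natDegree = i := natDegree_monicRec _ _
  have hmain := integral_det_mul_det (N := N) _ _ (integrable_pow_mul_laguerreWeight hν hs)
    (laguerreMonic ν ((2 * σ ^ 2 : ℝ) : ℂ))
    (fun i => (((2 * σ ^ 2) ^ i * i ! * ((2 * σ ^ 2) ^ i *
      ((2 * σ ^ 2) ^ (ν + 1) * Real.Gamma (i + ν + 1))) : ℝ) : ℂ))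
    (laguerreWeight_orthogonal hν hs) α
  -- The Vandermonde product of the joint family (x, α) absorbs h(α), the differences α_k - x_j and
  -- one factor h(x). Both it and the remaining h(x) are determinants of monic polynomials.
  have hint : ∀ x : Fin N → ℝ, diffProd α *
      (MvPolynomial.eval (Sum.elim α fun j => (x j : ℂ)) (laguerrePoly m N) *
        ∏ j, laguerreWeight ν (2 * σ ^ 2) (x j)) =
      (Matrix.of fun i j : Fin N =>
        (laguerreMonic ν ((2 * σ ^ 2 : ℝ) : ℂ) i).eval (x j : ℂ)).det *
      (Matrix.of fun r c : Fin N ⊕ Fin m =>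
        (laguerreMonic ν ((2 * σ ^ 2 : ℝ) : ℂ) (finSumFinEquiv r)).eval
          (Sum.elim (fun j => (x j : ℂ)) α c)).det *
      ∏ j, laguerreWeight ν (2 * σ ^ 2) (x j) := fun x => by
    have h1 := diffProd_eq_det_eval _ hmonic hdeg (Fin.append (fun j => (x j : ℂ)) α)
    rw [diffProd_add, ← Matrix.det_submatrix_equiv_self finSumFinEquiv] at h1
    simp only [Fin.append_left, Fin.append_right] at h1
    have h2 : (Matrix.of fun r c : Fin N ⊕ Fin m =>
        (laguerreMonic ν ((2 * σ ^ 2 : ℝ) : ℂ) (finSumFinEquiv r)).eval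
          (Sum.elim (fun j => (x j : ℂ)) α c)) =
        (Matrix.of fun i k : Fin (N + m) => (laguerreMonic ν ((2 * σ ^ 2 : ℝ) : ℂ) i).eval
          (Fin.append (fun j => (x j : ℂ)) α k)).submatrix finSumFinEquiv finSumFinEquiv := by
      refine Matrix.ext fun r c => ?_
      rcases c with c | c <;> simp
    rw [h2, h1, diffProd_eq_det_eval _ hmonic hdeg, eval_laguerrePoly, Finset.prod_comm]
    ring
  have hN : (N ! : ℂ) ≠ 0 := by exact_mod_cast N.factorial_ne_zero
  have hK := laguerreNorm_mul_prod hν hσ N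
  rw [← Complex.ofReal_inj, Complex.ofReal_mul, Complex.ofReal_prod, Complex.ofReal_one] at hK
  rw [avgLaguerre, restrict_nonneg_eq_pi]
  simp only [laguerreIntegrand_eq, integral_const_mul]
  rw [mul_left_comm, mul_left_comm (diffProd α), ← integral_const_mul]
  simp only [hint]
  rw [hmain, mul_left_comm, one_div, inv_mul_cancel_left₀ hN, ← mul_assoc, hK, one_mul]

end LaguerreAverage

/-! ### Evaluation of the constants. -/

section Constants

theorem prod_range_cast_sub {m s : ℕ} (hs : s ≤ m) :
    ∏ t ∈ Finset.range s, ((m - t : ℕ) : ℝ) = m ! / (m - s)! := by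
  induction s with
  | zero => simp [(Nat.factorial_pos m).ne']
  | succ s ih =>
    obtain ⟨d, rfl⟩ := Nat.exists_eq_add_of_le hs
    rw [Finset.prod_range_succ, ih (by omega), show s + 1 + d - s = d + 1 by omega,
      show s + 1 + d - (s + 1) = d by omega, Nat.factorial_succ d]
    have := Nat.cast_ne_zero (R := ℝ) |>.2 d.factorial_ne_zero
    push_cast
    have h2 : (d + 1 : ℝ) ≠ 0 := by positivity
    field_simp

theorem prod_range_cast_sub_add {m s : ℕ} {ν : ℝ} (hν : -1 < ν) (hs : s ≤ m) :
    ∏ t ∈ Finset.range s, (((m - t : ℕ) : ℝ) + ν) =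
      Real.Gamma (m + 1 + ν) / Real.Gamma ((m - s : ℕ) + 1 + ν) := by
  have hpos : ∀ d : ℕ, 0 < d + 1 + ν := fun d => by
    have : (0 : ℝ) ≤ d := d.cast_nonneg
    linarith
  induction s with
  | zero => simp [(Real.Gamma_pos_of_pos (hpos m)).ne']
  | succ s ih =>
    obtain ⟨d, rfl⟩ := Nat.exists_eq_add_of_le hs
    rw [Finset.prod_range_succ, ih (by omega), show s + 1 + d - s = d + 1 by omega,
      show s + 1 + d - (s + 1) = d by omega]
    have h := Real.Gamma_add_one (hpos d).ne'
    have h1 : ((d + 1 : ℕ) : ℝ) + 1 + ν = d + 1 + ν + 1 := by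
      push_cast
      ring
    have := (Real.Gamma_pos_of_pos (hpos d)).ne'
    have := (hpos d).ne'
    rw [h1, h]
    push_cast
    field_simp

theorem prod_range_sq_pow (x : ℝ) (n : ℕ) :
    x ^ n * ∏ s ∈ Finset.range n, (x ^ 2) ^ s = x ^ (n * n) := by
  induction n with
  | zero => simp
  | succ n ih =>
    rw [Finset.prod_range_succ]
    linear_combination x * (x ^ 2) ^ n * ih

theorem prod_range_factorial_reflect (N k : ℕ) (f : ℕ → ℝ) :
    ∏ s ∈ Finset.range (k + 1), f (N + k - s) = ∏ i ∈ Finset.range (k + 1), f (N + i) := by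
  rw [← Finset.prod_range_reflect]
  refine Finset.prod_congr rfl fun i hi => ?_
  have := Finset.mem_range.1 hi
  congr 1
  omega

/-- On the left are the diagonal of the transition matrix for c_j = j σ² and the factors between
monic and standard polynomials of the middle pair. Writing n = k + 1 makes the lower index of that
pair N + k, without truncated subtraction. -/
theorem hermite_constant {σ : ℝ} (hσ : 0 < σ) (N k : ℕ) :
    (∏ s ∈ Finset.range (k + 1), ∏ t ∈ Finset.range s, (((N + k - t : ℕ) : ℝ) * σ ^ 2)⁻¹) *
      ((σ / √2) ^ (N + k + 1) * (σ / √2) ^ (N + k)) ^ (k + 1) =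
    gammaHermite N (k + 1) * σ ^ ((k + 1) * (2 * N + (k + 1))) := by
  have h1 : ∏ s ∈ Finset.range (k + 1), ∏ t ∈ Finset.range s, (((N + k - t : ℕ) : ℝ) * σ ^ 2)⁻¹ =
      (∏ s ∈ Finset.range (k + 1), (((N + k - s)! : ℝ) / (N + k)!)) *
        (∏ s ∈ Finset.range (k + 1), (σ ^ 2) ^ s)⁻¹ := by
    rw [← Finset.prod_inv_distrib, ← Finset.prod_mul_distrib]
    refine Finset.prod_congr rfl fun s hs => ?_
    rw [Finset.prod_inv_distrib, Finset.prod_mul_distrib, prod_range_cast_sub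
      (by have := Finset.mem_range.1 hs; omega), Finset.prod_const, Finset.card_range, mul_inv,
      inv_div]
  have h2 : ∏ l ∈ Finset.Icc 2 (k + 1), (((N + (k + 1) - l)! : ℝ) / ((N + (k + 1) - 1)! : ℝ)) =
      ∏ s ∈ Finset.range (k + 1), (((N + k - s)! : ℝ) / (N + k)!) := by
    -- The product starting at `l = 2` lacks the term `s = 0`, which equals 1.
    rw [← Finset.Ico_add_one_right_eq_Icc, Finset.prod_Ico_eq_prod_range, Finset.prod_range_succ']
    have : ((N + k - 0)! : ℝ) / (N + k)! = 1 := div_self (by positivity)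
    rw [this, mul_one]
    refine Finset.prod_congr (by simp) fun i _ => ?_
    congr 3
    omega
  have h3 : (2 : ℝ) ^ (-(((k + 1 : ℕ) : ℝ) * (2 * N + 2 * (k + 1 : ℕ) - 1)) / 2) =
      (√2 ^ ((2 * (N + k) + 1) * (k + 1)))⁻¹ := by
    rw [Real.sqrt_eq_rpow, ← Real.rpow_natCast, ← Real.rpow_mul (by norm_num),
      ← Real.rpow_neg (by norm_num)]
    congr 1
    push_cast
    ring
  have h5 : σ ^ (k + 1) * σ ^ (2 * (N + k) * (k + 1)) = σ ^ ((k + 1) * (2 * N + (k + 1))) *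
      ∏ s ∈ Finset.range (k + 1), (σ ^ 2) ^ s := by
    refine mul_left_cancel₀ (pow_ne_zero (k + 1) hσ.ne') ?_
    linear_combination -σ ^ ((k + 1) * (2 * N + (k + 1))) * prod_range_sq_pow σ (k + 1)
  have h6 : ∏ s ∈ Finset.range (k + 1), (σ ^ 2) ^ s ≠ 0 :=
    Finset.prod_ne_zero_iff.2 fun _ _ => by positivity
  have h7 : ((σ / √2) ^ (N + k + 1) * (σ / √2) ^ (N + k)) ^ (k + 1) =
      σ ^ (k + 1) * σ ^ (2 * (N + k) * (k + 1)) * (√2 ^ ((2 * (N + k) + 1) * (k + 1)))⁻¹ := by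
    rw [← pow_add, ← pow_mul, div_pow, div_eq_mul_inv, ← pow_add]
    congr 2 <;> ring_nf
  rw [h1, gammaHermite, h2, h3, h7, h5]
  field_simp

theorem laguerre_constant {ν s : ℝ} (hν : -1 < ν) (hs : 0 < s) (N k : ℕ) :
    (∏ r ∈ Finset.range (k + 1), ∏ t ∈ Finset.range r,
      (s ^ 2 * (((N + k - t : ℕ) : ℝ) * ((N + k - t : ℕ) + ν)))⁻¹) *
      (((-1) ^ (N + k + 1) * (N + k + 1)! * s ^ (N + k + 1)) *
        ((-1) ^ (N + k) * (N + k)! * s ^ (N + k))) ^ (k + 1) =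
    gammaLaguerre ν N (k + 1) * s ^ ((k + 1) * (2 * N + (k + 1))) := by
  have hpos : ∀ d : ℕ, 0 < d + 1 + ν := fun d => by
    have : (0 : ℝ) ≤ d := d.cast_nonneg
    linarith
  have hΓ : ∀ d : ℕ, Real.Gamma (d + 1 + ν) ≠ 0 := fun d => (Real.Gamma_pos_of_pos (hpos d)).ne'
  have h1 : ∏ r ∈ Finset.range (k + 1), ∏ t ∈ Finset.range r,
      (s ^ 2 * (((N + k - t : ℕ) : ℝ) * ((N + k - t : ℕ) + ν)))⁻¹ =
      (∏ r ∈ Finset.range (k + 1), ((N + k - r)! : ℝ)) / (N + k)! ^ (k + 1) *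
      ((∏ r ∈ Finset.range (k + 1), Real.Gamma ((N + k - r : ℕ) + 1 + ν)) /
        Real.Gamma ((N + k : ℕ) + 1 + ν) ^ (k + 1)) *
        (∏ r ∈ Finset.range (k + 1), (s ^ 2) ^ r)⁻¹ := by
    have hc : ∀ a : ℝ, a ^ (k + 1) = ∏ _r ∈ Finset.range (k + 1), a := fun a => by simp
    rw [hc, hc, ← Finset.prod_inv_distrib, ← Finset.prod_div_distrib, ← Finset.prod_div_distrib,
      ← Finset.prod_mul_distrib, ← Finset.prod_mul_distrib]
    refine Finset.prod_congr rfl fun r hr => ?_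
    have hr : r ≤ N + k := by have := Finset.mem_range.1 hr; omega
    rw [Finset.prod_inv_distrib, Finset.prod_mul_distrib, Finset.prod_mul_distrib,
      prod_range_cast_sub hr, prod_range_cast_sub_add hν hr, Finset.prod_const, Finset.card_range,
      mul_inv, mul_inv, inv_div, inv_div]
    ring
  have h2 : ∏ l ∈ Finset.Icc 1 (k + 1 - 1), Real.Gamma (N + ν + l) =
      (∏ r ∈ Finset.range (k + 1), Real.Gamma ((N + k - r : ℕ) + 1 + ν)) /
        Real.Gamma ((N + k : ℕ) + 1 + ν) := by
    rw [prod_range_factorial_reflect N k (fun j => Real.Gamma (j + 1 + ν)), Finset.prod_range_succ,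
      mul_div_cancel_right₀ _ (hΓ _), ← Finset.Ico_add_one_right_eq_Icc,
      Finset.prod_Ico_eq_prod_range]
    refine Finset.prod_congr (by simp) fun i _ => ?_
    congr 1
    push_cast
    ring
  have h3 : ∏ j ∈ Finset.Icc 1 (k + 1 + 1), ((N + j - 1)! : ℝ) =
      (∏ r ∈ Finset.range (k + 1), ((N + k - r)! : ℝ)) * (N + k + 1)! := by
    rw [prod_range_factorial_reflect N k (fun j => (j ! : ℝ)), ← Finset.Ico_add_one_right_eq_Icc,
      Finset.prod_Ico_eq_prod_range, show k + 1 + 1 + 1 - 1 = k + 1 + 1 by omega,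
      Finset.prod_range_succ]
    congr 1
    · refine Finset.prod_congr rfl fun i _ => ?_
      congr 2
      omega
    · congr 2
      omega
  have h5 : s ^ (k + 1) * s ^ (2 * (N + k) * (k + 1)) = s ^ ((k + 1) * (2 * N + (k + 1))) *
      ∏ r ∈ Finset.range (k + 1), (s ^ 2) ^ r := by
    refine mul_left_cancel₀ (pow_ne_zero (k + 1) hs.ne') ?_
    linear_combination -s ^ ((k + 1) * (2 * N + (k + 1))) * prod_range_sq_pow s (k + 1)
  have h6 : ∏ r ∈ Finset.range (k + 1), (s ^ 2) ^ r ≠ 0 :=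
    Finset.prod_ne_zero_iff.2 fun _ _ => by positivity
  have h7 : (((-1) ^ (N + k + 1) * (N + k + 1)! * s ^ (N + k + 1)) *
        ((-1) ^ (N + k) * (N + k)! * s ^ (N + k))) ^ (k + 1) =
      (-1) ^ (k + 1) * ((N + k + 1)! : ℝ) ^ (k + 1) * (N + k)! ^ (k + 1) *
        (s ^ (k + 1) * s ^ (2 * (N + k) * (k + 1))) := by
    -- The two middle polynomials have consecutive degrees, so each kernel contributes one factor
    -- -1.
    have h8 : ((-1 : ℝ) ^ (N + k + 1) * (-1) ^ (N + k)) = -1 := by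
      rw [← pow_add, show N + k + 1 + (N + k) = 2 * (N + k) + 1 by ring, pow_succ, pow_mul]
      simp
    calc _ = (((-1 : ℝ) ^ (N + k + 1) * (-1) ^ (N + k)) * (N + k + 1)! * (N + k)! *
          (s * s ^ (2 * (N + k)))) ^ (k + 1) := by ring
      _ = _ := by
        rw [h8, mul_pow, mul_pow, mul_pow, mul_pow, ← pow_mul]
  have h9 : ((N + k : ℕ) : ℝ) + 1 + ν = N + (k + 1 : ℕ) + ν := by
    push_cast
    ring
  have h10 := hΓ (N + k)
  have h11 : ((N + k)! : ℝ) ≠ 0 := by positivity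
  rw [h1, gammaLaguerre, h2, h3, h7, h5, ← h9, Nat.add_sub_cancel, ← add_assoc N k 1, div_pow]
  field_simp
  ring

end Constants

/-! ### From the determinant of consecutive polynomials to the kernel formula. -/

section Assembly

variable {N n : ℕ}

theorem diffProd_half_ne_zero {α : Fin (n + n) → ℂ} (hα : Function.Injective α) :
    diffProd (firstHalf α) ≠ 0 ∧ diffProd (secondHalf α) ≠ 0 ∧
      ∏ j, ∏ k, (secondHalf α k - firstHalf α j) ≠ 0 := by
  have h := diffProd_ne_zero hα
  rw [diffProd_add] at h
  exact ⟨(mul_ne_zero_iff.1 (mul_ne_zero_iff.1 h).1).1, (mul_ne_zero_iff.1 (mul_ne_zero_iff.1 h).1).2,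
    (mul_ne_zero_iff.1 h).2⟩

/-- The differences between the two halves of α occur both in the full Vandermonde product and in
`det_monicRec`, and cancel. The constants `u` and `v` pass from the monic to the standard
polynomials. -/
theorem eq_of_diffProd_mul_eq_det_monicRec (b c : ℕ → ℂ) {m : ℕ} (hm : m + 1 = N + n)
    (hc : ∀ j, 1 ≤ j → j ≤ m → c j ≠ 0) {α : Fin (n + n) → ℂ} (hα : Function.Injective α) {M : ℂ}
    (hM : diffProd α * M =
      (Matrix.of fun i k : Fin (n + n) => (monicRec b c (N + i)).eval (α k)).det)
    {u v : ℂ} {f g : ℂ → ℂ} (hf : ∀ z, (monicRec b c (m + 1)).eval z = u * f z)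
    (hg : ∀ z, (monicRec b c m).eval z = v * g z) :
    M = (∏ s ∈ Finset.range n, ∏ t ∈ Finset.range s, (c (m - t))⁻¹) * (u * v) ^ n /
      (diffProd (firstHalf α) * diffProd (secondHalf α)) *
      (Matrix.of fun j k : Fin n => 1 / (firstHalf α j - secondHalf α k) *
        !![f (firstHalf α j), f (secondHalf α k);
          g (firstHalf α j), g (secondHalf α k)].det).det := by
  obtain ⟨h1, h2, h3⟩ := diffProd_half_ne_zero hα
  have hdet : (Matrix.of fun j k : Fin n => ((monicRec b c (m + 1)).eval (firstHalf α j) *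
      (monicRec b c m).eval (secondHalf α k) - (monicRec b c m).eval (firstHalf α j) *
      (monicRec b c (m + 1)).eval (secondHalf α k)) / (firstHalf α j - secondHalf α k)) =
      (u * v) • Matrix.of fun j k : Fin n => 1 / (firstHalf α j - secondHalf α k) *
        !![f (firstHalf α j), f (secondHalf α k);
          g (firstHalf α j), g (secondHalf α k)].det := by
    refine Matrix.ext fun j k => ?_
    simp only [Matrix.of_apply, Matrix.smul_apply, Matrix.det_fin_two_of, hf, hg, smul_eq_mul]
    ring
  rw [det_monicRec b c hm hc hα, hdet, Matrix.det_smul, Fintype.card_fin, diffProd_add] at hM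
  change diffProd (firstHalf α) * diffProd (secondHalf α) *
    (∏ j, ∏ k, (secondHalf α k - firstHalf α j)) * M = _ at hM
  generalize (Matrix.of fun j k : Fin n => 1 / (firstHalf α j - secondHalf α k) *
        !![f (firstHalf α j), f (secondHalf α k);
          g (firstHalf α j), g (secondHalf α k)].det).det = D at hM ⊢
  rw [div_mul_eq_mul_div, eq_div_iff (mul_ne_zero h1 h2)]
  refine mul_left_cancel₀ h3 ?_
  linear_combination hM

theorem eq_hermiteExpr {σ : ℝ} (hσ : 0 < σ) (hn : 1 ≤ n) {α : Fin (n + n) → ℂ}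
    (hα : Function.Injective α) {M : ℂ} (hM : diffProd α * M =
      (Matrix.of fun i k : Fin (n + n) => (hermiteMonic ((σ : ℂ) ^ 2) (N + i)).eval (α k)).det) :
    M = hermiteExpr N n σ α := by
  obtain ⟨k, rfl⟩ := Nat.exists_eq_add_of_le' hn
  have h := eq_of_diffProd_mul_eq_det_monicRec (N := N) 0 (fun j => j * (σ : ℂ) ^ 2) (m := N + k) rfl
    (fun j hj _ => mul_ne_zero (by exact_mod_cast (by omega : j ≠ 0))
      (pow_ne_zero 2 (Complex.ofReal_ne_zero.2 hσ.ne'))) hα hM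
    (fun z => eval_hermiteMonic hσ (N + k + 1) z) (fun z => eval_hermiteMonic hσ (N + k) z)
  have hconst := hermite_constant hσ N k
  rw [← Complex.ofReal_inj] at hconst
  push_cast at hconst
  rw [h, hermiteExpr]
  congr 2
  push_cast
  exact hconst

theorem eq_laguerreExpr {ν σ : ℝ} (hν : -1 < ν) (hσ : 0 < σ) (hn : 1 ≤ n) {α : Fin (n + n) → ℂ}
    (hα : Function.Injective α) {M : ℂ} (hM : diffProd α * M = (Matrix.of fun i k : Fin (n + n) =>
      (laguerreMonic ν ((2 * σ ^ 2 : ℝ) : ℂ) (N + i)).eval (α k)).det) :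
    M = laguerreExpr ν N n σ α := by
  have hs : 0 < 2 * σ ^ 2 := by positivity
  obtain ⟨k, rfl⟩ := Nat.exists_eq_add_of_le' hn
  have h := eq_of_diffProd_mul_eq_det_monicRec (N := N)
    (fun j => ((2 * σ ^ 2 : ℝ) : ℂ) * (2 * j + ν + 1))
    (fun j => ((2 * σ ^ 2 : ℝ) : ℂ) ^ 2 * (j * (j + ν))) (m := N + k) rfl
    (fun j hj _ => by
      have h1 : (1 : ℝ) ≤ j := by exact_mod_cast hj
      refine mul_ne_zero (pow_ne_zero 2 (Complex.ofReal_ne_zero.2 hs.ne')) (mul_ne_zero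
        (by exact_mod_cast (by omega : j ≠ 0)) ?_)
      exact_mod_cast (by linarith : (0 : ℝ) < j + ν).ne') hα hM
    (fun z => eval_laguerreMonic hs hν (N + k + 1) z) (fun z => eval_laguerreMonic hs hν (N + k) z)
  have hconst := laguerre_constant hν hs N k
  rw [← Complex.ofReal_inj] at hconst
  push_cast at hconst
  rw [h, laguerreExpr]
  push_cast
  rw [hconst]
  rfl

end Assembly

/-! ### The formulas for the individual ensembles. -/

section Ensembles

open Polynomial

variable {N n : ℕ} {σ : ℝ}

/-- Agreement on D transfers the limit from the continuous average to the expression, at coinciding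
arguments included. -/
theorem EqExtendedFrom.of_continuous {m : ℕ} {D : Set (Fin m → ℂ)} {f g : (Fin m → ℂ) → ℂ}
    (hf : Continuous f) (h : ∀ α ∈ D, f α = g α) : EqExtendedFrom D f g :=
  ⟨h, fun α => ((hf.tendsto α).mono_left nhdsWithin_le_nhds).congr'
    (eventually_nhdsWithin_of_forall h)⟩

theorem avgGUE_eq_hermiteExpr (hσ : 0 < σ) (hn : 1 ≤ n) {α : Fin (n + n) → ℂ}
    (hα : Function.Injective α) : avgGUE N σ α = hermiteExpr N n σ α :=
  eq_hermiteExpr hσ hn hα (diffProd_mul_avgGUE hσ (fun i => hermiteMonic ((σ : ℂ) ^ 2) (N + i))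
    (fun _ => degree_sub_X_pow_lt (monicRec_monic _ _ _) (natDegree_monicRec _ _ _))
    (fun _ => hermiteMonic_ode _ _) α)

theorem avgLaguerre_eq_laguerreExpr {ν : ℝ} (hν : -1 < ν) (hσ : 0 < σ) (hn : 1 ≤ n)
    {α : Fin (n + n) → ℂ} (hα : Function.Injective α) :
    avgLaguerre ν N σ α = laguerreExpr ν N n σ α :=
  eq_laguerreExpr hν hσ hn hα (diffProd_mul_avgLaguerre hν hσ N α)

theorem avgChGUE_eq_laguerreExpr (ν : ℕ) (hσ : 0 < σ) (hn : 1 ≤ n) {α : Fin (n + n) → ℂ}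
    (hα : Function.Injective α) : avgChGUE ν N σ α = laguerreExpr ν N n σ α :=
  eq_laguerreExpr (lt_of_lt_of_le (by norm_num) ν.cast_nonneg) hσ hn hα (diffProd_mul_avgChGUE hσ
    (fun i => laguerreMonic (ν : ℝ) ((2 * σ ^ 2 : ℝ) : ℂ) (N + i))
    (fun _ => degree_sub_X_pow_lt (monicRec_monic _ _ _) (natDegree_monicRec _ _ _))
    -- Twice the Laguerre equation of scale 2σ² is the eigenvalue equation of the chiral operator.
    (fun i => by
      have h := laguerreMonic_ode ((ν : ℝ) : ℂ) ((2 * σ ^ 2 : ℝ) : ℂ) (N + i)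
      simp only [spectralOp, Complex.ofReal_mul, Complex.ofReal_pow, Complex.ofReal_ofNat,
        Complex.ofReal_natCast, C_mul, C_add, C_pow, C_0, C_1, map_ofNat, zero_add] at h ⊢
      linear_combination 2 * h) α)

theorem avgClassC_eq_laguerreExpr (hσ : 0 < σ) (hn : 1 ≤ n) {α : Fin (n + n) → ℂ}
    (hα : Function.Injective fun i => α i ^ 2) :
    avgClassC N σ α = laguerreExpr (1 / 2) N n σ fun i => α i ^ 2 := by
  refine eq_laguerreExpr (by norm_num) hσ hn hα ?_
  have h := diffProd_mul_avgClassC (N := N) hσ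
    (fun i => expand ℂ 2 (laguerreMonic (1 / 2) (2 * (σ : ℂ) ^ 2) (N + i)))
    (fun i => degree_sub_X_pow_lt
      (monic_X.mul ((monicRec_monic _ _ _).expand (by norm_num))) (by
        rw [laguerreMonic, monic_X.natDegree_mul ((monicRec_monic _ _ _).expand (by norm_num)),
          natDegree_expand, natDegree_monicRec, natDegree_X]
        ring))
    (fun i => by
      rw [laguerreMonic_expand_ode_half]
      congr 3
      ring) α
  simpa [expand_eval] using h

theorem avgClassD_eq_laguerreExpr (hσ : 0 < σ) (hn : 1 ≤ n) {α : Fin (n + n) → ℂ}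
    (hα : Function.Injective fun i => α i ^ 2) :
    avgClassD N σ α = laguerreExpr (-1 / 2) N n σ fun i => α i ^ 2 := by
  refine eq_laguerreExpr (by norm_num) hσ hn hα ?_
  have h := diffProd_mul_avgClassD (N := N) hσ
    (fun i => expand ℂ 2 (laguerreMonic (-1 / 2) (2 * (σ : ℂ) ^ 2) (N + i)))
    (fun i => degree_sub_X_pow_lt ((monicRec_monic _ _ _).expand (by norm_num)) (by
        rw [natDegree_expand, laguerreMonic, natDegree_monicRec]
        ring))
    (fun i => by
      rw [laguerreMonic_expand_ode_neg_half]
      congr 3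
      ring) α
  simpa [expand_eval] using h

end Ensembles

theorem theorem2 (N n : ℕ) (hN : 1 ≤ N) (hn : 1 ≤ n) (σ : ℝ) (hσ : 0 < σ) :
    -- GUE
    ((∀ α : Fin (n + n) → ℂ, Integrable (fun g => charProd α (hermitianMatrix g))
        (iidGaussian (EntryIdx N N) σ)) ∧
      EqExtendedFrom {α : Fin (n + n) → ℂ | Function.Injective α}
        (avgGUE N σ) (hermiteExpr N n σ)) ∧
    -- Laguerre-type ensembles of real index
    (∀ ν : ℝ, -1 < ν →
      (∀ α : Fin (n + n) → ℂ,
        IntegrableOn (laguerreIntegrand ν N σ α) {x : Fin N → ℝ | ∀ j, 0 ≤ x j}) ∧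
      EqExtendedFrom {α : Fin (n + n) → ℂ | Function.Injective α}
        (avgLaguerre ν N σ) (laguerreExpr ν N n σ)) ∧
    -- chiral GUE
    (∀ ν : ℕ,
      (∀ α : Fin (n + n) → ℂ, Integrable (fun g => charProd α ((cplxMatrix g)ᴴ * cplxMatrix g))
        (iidGaussian (EntryIdx (N + ν) N) σ)) ∧
      EqExtendedFrom {α : Fin (n + n) → ℂ | Function.Injective α}
        (avgChGUE ν N σ) (laguerreExpr ν N n σ)) ∧
    -- class C
    ((∀ α : Fin (n + n) → ℂ, Integrable (fun g => charProd α (classCMatrix g))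
        (iidGaussian (EntryIdx N N ⊕ EntryIdx N N) σ)) ∧
      EqExtendedFrom {α : Fin (n + n) → ℂ | Function.Injective fun i => α i ^ 2}
        (avgClassC N σ) (fun α => laguerreExpr (1 / 2) N n σ fun i => α i ^ 2)) ∧
    -- class D
    ((∀ α : Fin (n + n) → ℂ, Integrable (fun g => charProd α (classDMatrix g))
        (iidGaussian (Fin (2 * N) × Fin (2 * N)) σ)) ∧
      EqExtendedFrom {α : Fin (n + n) → ℂ | Function.Injective fun i => α i ^ 2}
        (avgClassD N σ) (fun α => laguerreExpr (-1 / 2) N n σ fun i => α i ^ 2)) := by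
  refine ⟨⟨integrable_charProd_GUE σ, .of_continuous continuous_avgGUE fun α hα =>
      avgGUE_eq_hermiteExpr hσ hn hα⟩,
    fun ν hν => ⟨integrableOn_laguerreIntegrand hν hσ N,
      .of_continuous (continuous_avgLaguerre hν hσ N) fun α hα =>
        avgLaguerre_eq_laguerreExpr hν hσ hn hα⟩,
    fun ν => ⟨integrable_charProd_chGUE σ, .of_continuous continuous_avgChGUE fun α hα =>
      avgChGUE_eq_laguerreExpr ν hσ hn hα⟩,
    ⟨integrable_charProd_classC σ, .of_continuous continuous_avgClassC fun α hα =>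
      avgClassC_eq_laguerreExpr hσ hn hα⟩,
    ⟨integrable_charProd_classD σ, .of_continuous continuous_avgClassD fun α hα =>
      avgClassD_eq_laguerreExpr hσ hn hα⟩⟩
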